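/- Let $\mathbb T\subset\mathbb R$ be an interval (finite or infinite), let $\Theta\subset\mathbb R^d$ be open, convex and bounded, and for $\vartheta\in\Theta$ let $\lambda(\vartheta,\cdot):\mathbb T\to(0,\infty)$ be a Borel function with $\int_{\mathbb T}\lambda(\vartheta,t)\,dt<\infty$. Let $\ell=\ln\lambda$, let a dot denote the gradient in $\vartheta$, and let $$\mathbf I(\vartheta)=\int_{\mathbb T}\dot\lambda(\vartheta,t)\dot\lambda(\vartheta,t)^{\tau}\lambda(\vartheta,t)^{-1}\,dt$$ be the Fisher information matrix. Let $\vartheta_0\in\Theta$ be the true value and let $X_1,X_2,\ldots$ be independent Poisson processes on $\mathbb T$ with intensity function $\lambda(\vartheta_0,\cdot)$; $X_j(t)$ is the number of events of the $j$-th process in $\mathbb T\cap(-\infty,t]$. Assume: ($\mathcal L_0$) for every $t\in\mathbb T$ the function $\vartheta\mapsto\ell(\vartheta,t)$ has continuous derivatives on $\Theta$ up to order three, the derivatives of orders one, two and three are bounded uniformly in $(\vartheta,t)\in\Theta\times\mathbb T$, and $\inf_{\vartheta\in\Theta}\inf_{|\mu|=1}\mu^\tau\mathbf I(\vartheta)\mu>0$;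 ($\mathcal P_0$) for each $n$ there is a preliminary estimator $\bar\vartheta_n$, a function of $X_1,\ldots,X_n$ with values in $\mathbb R^d$, such that $\bar\vartheta_n\to\vartheta_0$ in probability and $\sqrt n(\bar\vartheta_n-\vartheta_0)$ is bounded in probability. Let $\delta\in(1/2,1)$ and $N=[n^\delta]$, where $[a]$ is the integer part of $a$. The one-step MLE-process is $$\vartheta^\star_{k,n}=\bar\vartheta_N+\mathbf I(\bar\vartheta_N)^{-1}\frac1k\sum_{j=N+1}^{k}\int_{\mathbb T}\dot\ell(\bar\vartheta_N,t)\,\bigl[dX_j(t)-\lambda(\bar\vartheta_N,t)\,dt\bigr],\qquad k=N+1,\ldots,n,$$ if $\bar\vartheta_N\in\Theta$, and $\vartheta^\star_{k,n}=\bar\vartheta_N$ otherwise. Then: 1. for $N<k\le n$ the estimator $\vartheta^\star_{k,n}$ is a function of the first $k$ observations $X_1,\ldots,X_k$ only; 2. the process is consistent: for every $\varepsilon>0$, $\ P\bigl(\max_{N<k\le n}|\vartheta^\star_{k,n}-\vartheta_0|\ge\varepsilon\bigr)\to0$ as $n\to\infty$; in particular each $\vartheta^\star_{k,n}$ with $k=k_n$,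 $N<k_n\le n$, converges to $\vartheta_0$ in probability; 3. it is asymptotically normal: for every $s\in(0,1]$, with $k=[sn]$, $$\sqrt k\,\bigl(\vartheta^\star_{k,n}-\vartheta_0\bigr)\Longrightarrow\mathcal N\bigl(0,\mathbf I(\vartheta_0)^{-1}\bigr)\qquad(n\to\infty).$$ (For the finitely many $n$ with $[sn]\le N$ the sum is empty and $\vartheta^\star_{k,n}$ is read as $\bar\vartheta_N$.) -/

import Mathlib

open MeasureTheory ProbabilityTheory Filter Topology

noncomputable section

/-- The family `lam θ t`, `θ ∈ Θ`, `t ∈ T`, is a family of intensity functions on the observation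
window `T`: each `lam θ` is positive, Borel on `T` and has a finite integral over `T`.
Values of `lam` outside `Θ × T` play no role. -/
structure IsIntensityFamily {d : ℕ} (T : Set ℝ) (Θ : Set (EuclideanSpace ℝ (Fin d)))
    (lam : EuclideanSpace ℝ (Fin d) → ℝ → ℝ) : Prop where
  pos : ∀ θ ∈ Θ, ∀ t ∈ T, 0 < lam θ t
  measurable : ∀ θ ∈ Θ, Measurable (T.domRestrict (lam θ))
  integrableOn : ∀ θ ∈ Θ, IntegrableOn (lam θ) T

/-- `X` is a Poisson process on the window `T` with intensity function `r`, defined on the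
probability space `(Ω, P)`. The value `X ω t` is the number of events in `T ∩ (-∞, t]`; a path is
thus given for all real `t` (with no events outside `T`), and is nondecreasing and
right-continuous, which is what `StieltjesFunction ℝ` bundles. -/
structure IsPoissonProcess {Ω : Type*} [MeasurableSpace Ω] (P : Measure Ω)
    (T : Set ℝ) (r : ℝ → ℝ) (X : Ω → StieltjesFunction ℝ) : Prop where
  measurable : ∀ t : ℝ, Measurable (fun ω => X ω t)
  counting : ∀ ω, ∀ t : ℝ, ∃ m : ℕ, X ω t = m
  start : ∀ᵐ ω ∂P, Tendsto (fun t : ℝ => X ω t) atBot (𝓝 0)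
  increment_law : ∀ a b : ℝ, a ≤ b →
    HasLaw (fun ω => X ω b - X ω a)
      ((poissonMeasure (∫ t in Set.Ioc a b ∩ T, r t).toNNReal).map (Nat.cast : ℕ → ℝ)) P
  indep_increments : HasIndepIncrements (fun (t : ℝ) ω => X ω t) P

/-- The σ-algebra generated by the process `Y`. -/
abbrev pathSigma {Ω : Type*} (Y : Ω → StieltjesFunction ℝ) : MeasurableSpace Ω :=
  ⨆ t : ℝ, MeasurableSpace.comap (fun ω => Y ω t) (borel ℝ)

/-- The σ-algebra generated by the first `n` observations `X 0, …, X (n - 1)`. -/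
abbrev obsSigma {Ω : Type*} (X : ℕ → Ω → StieltjesFunction ℝ) (n : ℕ) : MeasurableSpace Ω :=
  ⨆ j ∈ Finset.range n, pathSigma (X j)

/-- The observations `X 0, X 1, …` are independent Poisson processes on `T` with the same
intensity function `r`. -/
structure IsPoissonSample {Ω : Type*} [MeasurableSpace Ω] (P : Measure Ω)
    (T : Set ℝ) (r : ℝ → ℝ) (X : ℕ → Ω → StieltjesFunction ℝ) : Prop where
  poisson : ∀ j, IsPoissonProcess P T r (X j)
  indep : iIndep (fun j => pathSigma (X j)) P

/-- The Fisher information matrix `∫_T (∂_θ lam) (∂_θ lam)ᵀ / lam dt`. -/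
def fisherInfo {d : ℕ} (T : Set ℝ) (lam : EuclideanSpace ℝ (Fin d) → ℝ → ℝ)
    (θ : EuclideanSpace ℝ (Fin d)) : Matrix (Fin d) (Fin d) ℝ :=
  Matrix.of fun i j => ∫ t in T,
    gradient (fun θ' => lam θ' t) θ i * gradient (fun θ' => lam θ' t) θ j / lam θ t

/-- The score function: the gradient in `θ` of `log lam θ t`. -/
def score {d : ℕ} (lam : EuclideanSpace ℝ (Fin d) → ℝ → ℝ)
    (θ : EuclideanSpace ℝ (Fin d)) (t : ℝ) : EuclideanSpace ℝ (Fin d) :=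
  gradient (fun θ' => Real.log (lam θ' t)) θ

/-- The regularity conditions on the intensities: `log lam θ t` has three continuous derivatives
in `θ`, bounded uniformly in `θ ∈ Θ` and `t ∈ T`, and the Fisher information is uniformly
nondegenerate on `Θ`. -/
structure RegularityL0 {d : ℕ} (T : Set ℝ) (Θ : Set (EuclideanSpace ℝ (Fin d)))
    (lam : EuclideanSpace ℝ (Fin d) → ℝ → ℝ) : Prop where
  smooth : ∀ t ∈ T, ContDiffOn ℝ 3 (fun θ => Real.log (lam θ t)) Θ
  bounded : ∃ C : ℝ, ∀ m : ℕ, 1 ≤ m → m ≤ 3 → ∀ θ ∈ Θ, ∀ t ∈ T,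
    ‖iteratedFDeriv ℝ m (fun θ' => Real.log (lam θ' t)) θ‖ ≤ C
  nondegenerate : ∃ c : ℝ, 0 < c ∧ ∀ θ ∈ Θ, ∀ u : EuclideanSpace ℝ (Fin d), ‖u‖ = 1 →
    c ≤ inner ℝ u (Matrix.toEuclideanLin (fisherInfo T lam θ) u)

/-- The condition on the preliminary estimators: `θbar n` is a function of the first `n`
observations, is consistent, and `√n (θbar n - θ₀)` is bounded in probability. -/
structure PreliminaryP0 {d : ℕ} {Ω : Type*} [MeasurableSpace Ω] (P : Measure Ω)
    (X : ℕ → Ω → StieltjesFunction ℝ) (θ₀ : EuclideanSpace ℝ (Fin d))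
    (θbar : ℕ → Ω → EuclideanSpace ℝ (Fin d)) : Prop where
  estimator : ∀ n, Measurable[obsSigma X n] (θbar n)
  consistent : TendstoInMeasure P θbar atTop (fun _ => θ₀)
  bounded_in_prob : ∀ ε : ENNReal, 0 < ε → ∃ M : ℝ, ∀ n : ℕ,
    P {ω | M < ‖√(n : ℝ) • (θbar n ω - θ₀)‖} ≤ ε

/-- The size `N = [n ^ δ]` of the learning sample. -/
def learnSize (δ : ℝ) (n : ℕ) : ℕ := ⌊(n : ℝ) ^ δ⌋₊

open Classical in
/-- The one-step MLE based on the first `k` observations, of which the first `N` are used for the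
preliminary estimator `θbar N`:
`θbar_N + I(θbar_N)⁻¹ (1/k) ∑_{N < j ≤ k} ∫_T score(θbar_N, t) [dX_j(t) - lam(θbar_N, t) dt]`.
The `j`-th observation (counted from one) is `X (j - 1)`. The formula makes sense only if `θbar_N`
lies in the parameter set `Θ`; otherwise no correction is made. -/
def oneStepMLE {d : ℕ} {Ω : Type*} (T : Set ℝ) (Θ : Set (EuclideanSpace ℝ (Fin d)))
    (lam : EuclideanSpace ℝ (Fin d) → ℝ → ℝ) (X : ℕ → Ω → StieltjesFunction ℝ)
    (θbar : ℕ → Ω → EuclideanSpace ℝ (Fin d)) (N k : ℕ) (ω : Ω) : EuclideanSpace ℝ (Fin d) :=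
  if θbar N ω ∈ Θ then
    θbar N ω + Matrix.toEuclideanLin (fisherInfo T lam (θbar N ω))⁻¹
      ((k : ℝ)⁻¹ • ∑ j ∈ Finset.Ico N k,
        ((∫ t in T, score lam (θbar N ω) t ∂(X j ω).measure)
          - ∫ t in T, lam (θbar N ω) t • score lam (θbar N ω) t))
  else θbar N ω

end

/-!
Expand the one-step estimator around `θ₀`. Each observation beyond the `N`-th contributes to the
score at `θbar N` a bias `-I(θbar N)(θbar N - θ₀)` up to a quadratic term, so the correction cancels
the preliminary error `ρ = ‖θbar N - θ₀‖` except for `(N / k) ρ` and a term of order `ρ ^ 2`, and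
leaves the centered score at `θ₀` of the observations `N < j ≤ k`. Since `√N ρ` is bounded in
probability, `√k ((N / k) ρ + ρ ^ 2)` is of order `√(N / k) + √k / N`, which vanishes because
`N ~ n ^ δ` with `1 / 2 < δ < 1`.

Uniformity in `k` comes from the strong law of large numbers, applied along an arbitrary choice
`k = κ n ω > N`. Asymptotic normality comes from the exponential formula for the characteristic
function of a Poisson integral, `exp (∫ (exp (i f) - 1) dΛ)`, which holds for step functions by
independence of increments and passes to `L¹` limits. As `θbar N` is random, the score at `θbar N`
is replaced by its first order expansion at `θ₀`, whose remainder is bounded pointwise by a multiple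
of `ρ ^ 2` and hence needs only a law of large numbers for the number of events.
-/

section StieltjesKernel

variable {Ω : Type*} [MeasurableSpace Ω]

/-- The random measure `ω ↦ (X ω).measure` cut down to `(a, b]`, as a kernel. -/
noncomputable def stieltjesKernelIoc (X : Ω → StieltjesFunction ℝ)
    (hX : ∀ t, Measurable fun ω => X ω t) (a b : ℝ) : Kernel Ω ℝ where
  toFun ω := (X ω).measure.restrict (Set.Ioc a b)
  measurable' := by
    have : ∀ ω, IsFiniteMeasure ((X ω).measure.restrict (Set.Ioc a b)) := fun ω =>
      ⟨by simp [StieltjesFunction.measure_Ioc]⟩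
    have hIoc (u v : ℝ) : Measurable fun ω => (X ω).measure (Set.Ioc u v) := by
      simpa only [StieltjesFunction.measure_Ioc] using Measurable.ennreal_ofReal (by fun_prop)
    refine Measurable.measure_of_isPiSystem (S := {S | ∃ l u : ℝ, l < u ∧ Set.Ioc l u = S})
      (borel_eq_generateFrom_Ioc ℝ ▸ BorelSpace.measurable_eq) (isPiSystem_Ioc id id) ?_ ?_
    · rintro _ ⟨l, u, -, rfl⟩
      simpa only [Measure.restrict_apply measurableSet_Ioc, Set.Ioc_inter_Ioc] using hIoc _ _
    · simpa only [Measure.restrict_apply MeasurableSet.univ, Set.univ_inter] using hIoc _ _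

/-- The random measure `ω ↦ (X ω).measure` as a kernel; it is assembled from unit intervals, so
that it is visibly s-finite. -/
noncomputable def stieltjesKernel (X : Ω → StieltjesFunction ℝ)
    (hX : ∀ t, Measurable fun ω => X ω t) : Kernel Ω ℝ :=
  Kernel.sum fun n : ℤ => stieltjesKernelIoc X hX n (n + 1)

lemma stieltjesKernel_apply (X : Ω → StieltjesFunction ℝ)
    (hX : ∀ t, Measurable fun ω => X ω t) (ω : Ω) :
    stieltjesKernel X hX ω = (X ω).measure := by
  have h := Measure.restrict_iUnion (μ := (X ω).measure) (Set.pairwise_disjoint_Ioc_intCast ℝ)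
    fun n => measurableSet_Ioc
  rw [iUnion_Ioc_intCast, Measure.restrict_univ] at h
  rw [stieltjesKernel, Kernel.sum_apply, h]
  rfl

lemma isSFiniteKernel_of_forall_isFiniteMeasure {β : Type*} [MeasurableSpace β] (κ : Kernel Ω β)
    [hκ : ∀ ω, IsFiniteMeasure (κ ω)] : IsSFiniteKernel κ := by
  classical
  have hs (m : ℕ) : MeasurableSet {ω | ⌈(κ ω).real Set.univ⌉₊ = m} :=
    (κ.measurable_coe MeasurableSet.univ).ennreal_toReal.nat_ceil (measurableSet_singleton m)
  have hfin (m : ℕ) : IsFiniteKernel (Kernel.piecewise (hs m) κ 0) :=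
    ⟨⟨m, by simp, fun ω => by
      rw [Kernel.piecewise_apply]
      split_ifs with hω
      · rw [← ofReal_measureReal, ← ENNReal.ofReal_natCast]
        exact ENNReal.ofReal_le_ofReal (Nat.ceil_le.1 (le_of_eq hω))
      · simp⟩⟩
  have hsum : κ = Kernel.sum fun m : ℕ => Kernel.piecewise (hs m) κ 0 := by
    ext ω s hS
    rw [Kernel.sum_apply' _ _ hS, tsum_eq_single ⌈(κ ω).real Set.univ⌉₊]
    · simp [Kernel.piecewise_apply]
    · intro m hm
      rw [Kernel.piecewise_apply, if_neg fun h => hm h.symm]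
      simp
  rw [hsum]
  exact Kernel.isSFiniteKernel_sum

instance isSFiniteKernel_stieltjesKernel (X : Ω → StieltjesFunction ℝ)
    (hX : ∀ t, Measurable fun ω => X ω t) : IsSFiniteKernel (stieltjesKernel X hX) := by
  have (n : ℤ) (ω : Ω) : IsFiniteMeasure (stieltjesKernelIoc X hX n (n + 1) ω) :=
    ⟨by
      change (X ω).measure.restrict (Set.Ioc (n : ℝ) (n + 1)) Set.univ < ⊤
      simp [StieltjesFunction.measure_Ioc]⟩
  have (n : ℤ) := isSFiniteKernel_of_forall_isFiniteMeasure (stieltjesKernelIoc X hX n (n + 1))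
  exact Kernel.isSFiniteKernel_sum

lemma measurable_integral_stieltjes {E : Type*} [NormedAddCommGroup E] [NormedSpace ℝ E]
    [SecondCountableTopology E] [MeasurableSpace E] [BorelSpace E]
    (X : Ω → StieltjesFunction ℝ) (hX : ∀ t, Measurable fun ω => X ω t) {g : Ω → ℝ → E}
    (hg : Measurable (Function.uncurry g)) :
    Measurable fun ω => ∫ t, g ω t ∂(X ω).measure := by
  have h := hg.stronglyMeasurable.integral_kernel_prod_right' (κ := stieltjesKernel X hX)
  simp only [stieltjesKernel_apply] at h
  exact h.measurable

end StieltjesKernel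

section PoissonMean

lemma hasSum_poisson_mul_nat (r : NNReal) :
    HasSum (fun n : ℕ => Real.exp (-r) * (r : ℝ) ^ n / (n.factorial : ℝ) * n) r := by
  rw [← hasSum_nat_add_iff' 1]
  simp only [Finset.range_one, Finset.sum_singleton, Nat.cast_zero, mul_zero, sub_zero]
  refine ((mul_one (r : ℝ)) ▸ (hasSum_one_poissonMeasure r).mul_left (r : ℝ)).congr_fun fun n => ?_
  rw [Nat.factorial_succ]
  push_cast
  field_simp
  ring

lemma lintegral_ofReal_map_cast_poissonMeasure (r : NNReal) :
    ∫⁻ x, ENNReal.ofReal x ∂((poissonMeasure r).map (Nat.cast : ℕ → ℝ)) = r := by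
  have hint : Integrable (fun n : ℕ => (n : ℝ)) (poissonMeasure r) :=
    integrable_poissonMeasure_iff.2 ((hasSum_poisson_mul_nat r).summable.congr fun n => by simp)
  rw [lintegral_map ENNReal.measurable_ofReal .of_discrete,
    ← ofReal_integral_eq_lintegral_ofReal hint (ae_of_all _ fun n => n.cast_nonneg),
    integral_poissonMeasure' hint]
  simp only [smul_eq_mul, (hasSum_poisson_mul_nat r).tsum_eq, ENNReal.ofReal_coe_nnreal]

end PoissonMean

section StepFunctions

variable {E : Type*} [NormedAddCommGroup E]

/-- The step function with value `c j` on `(t j, t (j + 1)]` for `j < K`, and zero elsewhere. -/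
noncomputable def stepFun (K : ℕ) (t : ℕ → ℝ) (c : ℕ → E) (x : ℝ) : E :=
  ∑ j ∈ Finset.range K, (Set.Ioc (t j) (t (j + 1))).indicator (fun _ => c j) x

lemma stronglyMeasurable_stepFun (K : ℕ) (t : ℕ → ℝ) (c : ℕ → E) :
    StronglyMeasurable (stepFun K t c) :=
  Finset.stronglyMeasurable_fun_sum _ fun _ _ =>
    stronglyMeasurable_const.indicator measurableSet_Ioc

lemma stepFun_of_mem {K : ℕ} {t : ℕ → ℝ} (ht : Monotone t) (c : ℕ → E) {x : ℝ} {j : ℕ}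
    (hj : j < K) (hx : x ∈ Set.Ioc (t j) (t (j + 1))) : stepFun K t c x = c j := by
  rw [stepFun, Finset.sum_eq_single_of_mem j (Finset.mem_range.2 hj), Set.indicator_of_mem hx]
  exact fun i _ hij => Set.indicator_of_notMem
    (fun hi => (ht.pairwise_disjoint_on_Ioc_succ hij).notMem_of_mem_left hi hx) _

lemma exists_mem_Ioc_succ {K : ℕ} {t : ℕ → ℝ} (ht : Monotone t) {x : ℝ}
    (hx : x ∈ Set.Ioc (t 0) (t K)) : ∃ j < K, x ∈ Set.Ioc (t j) (t (j + 1)) := by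
  rw [← ht.biUnion_Ico_Ioc_map_succ] at hx
  simpa [and_assoc, and_left_comm] using hx

lemma stepFun_of_notMem {K : ℕ} {t : ℕ → ℝ} (ht : Monotone t) (c : ℕ → E) {x : ℝ}
    (hx : x ∉ Set.Ioc (t 0) (t K)) : stepFun K t c x = 0 :=
  Finset.sum_eq_zero fun j hj => Set.indicator_of_notMem
    (fun h => hx ⟨(ht j.zero_le).trans_lt h.1, h.2.trans (ht (Finset.mem_range.1 hj))⟩) _

lemma comp_stepFun {F : Type*} [NormedAddCommGroup F] {φ : E → F} (hφ : φ 0 = 0) (K : ℕ)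
    {t : ℕ → ℝ} (ht : Monotone t) (c : ℕ → E) (x : ℝ) :
    φ (stepFun K t c x) = stepFun K t (φ ∘ c) x := by
  by_cases hx : x ∈ Set.Ioc (t 0) (t K)
  · obtain ⟨j, hj, hxj⟩ := exists_mem_Ioc_succ ht hx
    rw [stepFun_of_mem ht c hj hxj, stepFun_of_mem ht _ hj hxj, Function.comp_apply]
  · rw [stepFun_of_notMem ht c hx, stepFun_of_notMem ht _ hx, hφ]

lemma integrable_stepFun (μ : Measure ℝ) [IsLocallyFiniteMeasure μ] (K : ℕ) (t : ℕ → ℝ)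
    (c : ℕ → E) : Integrable (stepFun K t c) μ :=
  integrable_finsetSum _ fun _ _ =>
    (integrable_indicator_iff measurableSet_Ioc).2 (integrableOn_const measure_Ioc_lt_top.ne)

lemma integral_stepFun [NormedSpace ℝ E] [CompleteSpace E] (μ : Measure ℝ)
    [IsLocallyFiniteMeasure μ] (K : ℕ) (t : ℕ → ℝ) (c : ℕ → E) :
    ∫ x, stepFun K t c x ∂μ =
      ∑ j ∈ Finset.range K, μ.real (Set.Ioc (t j) (t (j + 1))) • c j := by
  simp only [stepFun]
  rw [integral_finsetSum _ fun _ _ => (integrable_indicator_iff measurableSet_Ioc).2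
    (integrableOn_const measure_Ioc_lt_top.ne)]
  exact Finset.sum_congr rfl fun j _ => integral_indicator_const _ measurableSet_Ioc

lemma exists_stepFun_forall_norm_sub_le {f : ℝ → E} (hf : Continuous f) (hc : HasCompactSupport f)
    {ε : ℝ} (hε : 0 < ε) :
    ∃ (K : ℕ) (t : ℕ → ℝ) (c : ℕ → E), Monotone t ∧ ∀ x, ‖f x - stepFun K t c x‖ ≤ ε := by
  obtain ⟨δ, hδ, hδf⟩ := Metric.uniformContinuous_iff.1
    (hc.uniformContinuous_of_continuous hf) ε hε
  obtain ⟨R, hR⟩ := hc.isCompact.isBounded.subset_closedBall 0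
  obtain ⟨M, hM⟩ := exists_nat_gt R
  obtain ⟨n, hn⟩ := exists_nat_one_div_lt hδ
  set t : ℕ → ℝ := fun j => -M + j * (1 / (n + 1)) with ht_def
  have ht : Monotone t := fun i j hij => by
    simp only [ht_def]
    gcongr
  have hgap (j : ℕ) : t (j + 1) - t j = 1 / (n + 1) := by
    simp only [ht_def]
    push_cast
    ring
  refine ⟨2 * M * (n + 1), t, fun j => f (t (j + 1)), ht, fun x => ?_⟩
  by_cases hx : x ∈ Set.Ioc (t 0) (t (2 * M * (n + 1)))
  · obtain ⟨j, hj, hxj⟩ := exists_mem_Ioc_succ ht hx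
    rw [stepFun_of_mem ht _ hj hxj, ← dist_eq_norm]
    refine (hδf ?_).le
    rw [Real.dist_eq, abs_lt]
    constructor <;> linarith [hxj.1, hxj.2, hgap j]
  · have hlast : t (2 * M * (n + 1)) = M := by
      simp only [ht_def]
      push_cast
      field_simp
      ring
    rw [hlast, show t 0 = -M by simp [ht_def]] at hx
    have hfx : f x = 0 := by
      by_contra hne
      have hxR := mem_closedBall_zero_iff.1 (hR (subset_tsupport f hne))
      obtain ⟨h₁, h₂⟩ := abs_le.1 (Real.norm_eq_abs x ▸ hxR)
      exact hx ⟨by linarith, by linarith⟩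
    rw [stepFun_of_notMem ht _ (by rwa [hlast, show t 0 = -M by simp [ht_def]]), hfx, sub_zero,
      norm_zero]
    exact hε.le

lemma exists_stepFun_integral_norm_sub_le [NormedSpace ℝ E] (μ : Measure ℝ) [IsFiniteMeasure μ]
    {g : ℝ → E} (hg : Integrable g μ) {ε : ℝ} (hε : 0 < ε) :
    ∃ (K : ℕ) (t : ℕ → ℝ) (c : ℕ → E), Monotone t ∧ ∫ x, ‖g x - stepFun K t c x‖ ∂μ ≤ ε := by
  obtain ⟨f, hfc, hfg, hf, hfi⟩ := hg.exists_hasCompactSupport_integral_sub_le (half_pos hε)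
  have hμ : 0 < 2 * (μ.real Set.univ + 1) := by positivity
  obtain ⟨K, t, c, ht, hs⟩ := exists_stepFun_forall_norm_sub_le hf hfc (div_pos hε hμ)
  have hsi := integrable_stepFun μ K t c
  refine ⟨K, t, c, ht, ?_⟩
  calc ∫ x, ‖g x - stepFun K t c x‖ ∂μ
      ≤ ∫ x, (‖g x - f x‖ + ‖f x - stepFun K t c x‖) ∂μ :=
        integral_mono (hg.sub hsi).norm ((hg.sub hfi).norm.add (hfi.sub hsi).norm) fun x =>
          norm_sub_le_norm_sub_add_norm_sub _ _ _
    _ = ∫ x, ‖g x - f x‖ ∂μ + ∫ x, ‖f x - stepFun K t c x‖ ∂μ :=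
        integral_add (hg.sub hfi).norm (hfi.sub hsi).norm
    _ ≤ ε / 2 + ∫ _, ε / (2 * (μ.real Set.univ + 1)) ∂μ :=
        add_le_add hfg (integral_mono (hfi.sub hsi).norm (integrable_const _) hs)
    _ ≤ ε / 2 + ε / 2 := by
        rw [integral_const, smul_eq_mul, mul_div_assoc', add_le_add_iff_left, div_le_iff₀ hμ]
        linarith
    _ = ε := add_halves ε

end StepFunctions

section CharacteristicExponent

lemma norm_cexp_ofReal_mul_I_sub_le (a b : ℝ) :
    ‖Complex.exp (a * Complex.I) - Complex.exp (b * Complex.I)‖ ≤ |a - b| := by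
  have h : Complex.exp (a * Complex.I) - Complex.exp (b * Complex.I) =
      Complex.exp (b * Complex.I) * (Complex.exp (Complex.I * ((a - b : ℝ) : ℂ)) - 1) := by
    rw [mul_sub, ← Complex.exp_add]
    push_cast
    ring_nf
  rw [h, norm_mul, Complex.norm_exp_ofReal_mul_I, one_mul]
  exact Real.norm_exp_I_mul_ofReal_sub_one_le

variable {α : Type*} [MeasurableSpace α] {μ : Measure α} {g₁ g₂ : α → ℝ}

lemma integrable_cexp_mul_I_sub_one (h : Integrable g₁ μ) :
    Integrable (fun x => Complex.exp (g₁ x * Complex.I) - 1) μ := by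
  have hcont : Continuous fun y : ℝ => Complex.exp (y * Complex.I) - 1 := by fun_prop
  refine h.mono (hcont.comp_aestronglyMeasurable h.1) (ae_of_all _ fun x => ?_)
  simpa using norm_cexp_ofReal_mul_I_sub_le (g₁ x) 0

lemma norm_integral_cexp_mul_I_sub_le (h₁ : Integrable g₁ μ) (h₂ : Integrable g₂ μ) :
    ‖∫ x, (Complex.exp (g₁ x * Complex.I) - 1) ∂μ - ∫ x, (Complex.exp (g₂ x * Complex.I) - 1) ∂μ‖
      ≤ ∫ x, |g₁ x - g₂ x| ∂μ := by
  rw [← integral_sub (integrable_cexp_mul_I_sub_one h₁) (integrable_cexp_mul_I_sub_one h₂)]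
  refine norm_integral_le_of_norm_le (h₁.sub h₂).abs (ae_of_all _ fun x => ?_)
  rw [sub_sub_sub_cancel_right]
  exact norm_cexp_ofReal_mul_I_sub_le _ _

lemma inner_integral_left {E : Type*} [NormedAddCommGroup E] [InnerProductSpace ℝ E]
    [CompleteSpace E] {f : α → E} (hf : Integrable f μ) (u : E) :
    inner ℝ (∫ x, f x ∂μ) u = ∫ x, inner ℝ (f x) u ∂μ := by
  simp only [real_inner_comm u]
  exact (integral_inner hf u).symm

end CharacteristicExponent

section PoissonFunctional

variable {Ω : Type*} [MeasurableSpace Ω]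

/-- The increments of the process `X` are independent, and the increment over `(a, b]` has the
Poisson distribution with mean `Λ (a, b]`. No window enters: events outside the window of
observation are excluded by the choice of `Λ`. -/
structure HasPoissonIncrements (P : Measure Ω) (Λ : Measure ℝ)
    (X : Ω → StieltjesFunction ℝ) : Prop where
  measurable : ∀ t : ℝ, Measurable fun ω => X ω t
  law : ∀ a b : ℝ, a ≤ b → HasLaw (fun ω => X ω b - X ω a)
    ((poissonMeasure (Λ (Set.Ioc a b)).toNNReal).map (Nat.cast : ℕ → ℝ)) P
  indep_increments : HasIndepIncrements (fun (t : ℝ) ω => X ω t) P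

namespace HasPoissonIncrements

variable {P : Measure Ω} {Λ : Measure ℝ} {X : Ω → StieltjesFunction ℝ} {E : Type*}
  [NormedAddCommGroup E]

lemma measurable_integral [NormedSpace ℝ E] [SecondCountableTopology E]
    [MeasurableSpace E] [BorelSpace E] (h : HasPoissonIncrements P Λ X) {f : ℝ → E}
    (hf : Measurable f) :
    Measurable fun ω => ∫ t, f t ∂(X ω).measure :=
  measurable_integral_stieltjes X h.measurable (g := fun _ => f) (hf.comp measurable_snd)

lemma charFun_map_mul_increment (h : HasPoissonIncrements P Λ X) {a b : ℝ} (hab : a ≤ b)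
    (c : ℝ) : charFun (P.map fun ω => c * (X ω b - X ω a)) 1 =
      Complex.exp (Λ.real (Set.Ioc a b) * (Complex.exp (c * Complex.I) - 1)) := by
  have hmap : (P.map fun ω => c * (X ω b - X ω a)) =
      (P.map fun ω => X ω b - X ω a).map (c * ·) := by
    rw [AEMeasurable.map_map_of_aemeasurable (by fun_prop) (h.law a b hab).aemeasurable]
    rfl
  rw [hmap, charFun_map_mul, (h.law a b hab).map_eq, charFun_map_cast_poissonMeasure, mul_one]
  rfl

variable [IsFiniteMeasure Λ]

lemma bind_stieltjesKernel (h : HasPoissonIncrements P Λ X) :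
    P.bind (stieltjesKernel X h.measurable) = Λ := by
  refine (Measure.ext_of_Ioc _ _ fun a b hab => ?_).symm
  have hmean := lintegral_ofReal_map_cast_poissonMeasure (Λ (Set.Ioc a b)).toNNReal
  rw [← (h.law a b hab.le).map_eq, lintegral_map' ENNReal.measurable_ofReal.aemeasurable
    (h.law a b hab.le).aemeasurable, ENNReal.coe_toNNReal (measure_ne_top _ _)] at hmean
  rw [Measure.bind_apply measurableSet_Ioc (Kernel.aemeasurable _)]
  simpa only [stieltjesKernel_apply, StieltjesFunction.measure_Ioc] using hmean.symm

lemma ae_integrable (h : HasPoissonIncrements P Λ X) {g : ℝ → E} (hg : Integrable g Λ) :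
    ∀ᵐ ω ∂P, Integrable g (X ω).measure := by
  rw [← h.bind_stieltjesKernel] at hg
  simpa only [stieltjesKernel_apply] using Measure.ae_integrable_of_integrable_comp hg

lemma integrable_integral_norm (h : HasPoissonIncrements P Λ X) {g : ℝ → E}
    (hg : Integrable g Λ) : Integrable (fun ω => ∫ t, ‖g t‖ ∂(X ω).measure) P := by
  rw [← h.bind_stieltjesKernel] at hg
  simpa only [stieltjesKernel_apply] using Measure.integrable_integral_norm_of_integrable_comp hg

lemma integral_integral [NormedSpace ℝ E] (h : HasPoissonIncrements P Λ X) {g : ℝ → E}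
    (hg : Integrable g Λ) : ∫ ω, ∫ t, g t ∂(X ω).measure ∂P = ∫ t, g t ∂Λ := by
  have hcomp := Kernel.integral_comp (κ := Kernel.const Unit P)
    (η := stieltjesKernel X h.measurable) (a := ()) (f := g)
    (by rwa [Kernel.comp_apply, Kernel.const_apply, h.bind_stieltjesKernel])
  rw [Kernel.comp_apply, Kernel.const_apply, h.bind_stieltjesKernel] at hcomp
  simpa only [stieltjesKernel_apply] using hcomp.symm

lemma integral_cexp_integral_stepFun (h : HasPoissonIncrements P Λ X) (K : ℕ) {t : ℕ → ℝ}
    (ht : Monotone t) (c : ℕ → ℝ) :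
    ∫ ω, Complex.exp ((∫ x, stepFun K t c x ∂(X ω).measure : ℝ) * Complex.I) ∂P =
      Complex.exp (∫ x, (Complex.exp (stepFun K t c x * Complex.I) - 1) ∂Λ) := by
  set Y : ℕ → Ω → ℝ := fun j ω => c j * (X ω (t (j + 1)) - X ω (t j))
  have hsum (ω : Ω) : ∫ x, stepFun K t c x ∂(X ω).measure = ∑ j ∈ Finset.range K, Y j ω := by
    rw [integral_stepFun]
    refine Finset.sum_congr rfl fun j _ => ?_
    rw [measureReal_def, StieltjesFunction.measure_Ioc, ENNReal.toReal_ofReal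
      (sub_nonneg.2 ((X ω).mono (ht j.le_succ))), smul_eq_mul, mul_comm]
  have hexp : ∫ x, (Complex.exp (stepFun K t c x * Complex.I) - 1) ∂Λ =
      ∑ j ∈ Finset.range K,
        (Λ.real (Set.Ioc (t j) (t (j + 1))) : ℂ) * (Complex.exp (c j * Complex.I) - 1) := by
    have hcomp (x : ℝ) : Complex.exp (stepFun K t c x * Complex.I) - 1 = _ :=
      comp_stepFun (φ := fun y : ℝ => Complex.exp (y * Complex.I) - 1) (by simp) K ht c x
    simp only [hcomp, integral_stepFun, Complex.real_smul, Function.comp_apply]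
  have hYm (j : ℕ) : AEMeasurable (Y j) P := (h.law _ _ (ht j.le_succ)).aemeasurable.const_mul _
  have hYind : iIndepFun Y P :=
    (h.indep_increments.nat ht).comp (fun j => (c j * ·)) fun j => measurable_const_mul _
  have hprod := congrFun (iIndepFun.charFun_map_fun_finsetSum_eq_prod (s := Finset.range K)
    (fun j _ => hYm j) (hYind.restrict _)) 1
  rw [charFun_apply_real, integral_map (Finset.aemeasurable_fun_sum _ fun j _ => hYm j)
    (by fun_prop), Finset.prod_apply] at hprod
  simp only [Complex.ofReal_one, one_mul] at hprod
  simp only [hsum, hexp, Complex.exp_sum, hprod]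
  exact Finset.prod_congr rfl fun j _ => h.charFun_map_mul_increment (ht j.le_succ) (c j)

lemma norm_integral_cexp_integral_sub_le [IsFiniteMeasure P] (h : HasPoissonIncrements P Λ X)
    {g₁ g₂ : ℝ → ℝ} (hm₁ : Measurable g₁) (hm₂ : Measurable g₂) (h₁ : Integrable g₁ Λ)
    (h₂ : Integrable g₂ Λ) :
    ‖∫ ω, Complex.exp ((∫ x, g₁ x ∂(X ω).measure : ℝ) * Complex.I) ∂P
      - ∫ ω, Complex.exp ((∫ x, g₂ x ∂(X ω).measure : ℝ) * Complex.I) ∂P‖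
      ≤ ∫ x, |g₁ x - g₂ x| ∂Λ := by
  have hint {g : ℝ → ℝ} (hg : Measurable g) :
      Integrable (fun ω => Complex.exp ((∫ x, g x ∂(X ω).measure : ℝ) * Complex.I)) P := by
    have hcont : Continuous fun y : ℝ => Complex.exp (y * Complex.I) := by fun_prop
    exact Integrable.of_bound (C := 1)
      (hcont.comp_aestronglyMeasurable (h.measurable_integral hg).aestronglyMeasurable)
      (ae_of_all _ fun ω => (Complex.norm_exp_ofReal_mul_I _).le)
  rw [← integral_sub (hint hm₁) (hint hm₂),
    ← h.integral_integral (g := fun x => |g₁ x - g₂ x|) (h₁.sub h₂).abs]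
  refine norm_integral_le_of_norm_le (h.integrable_integral_norm (h₁.sub h₂)) ?_
  filter_upwards [h.ae_integrable h₁, h.ae_integrable h₂] with ω hω₁ hω₂
  refine (norm_cexp_ofReal_mul_I_sub_le _ _).trans ?_
  rw [← integral_sub hω₁ hω₂]
  exact norm_integral_le_integral_norm (μ := (X ω).measure) fun x => g₁ x - g₂ x

lemma integral_cexp_integral [IsFiniteMeasure P] (h : HasPoissonIncrements P Λ X) {g : ℝ → ℝ}
    (hm : Measurable g) (hg : Integrable g Λ) :
    ∫ ω, Complex.exp ((∫ x, g x ∂(X ω).measure : ℝ) * Complex.I) ∂P =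
      Complex.exp (∫ x, (Complex.exp (g x * Complex.I) - 1) ∂Λ) := by
  choose K t c ht hs using fun n : ℕ =>
    exists_stepFun_integral_norm_sub_le Λ hg (ε := 1 / ((n : ℝ) + 1)) (by positivity)
  have hsi (n : ℕ) := integrable_stepFun Λ (K n) (t n) (c n)
  have hsm (n : ℕ) := (stronglyMeasurable_stepFun (K n) (t n) (c n)).measurable
  have hs' (n : ℕ) : ∫ x, |stepFun (K n) (t n) (c n) x - g x| ∂Λ ≤ 1 / ((n : ℝ) + 1) := by
    simpa only [abs_sub_comm, Real.norm_eq_abs] using hs n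
  have hleft : Tendsto (fun n => ∫ ω, Complex.exp
      ((∫ x, stepFun (K n) (t n) (c n) x ∂(X ω).measure : ℝ) * Complex.I) ∂P) atTop
      (𝓝 (∫ ω, Complex.exp ((∫ x, g x ∂(X ω).measure : ℝ) * Complex.I) ∂P)) :=
    tendsto_iff_norm_sub_tendsto_zero.2 <| squeeze_zero (fun _ => norm_nonneg _)
      (fun n => (h.norm_integral_cexp_integral_sub_le (hsm n) hm (hsi n) hg).trans (hs' n))
      tendsto_one_div_add_atTop_nhds_zero_nat
  have hright : Tendsto (fun n =>
      ∫ x, (Complex.exp (stepFun (K n) (t n) (c n) x * Complex.I) - 1) ∂Λ) atTop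
      (𝓝 (∫ x, (Complex.exp (g x * Complex.I) - 1) ∂Λ)) :=
    tendsto_iff_norm_sub_tendsto_zero.2 <| squeeze_zero (fun _ => norm_nonneg _)
      (fun n => (norm_integral_cexp_mul_I_sub_le (hsi n) hg).trans (hs' n))
      tendsto_one_div_add_atTop_nhds_zero_nat
  refine tendsto_nhds_unique hleft (((Complex.continuous_exp.tendsto _).comp hright).congr fun n =>
    (h.integral_cexp_integral_stepFun (K n) (ht n) (c n)).symm)

variable {E : Type*} [NormedAddCommGroup E] [InnerProductSpace ℝ E] [SecondCountableTopology E]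
  [MeasurableSpace E] [BorelSpace E] {f : ℝ → E}

lemma integrable_integral (h : HasPoissonIncrements P Λ X) (hf : Measurable f)
    (hfi : Integrable f Λ) : Integrable (fun ω => ∫ t, f t ∂(X ω).measure) P :=
  (h.integrable_integral_norm hfi).mono' (h.measurable_integral hf).aestronglyMeasurable
    (ae_of_all _ fun _ => norm_integral_le_integral_norm _)

lemma charFun_map_integral [CompleteSpace E] [IsFiniteMeasure P] (h : HasPoissonIncrements P Λ X)
    (hf : Measurable f) (hfi : Integrable f Λ) (u : E) :
    charFun (P.map fun ω => ∫ t, f t ∂(X ω).measure) u =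
      Complex.exp (∫ t, (Complex.exp ((inner ℝ (f t) u : ℝ) * Complex.I) - 1) ∂Λ) := by
  rw [charFun_apply, integral_map (h.measurable_integral hf).aemeasurable (by fun_prop),
    ← h.integral_cexp_integral (by fun_prop) (hfi.inner_const u)]
  refine integral_congr_ae ?_
  filter_upwards [h.ae_integrable hfi] with ω hω
  rw [inner_integral_left hω]

end HasPoissonIncrements

end PoissonFunctional

section StochasticOrder

variable {Ω : Type*} [MeasurableSpace Ω] {P : Measure Ω} {Z W : ℕ → Ω → ℝ}

lemma tendsto_measure_zero_of_subset {A B : ℕ → Set Ω}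
    (hB : Tendsto (fun n => P (B n)) atTop (𝓝 0)) (hAB : ∀ n, A n ⊆ B n) :
    Tendsto (fun n => P (A n)) atTop (𝓝 0) :=
  tendsto_of_tendsto_of_tendsto_of_le_of_le tendsto_const_nhds hB (fun _ => zero_le)
    fun n => measure_mono (hAB n)

/-- The upper half of the relation `Z n = O_P(1)`: large positive values of `Z n` are unlikely,
uniformly in large `n`. It is applied to norms, for which the lower half is void. -/
def BoundedInProb (P : Measure Ω) (Z : ℕ → Ω → ℝ) : Prop :=
  ∀ ε : ENNReal, 0 < ε → ∃ M : ℝ, ∀ᶠ n in atTop, P {ω | M < Z n ω} ≤ ε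

/-- The upper half of the relation `Z n = o_P(1)`: the positive part of `Z n` tends to zero in
probability. The `Z n` need not be measurable, so that `Z n` may be the value of a process at a
random index chosen arbitrarily. -/
def SmallInProb (P : Measure Ω) (Z : ℕ → Ω → ℝ) : Prop :=
  ∀ ε : ℝ, 0 < ε → Tendsto (fun n => P {ω | ε ≤ Z n ω}) atTop (𝓝 0)

namespace BoundedInProb

lemma const (P : Measure Ω) (a : ℝ) : BoundedInProb P fun _ _ => a :=
  fun ε _ => ⟨a, Eventually.of_forall fun _ => by simp⟩

lemma comp (hZ : BoundedInProb P Z) {N : ℕ → ℕ} (hN : Tendsto N atTop atTop) :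
    BoundedInProb P fun n => Z (N n) :=
  fun ε hε => (hZ ε hε).imp fun _ hM => hN.eventually hM

lemma exists_pos (hZ : BoundedInProb P Z) {ε : ENNReal} (hε : 0 < ε) :
    ∃ M : ℝ, 0 < M ∧ ∀ᶠ n in atTop, P {ω | M < Z n ω} ≤ ε := by
  obtain ⟨M, hM⟩ := hZ ε hε
  refine ⟨max M 1, lt_max_of_lt_right one_pos, hM.mono fun n hn => (measure_mono ?_).trans hn⟩
  exact fun ω hω => (le_max_left M 1).trans_lt hω

lemma add (hZ : BoundedInProb P Z) (hW : BoundedInProb P W) :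
    BoundedInProb P fun n ω => Z n ω + W n ω := fun ε hε => by
  obtain ⟨M₁, h₁⟩ := hZ _ (ENNReal.half_pos hε.ne')
  obtain ⟨M₂, h₂⟩ := hW _ (ENNReal.half_pos hε.ne')
  refine ⟨M₁ + M₂, ?_⟩
  filter_upwards [h₁, h₂] with n hn₁ hn₂
  rw [← ENNReal.add_halves ε]
  refine (measure_mono fun ω (hω : M₁ + M₂ < _) => ?_).trans
    ((measure_union_le _ _).trans (add_le_add hn₁ hn₂))
  by_contra! h
  simp only [Set.mem_union, Set.mem_ofPred_eq, not_or, not_lt] at h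
  linarith

lemma sum {ι : Type*} (s : Finset ι) {Z : ι → ℕ → Ω → ℝ} (hZ : ∀ i ∈ s, BoundedInProb P (Z i)) :
    BoundedInProb P fun n ω => ∑ i ∈ s, Z i n ω := by
  classical
  induction s using Finset.induction_on with
  | empty => simpa using const P 0
  | insert i s hi ih =>
    simp only [Finset.sum_insert hi]
    exact (hZ i (s.mem_insert_self i)).add (ih fun j hj => hZ j (Finset.mem_insert_of_mem hj))

end BoundedInProb

namespace SmallInProb

lemma of_tendsto (P : Measure Ω) {a : ℕ → ℝ} (ha : Tendsto a atTop (𝓝 0)) :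
    SmallInProb P fun n _ => a n := fun ε hε => by
  refine tendsto_const_nhds.congr' ?_
  filter_upwards [ha.eventually_lt_const hε] with n hn
  rw [show {_ω : Ω | ε ≤ a n} = ∅ from Set.eq_empty_of_forall_notMem fun _ hω => hn.not_ge hω,
    measure_empty]

lemma comp (hZ : SmallInProb P Z) {N : ℕ → ℕ} (hN : Tendsto N atTop atTop) :
    SmallInProb P fun n => Z (N n) := fun ε hε => (hZ ε hε).comp hN

lemma mono (hZ : SmallInProb P Z) {B : ℕ → Set Ω} (hB : Tendsto (fun n => P (B n)) atTop (𝓝 0))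
    (hle : ∀ᶠ n in atTop, ∀ᵐ ω ∂P, ω ∉ B n → W n ω ≤ Z n ω) : SmallInProb P W := fun ε hε => by
  have hsum := (hZ ε hε).add hB
  rw [add_zero] at hsum
  refine tendsto_of_tendsto_of_tendsto_of_le_of_le' tendsto_const_nhds hsum
    (Eventually.of_forall fun _ => zero_le) ?_
  filter_upwards [hle] with n hn
  refine (measure_mono_ae ?_).trans (measure_union_le _ _)
  filter_upwards [hn] with ω hω hεω
  exact (em (ω ∈ B n)).symm.imp (fun hωB => hεω.trans (hω hωB)) id

lemma mono_of_le (hZ : SmallInProb P Z) (hle : ∀ n ω, W n ω ≤ Z n ω) : SmallInProb P W :=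
  hZ.mono (B := fun _ => ∅) (by simp) (Eventually.of_forall fun n => ae_of_all _ fun ω _ => hle n ω)

lemma add (hZ : SmallInProb P Z) (hW : SmallInProb P W) :
    SmallInProb P fun n ω => Z n ω + W n ω := fun ε hε => by
  have hsum := (hZ (ε / 2) (half_pos hε)).add (hW (ε / 2) (half_pos hε))
  rw [add_zero] at hsum
  refine tendsto_of_tendsto_of_tendsto_of_le_of_le tendsto_const_nhds hsum
    (fun _ => zero_le) fun n => (measure_mono fun ω (hω : ε ≤ _) => ?_).trans
      (measure_union_le _ _)
  by_contra! h
  simp only [Set.mem_union, Set.mem_ofPred_eq, not_or, not_le] at h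
  linarith

lemma sum {ι : Type*} (s : Finset ι) {Z : ι → ℕ → Ω → ℝ} (hZ : ∀ i ∈ s, SmallInProb P (Z i)) :
    SmallInProb P fun n ω => ∑ i ∈ s, Z i n ω := by
  classical
  induction s using Finset.induction_on with
  | empty => simpa using of_tendsto P tendsto_const_nhds
  | insert i s hi ih =>
    simp only [Finset.sum_insert hi]
    exact (hZ i (s.mem_insert_self i)).add (ih fun j hj => hZ j (Finset.mem_insert_of_mem hj))

lemma boundedInProb (hZ : SmallInProb P Z) : BoundedInProb P Z := fun ε hε => by
  refine ⟨1, ?_⟩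
  filter_upwards [ENNReal.tendsto_nhds_zero.1 (hZ 1 one_pos) ε hε] with n hn
  exact (measure_mono fun ω (hω : 1 < Z n ω) => hω.le).trans hn

lemma mul_boundedInProb (hZ : SmallInProb P Z) (hW : BoundedInProb P W)
    (hW0 : ∀ n ω, 0 ≤ W n ω) : SmallInProb P fun n ω => Z n ω * W n ω := fun ε hε => by
  refine ENNReal.tendsto_nhds_zero.2 fun η hη => ?_
  have hη2 : 0 < η / 2 := ENNReal.half_pos hη.ne'
  obtain ⟨M, hM0, hM⟩ := hW.exists_pos hη2
  filter_upwards [hM, ENNReal.tendsto_nhds_zero.1 (hZ (ε / M) (by positivity)) _ hη2]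
    with n hn₁ hn₂
  rw [← ENNReal.add_halves η]
  refine (measure_mono fun ω (hω : ε ≤ _) => ?_).trans
    ((measure_union_le _ _).trans (add_le_add hn₂ hn₁))
  by_contra! h
  simp only [Set.mem_union, Set.mem_ofPred_eq, not_or, not_le, not_lt] at h
  rcases (hW0 n ω).eq_or_lt with h0 | h0
  · rw [← h0, mul_zero] at hω
    exact hω.not_gt hε
  · refine hω.not_gt ?_
    calc Z n ω * W n ω < ε / M * W n ω := mul_lt_mul_of_pos_right h.1 h0
      _ ≤ ε / M * M := mul_le_mul_of_nonneg_left h.2 (by positivity)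
      _ = ε := div_mul_cancel₀ _ hM0.ne'

lemma tendsto_measure_exists_ge {N : ℕ → ℕ} {Z : ℕ → ℕ → Ω → ℝ}
    (hZ : ∀ κ : ℕ → Ω → ℕ, (∀ n ω, N n < κ n ω) → SmallInProb P fun n ω => Z n (κ n ω) ω)
    {ε : ℝ} (hε : 0 < ε) :
    Tendsto (fun n => P {ω | ∃ k, N n < k ∧ ε ≤ Z n k ω}) atTop (𝓝 0) := by
  have hchoice (n : ℕ) (ω : Ω) : ∃ κ, N n < κ ∧ ((∃ k, N n < k ∧ ε ≤ Z n k ω) → ε ≤ Z n κ ω) := by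
    by_cases h : ∃ k, N n < k ∧ ε ≤ Z n k ω
    · exact h.imp fun k hk => ⟨hk.1, fun _ => hk.2⟩
    · exact ⟨N n + 1, Nat.lt_succ_self _, fun h' => absurd h' h⟩
  choose κ hκ hκε using hchoice
  exact tendsto_measure_zero_of_subset (hZ κ hκ ε hε) hκε

lemma tendsto_measure_notMem {E : Type*} [SeminormedAddCommGroup E] {Y : ℕ → Ω → E} {y : E}
    (hY : SmallInProb P fun n ω => ‖Y n ω - y‖) {U : Set E} (hU : U ∈ 𝓝 y) :
    Tendsto (fun n => P {ω | Y n ω ∉ U}) atTop (𝓝 0) := by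
  obtain ⟨r, hr, hball⟩ := Metric.mem_nhds_iff.1 hU
  refine tendsto_measure_zero_of_subset (hY r hr) fun n ω hω => ?_
  by_contra h
  exact hω (hball (mem_ball_iff_norm.2 (not_le.1 h)))

lemma of_ae_tendsto {E : Type*} [NormedAddCommGroup E] [IsFiniteMeasure P] [MeasurableSpace E]
    [OpensMeasurableSpace E] {g : ℕ → Ω → E} (hg : ∀ k, Measurable (g k))
    (h : ∀ᵐ ω ∂P, Tendsto (fun k => g k ω) atTop (𝓝 0)) {N : ℕ → ℕ} (hN : Tendsto N atTop atTop)
    {κ : ℕ → Ω → ℕ} (hκ : ∀ n ω, N n ≤ κ n ω) : SmallInProb P fun n ω => ‖g (κ n ω) ω‖ := by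
  intro ε hε
  set S : ℕ → Set Ω := fun m => {ω | ∃ k, m ≤ k ∧ ε ≤ ‖g k ω‖}
  have hSm (m : ℕ) : MeasurableSet (S m) := by
    simp only [S, measurableSet_setOfPred]
    exact Measurable.exists fun k => measurable_const.and
      (measurableSet_setOfPred.1 (measurableSet_le measurable_const (hg k).norm))
  have hS0 : P (⋂ m, S m) = 0 := by
    refine measure_mono_null ?_ (ae_iff.1 h)
    intro ω hω hlim
    obtain ⟨m, hm⟩ := eventually_atTop.1 (hlim.norm.eventually_lt_const (norm_zero.trans_lt hε))
    obtain ⟨k, hk, hkε⟩ := Set.mem_iInter.1 hω m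
    exact (hm k hk).not_ge hkε
  have hS := tendsto_measure_iInter_atTop (μ := P) (fun m => (hSm m).nullMeasurableSet)
    (fun m m' hmm' ω ⟨k, hk, hkε⟩ => ⟨k, hmm'.trans hk, hkε⟩) ⟨0, measure_ne_top P _⟩
  rw [hS0] at hS
  exact tendsto_measure_zero_of_subset (hS.comp hN) fun n ω hω => ⟨κ n ω, hκ n ω, hω⟩

end SmallInProb

end StochasticOrder

section SecondOrder

lemma norm_cexp_mul_I_sub_one_sub_le (y : ℝ) :
    ‖Complex.exp (y * Complex.I) - 1 - y * Complex.I‖ ≤ 2 * y ^ 2 := by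
  have hnorm : ‖(y : ℂ) * Complex.I‖ = |y| := by simp
  rcases le_total |y| 1 with hy | hy
  · have h := Complex.norm_exp_sub_one_sub_id_le (hnorm.trans_le hy)
    rw [hnorm, sq_abs] at h
    exact h.trans (by linarith [sq_nonneg y])
  · calc ‖Complex.exp (y * Complex.I) - 1 - y * Complex.I‖
        ≤ ‖Complex.exp (y * Complex.I) - 1‖ + ‖(y : ℂ) * Complex.I‖ := norm_sub_le _ _
      _ ≤ |y| + |y| := by
          rw [hnorm]
          gcongr
          simpa using norm_cexp_ofReal_mul_I_sub_le y 0
      _ ≤ 2 * y ^ 2 := by nlinarith [sq_abs y]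

lemma tendsto_cexp_mul_I_sub_one_sub_div_sq (a : ℝ) :
    Tendsto (fun r : ℝ => (Complex.exp ((r * a : ℝ) * Complex.I) - 1 - (r * a : ℝ) * Complex.I)
      / (r : ℂ) ^ 2) (𝓝[≠] 0) (𝓝 ((-a ^ 2 / 2 : ℝ) : ℂ)) := by
  have harg : Tendsto (fun r : ℝ => ((r * a : ℝ) : ℂ) * Complex.I) (𝓝[≠] 0) (𝓝 0) := by
    have hcont : Continuous fun r : ℝ => ((r * a : ℝ) : ℂ) * Complex.I := by fun_prop
    simpa using (hcont.tendsto 0).mono_left nhdsWithin_le_nhds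
  have hbig : (fun r : ℝ => (((r * a : ℝ) : ℂ) * Complex.I) ^ 2) =O[𝓝[≠] 0]
      fun r : ℝ => (r : ℂ) ^ 2 :=
    Asymptotics.IsBigO.of_bound (a ^ 2) (Eventually.of_forall fun r => by
      simp [mul_pow, mul_comm])
  have hrem := (((Complex.exp_sub_sum_range_succ_isLittleO_pow 2).comp_tendsto harg).trans_isBigO
    hbig).tendsto_div_nhds_zero
  have hsum := hrem.add_const ((-a ^ 2 / 2 : ℝ) : ℂ)
  rw [zero_add] at hsum
  refine hsum.congr' (eventually_nhdsWithin_of_forall fun r (hr : r ≠ 0) => ?_)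
  have hr' : (r : ℂ) ≠ 0 := Complex.ofReal_ne_zero.2 hr
  simp only [Function.comp_apply, Finset.sum_range_succ, Finset.sum_range_zero, pow_zero, pow_one,
    Nat.factorial, Nat.cast_one, mul_pow, Complex.I_sq]
  push_cast
  field_simp
  ring

lemma tendsto_integral_cexp_mul_I_sub_one_sub_div_sq {α : Type*} [MeasurableSpace α]
    {μ : Measure α} {g : α → ℝ} (hg : MemLp g 2 μ) :
    Tendsto (fun r : ℝ => ∫ x, (Complex.exp ((r * g x : ℝ) * Complex.I) - 1
      - (r * g x : ℝ) * Complex.I) / (r : ℂ) ^ 2 ∂μ) (𝓝[≠] 0)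
      (𝓝 ((-(∫ x, g x ^ 2 ∂μ) / 2 : ℝ) : ℂ)) := by
  rw [← integral_neg, ← integral_div, ← integral_complex_ofReal]
  refine tendsto_integral_filter_of_dominated_convergence (fun x => 2 * g x ^ 2)
    (Eventually.of_forall fun r => ?_)
    (eventually_nhdsWithin_of_forall fun r (hr : r ≠ 0) => ?_)
    (hg.integrable_sq.const_mul 2)
    (ae_of_all _ fun x => tendsto_cexp_mul_I_sub_one_sub_div_sq (g x))
  · have hcont : Continuous fun y : ℝ => (Complex.exp ((r * y : ℝ) * Complex.I) - 1
      - (r * y : ℝ) * Complex.I) / (r : ℂ) ^ 2 := by fun_prop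
    exact hcont.comp_aestronglyMeasurable hg.1
  · refine ae_of_all _ fun x => ?_
    have hr2 : 0 < r ^ 2 := by positivity
    rw [norm_div, norm_pow, Complex.norm_real, Real.norm_eq_abs, sq_abs, div_le_iff₀ hr2]
    exact (norm_cexp_mul_I_sub_one_sub_le _).trans_eq (by ring)

end SecondOrder

section PathSigma

variable {Ω : Type*}

lemma measurable_pathSigma (Y : Ω → StieltjesFunction ℝ) (t : ℝ) :
    Measurable[pathSigma Y] fun ω => Y ω t :=
  Measurable.mono (comap_measurable fun ω => Y ω t)
    (le_iSup (fun t : ℝ => MeasurableSpace.comap (fun ω => Y ω t) (borel ℝ)) t) le_rfl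

end PathSigma

section CenteredSum

/-- The sum over `N ≤ j < k` of the integrals of `f` with respect to `X j`, centered at their
common expectation `∫ f dΛ`. -/
noncomputable def centeredSum {Ω E : Type*} [NormedAddCommGroup E] [NormedSpace ℝ E]
    (Λ : Measure ℝ) (X : ℕ → Ω → StieltjesFunction ℝ) (f : ℝ → E) (N k : ℕ) (ω : Ω) : E :=
  ∑ j ∈ Finset.Ico N k, (∫ t, f t ∂(X j ω).measure - ∫ t, f t ∂Λ)

variable {Ω E F : Type*} [NormedAddCommGroup E] [NormedSpace ℝ E] [NormedAddCommGroup F]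
  [NormedSpace ℝ F] {Λ : Measure ℝ} {X : ℕ → Ω → StieltjesFunction ℝ} {f : ℝ → E} {N k : ℕ}

lemma centeredSum_eq_sub (hNk : N ≤ k) (ω : Ω) :
    centeredSum Λ X f N k ω = centeredSum Λ X f 0 k ω - centeredSum Λ X f 0 N ω := by
  rw [eq_sub_iff_add_eq, add_comm]
  exact Finset.sum_Ico_consecutive _ (Nat.zero_le N) hNk

lemma norm_inv_smul_centeredSum_le (hNk : N ≤ k) (ω : Ω) :
    ‖(k : ℝ)⁻¹ • centeredSum Λ X f N k ω‖ ≤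
      ‖(k : ℝ)⁻¹ • centeredSum Λ X f 0 k ω‖ + ‖(N : ℝ)⁻¹ • centeredSum Λ X f 0 N ω‖ := by
  rw [centeredSum_eq_sub hNk, smul_sub]
  refine (norm_sub_le _ _).trans (add_le_add_right ?_ _)
  rcases N.eq_zero_or_pos with rfl | hN
  · simp [centeredSum]
  · simp only [norm_smul, norm_inv, RCLike.norm_natCast]
    gcongr

lemma sum_measureReal_univ_eq_centeredSum (hNk : N ≤ k) (ω : Ω) :
    ∑ j ∈ Finset.Ico N k, (X j ω).measure.real Set.univ =
      centeredSum Λ X (fun _ => (1 : ℝ)) N k ω + ((k : ℝ) - N) * Λ.real Set.univ := by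
  simp only [centeredSum, integral_const, smul_eq_mul, mul_one, Finset.sum_sub_distrib,
    Finset.sum_const, Nat.card_Ico, nsmul_eq_mul, Nat.cast_sub hNk]
  ring

lemma inv_mul_sum_measureReal_univ_le (hNk : N ≤ k) (ω : Ω) :
    (k : ℝ)⁻¹ * ∑ j ∈ Finset.Ico N k, (X j ω).measure.real Set.univ ≤
      Λ.real Set.univ + ‖(k : ℝ)⁻¹ • centeredSum Λ X (fun _ => (1 : ℝ)) N k ω‖ := by
  rw [sum_measureReal_univ_eq_centeredSum (Λ := Λ) hNk, mul_add, add_comm, ← mul_assoc,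
    ← smul_eq_mul (_⁻¹)]
  refine add_le_add (mul_le_of_le_one_left measureReal_nonneg ?_) (Real.le_norm_self _)
  exact inv_mul_le_one_of_le₀ (sub_le_self _ N.cast_nonneg) k.cast_nonneg

lemma centeredSum_clm_comp [CompleteSpace E] [CompleteSpace F] (L : E →L[ℝ] F)
    (hΛ : Integrable f Λ) {ω : Ω} (hω : ∀ j, Integrable f (X j ω).measure) :
    centeredSum Λ X (fun t => L (f t)) N k ω = L (centeredSum Λ X f N k ω) := by
  rw [centeredSum, centeredSum, map_sum]
  refine Finset.sum_congr rfl fun j _ => ?_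
  rw [L.integral_comp_comm (hω j), L.integral_comp_comm hΛ, map_sub]

end CenteredSum

section PoissonSample

/-- Independent processes with independent Poisson increments and common mean measure `Λ`. -/
structure IsPoissonMeasureSample {Ω : Type*} [MeasurableSpace Ω] (P : Measure Ω) (Λ : Measure ℝ)
    (X : ℕ → Ω → StieltjesFunction ℝ) : Prop where
  hasPoissonIncrements : ∀ j, HasPoissonIncrements P Λ (X j)
  indep : iIndep (fun j => pathSigma (X j)) P

namespace IsPoissonMeasureSample

variable {Ω : Type*} [MeasurableSpace Ω] {P : Measure Ω} {Λ : Measure ℝ}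
  {X : ℕ → Ω → StieltjesFunction ℝ}

lemma ae_integrable [IsFiniteMeasure Λ] {E : Type*} [NormedAddCommGroup E]
    (h : IsPoissonMeasureSample P Λ X) {f : ℝ → E} (hf : Integrable f Λ) :
    ∀ᵐ ω ∂P, ∀ j, Integrable f (X j ω).measure :=
  ae_all_iff.2 fun j => (h.hasPoissonIncrements j).ae_integrable hf

lemma ae_isFiniteMeasure [IsFiniteMeasure Λ] (h : IsPoissonMeasureSample P Λ X) :
    ∀ᵐ ω ∂P, ∀ j, IsFiniteMeasure (X j ω).measure :=
  (h.ae_integrable (integrable_const (1 : ℝ))).mono fun _ hω j =>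
    (integrable_const_iff_isFiniteMeasure one_ne_zero).1 (hω j)

variable {E : Type*} [NormedAddCommGroup E] [MeasurableSpace E] [BorelSpace E] {f : ℝ → E}

section NormedSpace

variable [NormedSpace ℝ E] [SecondCountableTopology E]

lemma measurable_centeredSum (h : IsPoissonMeasureSample P Λ X) (hf : Measurable f) (N k : ℕ) :
    Measurable (centeredSum Λ X f N k) :=
  Finset.measurable_fun_sum _ fun j _ =>
    ((h.hasPoissonIncrements j).measurable_integral hf).sub_const _

lemma iIndepFun_integral (h : IsPoissonMeasureSample P Λ X) (hf : Measurable f) :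
    iIndepFun (fun j ω => ∫ t, f t ∂(X j ω).measure) P := by
  rw [iIndepFun_iff_iIndep]
  refine iIndep_of_iIndep_of_le h.indep fun j => Measurable.comap_le ?_
  exact @measurable_integral_stieltjes Ω (pathSigma (X j)) E _ _ _ _ _ (X j)
    (fun t => measurable_pathSigma (X j) t) (fun _ => f)
    (hf.comp (@measurable_snd Ω ℝ (pathSigma (X j)) _))

end NormedSpace

variable [InnerProductSpace ℝ E] [FiniteDimensional ℝ E] [IsProbabilityMeasure P]
  [IsFiniteMeasure Λ]

lemma identDistrib_integral (h : IsPoissonMeasureSample P Λ X) (hf : Measurable f)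
    (hfi : Integrable f Λ) (i j : ℕ) :
    IdentDistrib (fun ω => ∫ t, f t ∂(X i ω).measure) (fun ω => ∫ t, f t ∂(X j ω).measure) P P where
  aemeasurable_fst := ((h.hasPoissonIncrements i).measurable_integral hf).aemeasurable
  aemeasurable_snd := ((h.hasPoissonIncrements j).measurable_integral hf).aemeasurable
  map_eq := by
    have hprob (j : ℕ) := Measure.isProbabilityMeasure_map (μ := P)
      ((h.hasPoissonIncrements j).measurable_integral hf).aemeasurable
    have := hprob i
    have := hprob j
    refine Measure.ext_of_charFun (funext fun u => ?_)
    rw [(h.hasPoissonIncrements i).charFun_map_integral hf hfi,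
      (h.hasPoissonIncrements j).charFun_map_integral hf hfi]

lemma ae_tendsto_centeredSum (h : IsPoissonMeasureSample P Λ X) (hf : Measurable f)
    (hfi : Integrable f Λ) :
    ∀ᵐ ω ∂P, Tendsto (fun k : ℕ => (k : ℝ)⁻¹ • centeredSum Λ X f 0 k ω) atTop (𝓝 0) := by
  have hslln := strong_law_ae (fun j ω => ∫ t, f t ∂(X j ω).measure)
    ((h.hasPoissonIncrements 0).integrable_integral hf hfi)
    (fun i j hij => (h.iIndepFun_integral hf).indepFun hij)
    (fun i => h.identDistrib_integral hf hfi i 0)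
  rw [(h.hasPoissonIncrements 0).integral_integral hfi] at hslln
  filter_upwards [hslln] with ω hω
  have hcentered := hω.sub_const (∫ t, f t ∂Λ)
  rw [sub_self] at hcentered
  refine hcentered.congr' ?_
  filter_upwards [eventually_gt_atTop 0] with k hk
  simp only [centeredSum, Nat.Ico_zero_eq_range, Finset.sum_sub_distrib, Finset.sum_const,
    Finset.card_range, smul_sub]
  rw [← Nat.cast_smul_eq_nsmul ℝ, smul_smul, inv_mul_cancel₀ (Nat.cast_ne_zero.2 hk.ne'), one_smul]

lemma smallInProb_centeredSum (h : IsPoissonMeasureSample P Λ X) (hf : Measurable f)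
    (hfi : Integrable f Λ) {N : ℕ → ℕ} (hN : Tendsto N atTop atTop) {κ : ℕ → Ω → ℕ}
    (hκ : ∀ n ω, N n ≤ κ n ω) :
    SmallInProb P fun n ω => ‖(κ n ω : ℝ)⁻¹ • centeredSum Λ X f (N n) (κ n ω) ω‖ := by
  have hlim {κ : ℕ → Ω → ℕ} (hκ : ∀ n ω, N n ≤ κ n ω) :=
    SmallInProb.of_ae_tendsto (fun k => (h.measurable_centeredSum hf 0 k).const_smul (k : ℝ)⁻¹)
      (h.ae_tendsto_centeredSum hf hfi) hN hκ
  exact ((hlim hκ).add (hlim (κ := fun n _ => N n) fun _ _ => le_rfl)).mono_of_le fun n ω =>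
    norm_inv_smul_centeredSum_le (hκ n ω) ω

lemma charFun_map_smul_integral_sub (h : IsPoissonMeasureSample P Λ X) (hf : Measurable f)
    (hfi : Integrable f Λ) (j : ℕ) (r : ℝ) (u : E) :
    charFun (P.map fun ω => ∫ t, f t ∂(X j ω).measure - ∫ t, f t ∂Λ) (r • u) =
      Complex.exp (∫ t, (Complex.exp ((r * inner ℝ (f t) u : ℝ) * Complex.I) - 1
        - (r * inner ℝ (f t) u : ℝ) * Complex.I) ∂Λ) := by
  have hmap : (P.map fun ω => ∫ t, f t ∂(X j ω).measure - ∫ t, f t ∂Λ) =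
      (P.map fun ω => ∫ t, f t ∂(X j ω).measure).map (· + -∫ t, f t ∂Λ) := by
    rw [Measure.map_map (by fun_prop) ((h.hasPoissonIncrements j).measurable_integral hf)]
    simp only [sub_eq_add_neg]
    rfl
  have hr : Integrable (fun t => r * inner ℝ (f t) u) Λ := (hfi.inner_const u).const_mul r
  have hinner : inner ℝ (-∫ t, f t ∂Λ) (r • u) = -∫ t, r * inner ℝ (f t) u ∂Λ := by
    rw [inner_neg_left, inner_smul_right, integral_const_mul, inner_integral_left hfi]
  have hrI : Integrable (fun t => ((r * inner ℝ (f t) u : ℝ) : ℂ) * Complex.I) Λ :=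
    hr.ofReal.mul_const _
  rw [hmap, charFun_map_add_const, (h.hasPoissonIncrements j).charFun_map_integral hf hfi,
    ← Complex.exp_add, integral_sub (integrable_cexp_mul_I_sub_one hr) hrI,
    integral_mul_const, integral_complex_ofReal, hinner]
  simp only [inner_smul_right, Complex.ofReal_neg, neg_mul, sub_eq_add_neg]

lemma charFun_map_smul_centeredSum (h : IsPoissonMeasureSample P Λ X) (hf : Measurable f)
    (hfi : Integrable f Λ) (N k : ℕ) (r : ℝ) (u : E) :
    charFun (P.map fun ω => r • centeredSum Λ X f N k ω) u =
      Complex.exp ((k - N : ℕ) * ∫ t, (Complex.exp ((r * inner ℝ (f t) u : ℝ) * Complex.I) - 1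
        - (r * inner ℝ (f t) u : ℝ) * Complex.I) ∂Λ) := by
  have hm (j : ℕ) : Measurable fun ω => ∫ t, f t ∂(X j ω).measure - ∫ t, f t ∂Λ :=
    ((h.hasPoissonIncrements j).measurable_integral hf).sub_const _
  have hind : iIndepFun (fun j ω => ∫ t, f t ∂(X j ω).measure - ∫ t, f t ∂Λ) P :=
    (h.iIndepFun_integral hf).comp (fun _ x => x - ∫ t, f t ∂Λ) fun _ => measurable_id.sub_const _
  have hmap : (P.map fun ω => r • centeredSum Λ X f N k ω) =
      (P.map (centeredSum Λ X f N k)).map (r • ·) := by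
    rw [Measure.map_map (by fun_prop) (h.measurable_centeredSum hf N k)]
    rfl
  unfold centeredSum at hmap ⊢
  rw [hmap, charFun_map_smul, iIndepFun.charFun_map_fun_finsetSum_eq_prod
    (fun j _ => (hm j).aemeasurable) (hind.restrict _), Finset.prod_apply]
  simp only [h.charFun_map_smul_integral_sub hf hfi]
  rw [Finset.prod_const, Nat.card_Ico, ← Complex.exp_nat_mul]

end IsPoissonMeasureSample

end PoissonSample

section CentralLimit

lemma tendsto_natCast_sub_div {N k : ℕ → ℕ} (hk : Tendsto k atTop atTop)
    (hN : Tendsto (fun n => (N n : ℝ) / k n) atTop (𝓝 0)) :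
    Tendsto (fun n => ((k n - N n : ℕ) : ℝ) / k n) atTop (𝓝 1) := by
  have hlim : Tendsto (fun n => 1 - (N n : ℝ) / k n) atTop (𝓝 1) := by
    simpa using hN.const_sub 1
  refine hlim.congr' ?_
  filter_upwards [hN.eventually_lt_const zero_lt_one, hk.eventually_gt_atTop 0] with n hn hkn
  have hk0 : (0 : ℝ) < k n := Nat.cast_pos.2 hkn
  rw [div_lt_one hk0, Nat.cast_lt] at hn
  rw [Nat.cast_sub hn.le, sub_div, div_self hk0.ne']

variable {Ω : Type*} [MeasurableSpace Ω] {P : Measure Ω} [IsProbabilityMeasure P] {Λ : Measure ℝ}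
  [IsFiniteMeasure Λ] {X : ℕ → Ω → StieltjesFunction ℝ}

namespace IsPoissonMeasureSample

variable {E : Type*} [NormedAddCommGroup E] [InnerProductSpace ℝ E] [FiniteDimensional ℝ E]
  [MeasurableSpace E] [BorelSpace E] {f : ℝ → E} {N k : ℕ → ℕ}

lemma tendsto_charFun_centeredSum (h : IsPoissonMeasureSample P Λ X) (hf : Measurable f)
    (hf2 : MemLp f 2 Λ) (hk : Tendsto k atTop atTop)
    (hN : Tendsto (fun n => (N n : ℝ) / k n) atTop (𝓝 0)) (u : E) :
    Tendsto (fun n => charFun (P.map fun ω => (√(k n))⁻¹ • centeredSum Λ X f (N n) (k n) ω) u)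
      atTop (𝓝 (Complex.exp ((-(∫ t, (inner ℝ (f t) u) ^ 2 ∂Λ) / 2 : ℝ) : ℂ))) := by
  simp only [h.charFun_map_smul_centeredSum hf (hf2.integrable one_le_two)]
  refine (Complex.continuous_exp.tendsto _).comp ?_
  have hr : Tendsto (fun n => (√(k n : ℝ))⁻¹) atTop (𝓝[≠] 0) := by
    refine tendsto_nhdsWithin_iff.2 ⟨(Real.tendsto_sqrt_atTop.comp
      (tendsto_natCast_atTop_atTop.comp hk)).inv_tendsto_atTop, ?_⟩
    filter_upwards [hk.eventually_gt_atTop 0] with n hn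
    exact inv_ne_zero (Real.sqrt_ne_zero'.2 (Nat.cast_pos.2 hn))
  have hlim := ((Complex.continuous_ofReal.tendsto _).comp (tendsto_natCast_sub_div hk hN)).mul
    ((tendsto_integral_cexp_mul_I_sub_one_sub_div_sq (hf2.inner_const u)).comp hr)
  rw [Complex.ofReal_one, one_mul] at hlim
  refine hlim.congr' ?_
  filter_upwards [hk.eventually_gt_atTop 0] with n hn
  have hsq : (((√(k n : ℝ))⁻¹ : ℝ) : ℂ) ^ 2 = (k n : ℂ)⁻¹ := by
    rw [← Complex.ofReal_pow, inv_pow, Real.sq_sqrt (Nat.cast_nonneg _), Complex.ofReal_inv,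
      Complex.ofReal_natCast]
  simp only [Function.comp_apply, integral_div, hsq, div_inv_eq_mul, Complex.ofReal_div,
    Complex.ofReal_natCast]
  rw [mul_comm _ (k n : ℂ), ← mul_assoc, div_mul_cancel₀ _ (Nat.cast_ne_zero.2 hn.ne')]

lemma boundedInProb_centeredSum (h : IsPoissonMeasureSample P Λ X) (hf : Measurable f)
    (hf2 : MemLp f 2 Λ) (hk : Tendsto k atTop atTop)
    (hN : Tendsto (fun n => (N n : ℝ) / k n) atTop (𝓝 0)) :
    BoundedInProb P fun n ω => ‖(√(k n))⁻¹ • centeredSum Λ X f (N n) (k n) ω‖ := fun ε hε => by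
  have hm (n : ℕ) : Measurable fun ω => (√(k n : ℝ))⁻¹ • centeredSum Λ X f (N n) (k n) ω :=
    (h.measurable_centeredSum hf _ _).const_smul _
  have (n : ℕ) := Measure.isProbabilityMeasure_map (μ := P) (hm n).aemeasurable
  have hint : ContinuousAt (fun u : E => ∫ t, (inner ℝ (f t) u) ^ 2 ∂Λ) 0 := by
    have hcont : Continuous fun u : E => (∫ t, ‖f t‖ ^ 2 ∂Λ) * ‖u‖ ^ 2 := by fun_prop
    simp only [ContinuousAt, inner_zero_right, ne_eq, OfNat.ofNat_ne_zero, not_false_eq_true,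
      zero_pow, integral_zero]
    refine squeeze_zero_norm (fun u => ?_) (by simpa using hcont.tendsto 0)
    rw [← integral_mul_const]
    refine norm_integral_le_of_norm_le (hf2.norm.integrable_sq.mul_const _)
      (ae_of_all _ fun t => ?_)
    rw [norm_pow, ← mul_pow]
    exact pow_le_pow_left₀ (norm_nonneg _) (norm_inner_le_norm _ _) 2
  have hexp : Continuous fun x : ℝ => Complex.exp ((-x / 2 : ℝ) : ℂ) := by fun_prop
  obtain ⟨K, hK, hKε⟩ := isTightMeasureSet_iff_exists_isCompact_measure_compl_le.1
    (isTightMeasureSet_of_tendsto_charFun (ContinuousAt.comp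
      (g := fun x : ℝ => Complex.exp ((-x / 2 : ℝ) : ℂ)) hexp.continuousAt hint)
      (h.tendsto_charFun_centeredSum hf hf2 hk hN)) ε hε
  obtain ⟨R, hR⟩ := hK.isBounded.exists_norm_le
  refine ⟨R, Eventually.of_forall fun n => (measure_mono fun ω hω hmem => ?_).trans
    ((Measure.map_apply (hm n) hK.measurableSet.compl).symm.trans_le (hKε _ ⟨n, rfl⟩))⟩
  exact (hR _ hmem).not_gt hω

end IsPoissonMeasureSample

lemma IsPoissonMeasureSample.tendstoInDistribution_centeredSum {d : ℕ}
    (h : IsPoissonMeasureSample P Λ X) {f : ℝ → EuclideanSpace ℝ (Fin d)} (hf : Measurable f)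
    (hf2 : MemLp f 2 Λ) {S : Matrix (Fin d) (Fin d) ℝ} (hS : S.PosSemidef)
    (hcov : ∀ u, ∫ t, (inner ℝ (f t) u) ^ 2 ∂Λ = u.ofLp ⬝ᵥ S.mulVec u.ofLp) {N k : ℕ → ℕ}
    (hk : Tendsto k atTop atTop) (hN : Tendsto (fun n => (N n : ℝ) / k n) atTop (𝓝 0)) :
    TendstoInDistribution (fun n ω => (√(k n))⁻¹ • centeredSum Λ X f (N n) (k n) ω)
      atTop id (fun _ => P) (multivariateGaussian 0 S) := by
  refine ⟨fun n => ((h.measurable_centeredSum hf _ _).const_smul (√(k n : ℝ))⁻¹).aemeasurable,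
    aemeasurable_id, ProbabilityMeasure.tendsto_of_tendsto_charFun fun u => ?_⟩
  have hlim := h.tendsto_charFun_centeredSum hf hf2 hk hN u
  have hchar : charFun ((multivariateGaussian 0 S).map id) u =
      Complex.exp ((-(u.ofLp ⬝ᵥ S.mulVec u.ofLp) / 2 : ℝ) : ℂ) := by
    rw [Measure.map_id, charFun_multivariateGaussian hS]
    simp [neg_div]
  rw [hcov, ← hchar] at hlim
  exact hlim

end CentralLimit

section LearnSize

variable {δ s : ℝ}

lemma tendsto_learnSize (hδ : 0 < δ) : Tendsto (learnSize δ) atTop atTop :=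
  tendsto_nat_floor_atTop.comp ((tendsto_rpow_atTop hδ).comp tendsto_natCast_atTop_atTop)

lemma tendsto_natFloor_mul (hs : 0 < s) : Tendsto (fun n : ℕ => ⌊s * n⌋₊) atTop atTop :=
  tendsto_nat_floor_atTop.comp (tendsto_natCast_atTop_atTop.const_mul_atTop hs)

lemma tendsto_natFloor_mul_div_natCast (hs : 0 ≤ s) :
    Tendsto (fun n : ℕ => (⌊s * n⌋₊ : ℝ) / n) atTop (𝓝 s) :=
  (tendsto_nat_floor_mul_div_atTop hs).comp tendsto_natCast_atTop_atTop

lemma tendsto_learnSize_div_rpow (hδ : 0 < δ) :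
    Tendsto (fun n : ℕ => (learnSize δ n : ℝ) / (n : ℝ) ^ δ) atTop (𝓝 1) :=
  tendsto_nat_floor_div_atTop.comp ((tendsto_rpow_atTop hδ).comp tendsto_natCast_atTop_atTop)

lemma tendsto_learnSize_div_natFloor (hδ₀ : 0 < δ) (hδ₁ : δ < 1) (hs : 0 < s) :
    Tendsto (fun n : ℕ => (learnSize δ n : ℝ) / ⌊s * n⌋₊) atTop (𝓝 0) := by
  have hrpow := (tendsto_rpow_neg_atTop (sub_pos.2 hδ₁)).comp
    (tendsto_natCast_atTop_atTop (R := ℝ))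
  have hlim := ((tendsto_learnSize_div_rpow hδ₀).mul hrpow).div
    (tendsto_natFloor_mul_div_natCast hs.le) hs.ne'
  rw [mul_zero, zero_div] at hlim
  refine hlim.congr' ?_
  filter_upwards [eventually_gt_atTop 0] with n hn
  have hn0 : (0 : ℝ) < n := Nat.cast_pos.2 hn
  rw [Pi.div_apply, Function.comp_apply, neg_sub, Real.rpow_sub_one hn0.ne']
  field_simp

lemma tendsto_sqrt_natFloor_div_learnSize (hδ : 1 / 2 < δ) (hs : 0 ≤ s) :
    Tendsto (fun n : ℕ => √⌊s * n⌋₊ / learnSize δ n) atTop (𝓝 0) := by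
  have hrpow := (tendsto_rpow_neg_atTop (sub_pos.2 hδ)).comp
    (tendsto_natCast_atTop_atTop (R := ℝ))
  have hlim := ((tendsto_natFloor_mul_div_natCast hs).sqrt.mul hrpow).div
    (tendsto_learnSize_div_rpow (one_half_pos.trans hδ)) one_ne_zero
  rw [mul_zero, zero_div] at hlim
  refine hlim.congr' ?_
  filter_upwards [eventually_gt_atTop 0] with n hn
  have hn0 : (0 : ℝ) < n := Nat.cast_pos.2 hn
  rw [Pi.div_apply, Function.comp_apply, neg_sub, Real.rpow_sub hn0, ← Real.sqrt_eq_rpow,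
    Real.sqrt_div (Nat.cast_nonneg _)]
  field_simp

end LearnSize

section GradientCalculus

variable {E V : Type*} [NormedAddCommGroup E]

section Taylor

variable [NormedSpace ℝ E] [NormedAddCommGroup V] [NormedSpace ℝ V] {F : E → V} {s : Set E} {C : ℝ}
  {x y : E}

lemma norm_fderiv_sub_fderiv_le (hso : IsOpen s) (hsc : Convex ℝ s) (hF : ContDiffOn ℝ 2 F s)
    (hC : ∀ z ∈ s, ‖iteratedFDeriv ℝ 2 F z‖ ≤ C) (hx : x ∈ s) (hy : y ∈ s) :
    ‖fderiv ℝ F x - fderiv ℝ F y‖ ≤ C * ‖x - y‖ := by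
  refine Convex.norm_image_sub_le_of_norm_fderiv_le (𝕜 := ℝ) (fun z hz => ?_) (fun z hz => ?_)
    hsc hy hx
  · exact ((hF.contDiffAt (hso.mem_nhds hz)).fderiv_right (m := 1) (by norm_num)).differentiableAt
      one_ne_zero
  · rw [← norm_iteratedFDeriv_one, norm_iteratedFDeriv_fderiv]
    exact hC z hz

lemma norm_sub_sub_fderiv_le (hso : IsOpen s) (hsc : Convex ℝ s) (hF : ContDiffOn ℝ 2 F s)
    (hC : ∀ z ∈ s, ‖iteratedFDeriv ℝ 2 F z‖ ≤ C) (hx : x ∈ s) (hy : y ∈ s) :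
    ‖F x - F y - fderiv ℝ F y (x - y)‖ ≤ C * ‖x - y‖ ^ 2 := by
  have hseg : segment ℝ y x ⊆ s := hsc.segment_subset hy hx
  have hC0 : 0 ≤ C := (norm_nonneg _).trans (hC x hx)
  have hbound : ∀ z ∈ segment ℝ y x, ‖fderiv ℝ F z - fderiv ℝ F y‖ ≤ C * ‖x - y‖ := fun z hz => by
    refine (norm_fderiv_sub_fderiv_le hso hsc hF hC (hseg hz) hy).trans ?_
    gcongr
    simpa only [norm_sub_rev] using norm_sub_le_of_mem_segment hz
  have hdiff : ∀ z ∈ segment ℝ y x, DifferentiableAt ℝ F z := fun z hz =>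
    (hF.contDiffAt (hso.mem_nhds (hseg hz))).differentiableAt two_ne_zero
  calc ‖F x - F y - fderiv ℝ F y (x - y)‖
      ≤ C * ‖x - y‖ * ‖x - y‖ := Convex.norm_image_sub_le_of_norm_fderiv_le' hdiff hbound
        (convex_segment _ _) (left_mem_segment ℝ y x) (right_mem_segment ℝ y x)
    _ = C * ‖x - y‖ ^ 2 := by ring

end Taylor

variable [InnerProductSpace ℝ E] [CompleteSpace E] {f : E → ℝ} {x : E}

variable (E) in
/-- The Riesz isomorphism as an `ℝ`-linear isometry; `InnerProductSpace.toDual` is only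
conjugate-linear on the nose, which the calculus of iterated derivatives does not accept. -/
noncomputable def rieszIsometry : StrongDual ℝ E ≃ₗᵢ[ℝ] E where
  toFun := (InnerProductSpace.toDual ℝ E).symm
  invFun := InnerProductSpace.toDual ℝ E
  map_add' := map_add _
  map_smul' _ _ := by simp
  left_inv _ := by simp
  right_inv _ := by simp
  norm_map' _ := LinearIsometryEquiv.norm_map _ _

lemma norm_iteratedFDeriv_gradient (f : E → ℝ) (x : E) (i : ℕ) :
    ‖iteratedFDeriv ℝ i (gradient f) x‖ = ‖iteratedFDeriv ℝ (i + 1) f x‖ := by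
  rw [← norm_iteratedFDeriv_fderiv]
  exact (rieszIsometry E).norm_iteratedFDeriv_comp_left (fderiv ℝ f) x i

lemma norm_gradient (f : E → ℝ) (x : E) : ‖gradient f x‖ = ‖iteratedFDeriv ℝ 1 f x‖ := by
  simpa only [norm_iteratedFDeriv_zero] using norm_iteratedFDeriv_gradient f x 0

lemma contDiffAt_gradient {m n : WithTop ℕ∞} (hf : ContDiffAt ℝ n f x) (hmn : m + 1 ≤ n) :
    ContDiffAt ℝ m (gradient f) x :=
  (rieszIsometry E).contDiff.contDiffAt.comp x (hf.fderiv_right hmn)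

lemma gradient_exp (hf : DifferentiableAt ℝ f x) :
    gradient (fun y => Real.exp (f y)) x = Real.exp (f x) • gradient f x := by
  rw [gradient, fderiv_exp hf]
  exact map_smul (rieszIsometry E) _ _

end GradientCalculus

section ParametricMeasurability

variable {α β : Type*} [MeasurableSpace α] {T : Set α}

lemma measurable_indicator_iff_domRestrict [MeasurableSpace β] [Zero β] (hT : MeasurableSet T)
    {g : α → β} : Measurable (T.indicator g) ↔ Measurable (T.domRestrict g) := by
  have hrestrict : T.domRestrict (T.indicator g) = T.domRestrict g :=
    funext fun x => Set.indicator_of_mem x.2 g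
  refine ⟨fun h => hrestrict ▸ h.comp measurable_subtype_coe, fun h => ?_⟩
  refine measurable_of_restrict_of_restrict_compl hT (hrestrict ▸ h) ?_
  have hcompl : Tᶜ.domRestrict (T.indicator g) = fun _ => 0 :=
    funext fun x => Set.indicator_of_notMem x.2 g
  exact hcompl ▸ measurable_const

lemma aestronglyMeasurable_restrict_of_measurable_indicator [TopologicalSpace β]
    [SecondCountableTopology β] [TopologicalSpace.PseudoMetrizableSpace β] [MeasurableSpace β]
    [BorelSpace β] [Zero β] {μ : Measure α} (hT : MeasurableSet T) {g : α → β}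
    (hg : Measurable (T.indicator g)) : AEStronglyMeasurable g (μ.restrict T) :=
  hg.aestronglyMeasurable.congr (indicator_ae_eq_restrict hT)

lemma measurable_indicator_fderiv_apply {E V : Type*} [NormedAddCommGroup E] [NormedSpace ℝ E]
    [NormedAddCommGroup V] [NormedSpace ℝ V] [FiniteDimensional ℝ V] [MeasurableSpace V]
    [BorelSpace V] {Θ : Set E} (hΘ : IsOpen Θ) {F : E → α → V}
    (hFm : ∀ θ ∈ Θ, Measurable (T.indicator (F θ))) {θ : E} (hθ : θ ∈ Θ)
    (hF : ∀ t ∈ T, DifferentiableAt ℝ (fun θ' => F θ' t) θ) (v : E) :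
    Measurable (T.indicator fun t => fderiv ℝ (fun θ' => F θ' t) θ v) := by
  have hscale : Tendsto (fun n : ℕ => ‖(n : ℝ)‖) atTop atTop :=
    tendsto_norm_atTop_atTop.comp tendsto_natCast_atTop_atTop
  have hmem : ∀ᶠ n : ℕ in atTop, θ + (n : ℝ)⁻¹ • v ∈ Θ := by
    have hlim : Tendsto (fun n : ℕ => θ + (n : ℝ)⁻¹ • v) atTop (𝓝 (θ + (0 : ℝ) • v)) :=
      (tendsto_inv_atTop_nhds_zero_nat.smul_const v).const_add θ
    rw [zero_smul, add_zero] at hlim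
    exact hlim.eventually (hΘ.mem_nhds hθ)
  obtain ⟨n₀, hn₀⟩ := eventually_atTop.1 hmem
  let quotient (n : ℕ) (t : α) : V :=
    (n : ℝ) • (T.indicator (F (θ + (n : ℝ)⁻¹ • v)) t - T.indicator (F θ) t)
  refine measurable_of_tendsto_metrizable (f := fun n => quotient (n + n₀)) (fun n => ?_)
    (tendsto_pi_nhds.2 fun t => ?_)
  · exact ((hFm _ (hn₀ _ (Nat.le_add_left _ _))).sub (hFm θ hθ)).const_smul _
  · refine Tendsto.comp (g := fun n => quotient n t) ?_ (tendsto_add_atTop_nat n₀)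
    by_cases ht : t ∈ T
    · simpa only [quotient, Set.indicator_of_mem ht] using (hF t ht).hasFDerivAt.lim v hscale
    · simp [quotient, Set.indicator_of_notMem ht]

end ParametricMeasurability

section ExpBounds

lemma abs_exp_sub_one_le_mul_exp (x : ℝ) : |Real.exp x - 1| ≤ |x| * Real.exp |x| := by
  have h := Complex.norm_exp_sub_sum_le_norm_mul_exp x 1
  simp only [Finset.sum_range_one, pow_zero, Nat.factorial_zero, Nat.cast_one, div_one, pow_one,
    Complex.norm_real, Real.norm_eq_abs] at h
  rwa [← Complex.ofReal_exp, ← Complex.ofReal_one, ← Complex.ofReal_sub, Complex.norm_real] at h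

lemma abs_exp_sub_one_sub_le_mul_exp (x : ℝ) :
    |Real.exp x - 1 - x| ≤ |x| ^ 2 * Real.exp |x| := by
  have h := Complex.norm_exp_sub_sum_le_norm_mul_exp x 2
  simp only [Finset.sum_range_succ, Finset.sum_range_zero, zero_add, pow_zero, pow_one,
    Nat.factorial_zero, Nat.factorial_one, Nat.cast_one, div_one, Complex.norm_real,
    Real.norm_eq_abs] at h
  rwa [← Complex.ofReal_exp, ← Complex.ofReal_one, ← Complex.ofReal_add, ← Complex.ofReal_sub,
    Complex.norm_real, ← sub_sub] at h

lemma abs_exp_sub_exp_le (a b : ℝ) :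
    |Real.exp a - Real.exp b| ≤ |a - b| * Real.exp |a - b| * Real.exp b := by
  have hfactor : Real.exp a - Real.exp b = (Real.exp (a - b) - 1) * Real.exp b := by
    rw [sub_mul, ← Real.exp_add, sub_add_cancel, one_mul]
  rw [hfactor, abs_mul, Real.abs_exp]
  gcongr
  exact abs_exp_sub_one_le_mul_exp _

lemma abs_exp_sub_exp_sub_mul_le (a b w : ℝ) :
    |Real.exp a - Real.exp b - Real.exp b * w| ≤
      (|a - b| ^ 2 * Real.exp |a - b| + |a - b - w|) * Real.exp b := by
  have hfactor : Real.exp a - Real.exp b - Real.exp b * w =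
      (Real.exp (a - b) - 1 - (a - b) + (a - b - w)) * Real.exp b := by
    rw [show Real.exp a = Real.exp (a - b) * Real.exp b by rw [← Real.exp_add, sub_add_cancel]]
    ring
  rw [hfactor, abs_mul, Real.abs_exp]
  gcongr
  exact (abs_add_le _ _).trans (add_le_add_left (abs_exp_sub_one_sub_le_mul_exp _) _)

end ExpBounds

section RegularModel

variable {d : ℕ} {T : Set ℝ} {Θ : Set (EuclideanSpace ℝ (Fin d))}
  {lam : EuclideanSpace ℝ (Fin d) → ℝ → ℝ} {θ : EuclideanSpace ℝ (Fin d)} {t : ℝ}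

lemma IsIntensityFamily.mono {Θ' : Set (EuclideanSpace ℝ (Fin d))}
    (hlam : IsIntensityFamily T Θ lam) (hΘ : Θ' ⊆ Θ) : IsIntensityFamily T Θ' lam where
  pos θ hθ := hlam.pos θ (hΘ hθ)
  measurable θ hθ := hlam.measurable θ (hΘ hθ)
  integrableOn θ hθ := hlam.integrableOn θ (hΘ hθ)

lemma IsIntensityFamily.measurable_indicator (hlam : IsIntensityFamily T Θ lam)
    (hT : MeasurableSet T) (hθ : θ ∈ Θ) : Measurable (T.indicator (lam θ)) :=
  (measurable_indicator_iff_domRestrict hT).2 (hlam.measurable θ hθ)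

namespace RegularityL0

lemma mono {Θ' : Set (EuclideanSpace ℝ (Fin d))} (hL0 : RegularityL0 T Θ lam) (hΘ : Θ' ⊆ Θ) :
    RegularityL0 T Θ' lam where
  smooth t ht := (hL0.smooth t ht).mono hΘ
  bounded := hL0.bounded.imp fun _ hC m h1 h3 θ hθ => hC m h1 h3 θ (hΘ hθ)
  nondegenerate := hL0.nondegenerate.imp fun _ hc => ⟨hc.1, fun θ hθ => hc.2 θ (hΘ hθ)⟩

lemma contDiffAt_log (hL0 : RegularityL0 T Θ lam) (hΘ : IsOpen Θ) (hθ : θ ∈ Θ) (ht : t ∈ T) :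
    ContDiffAt ℝ 3 (fun θ' => Real.log (lam θ' t)) θ :=
  (hL0.smooth t ht).contDiffAt (hΘ.mem_nhds hθ)

lemma contDiffAt_score (hL0 : RegularityL0 T Θ lam) (hΘ : IsOpen Θ) (hθ : θ ∈ Θ) (ht : t ∈ T) :
    ContDiffAt ℝ 2 (fun θ' => score lam θ' t) θ :=
  contDiffAt_gradient (hL0.contDiffAt_log hΘ hθ ht) (by norm_num)

lemma gradient_eq_smul_score (hL0 : RegularityL0 T Θ lam) (hΘ : IsOpen Θ)
    (hlam : IsIntensityFamily T Θ lam) (hθ : θ ∈ Θ) (ht : t ∈ T) :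
    gradient (fun θ' => lam θ' t) θ = lam θ t • score lam θ t := by
  have hexp : (fun θ' => lam θ' t) =ᶠ[𝓝 θ] fun θ' => Real.exp (Real.log (lam θ' t)) := by
    filter_upwards [hΘ.mem_nhds hθ] with z hz using (Real.exp_log (hlam.pos z hz t ht)).symm
  rw [gradient, hexp.fderiv_eq, ← gradient,
    gradient_exp ((hL0.contDiffAt_log hΘ hθ ht).differentiableAt three_ne_zero),
    Real.exp_log (hlam.pos θ hθ t ht), score]

lemma measurable_indicator_score (hL0 : RegularityL0 T Θ lam) (hΘ : IsOpen Θ)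
    (hT : MeasurableSet T) (hlam : IsIntensityFamily T Θ lam) (hθ : θ ∈ Θ) :
    Measurable (T.indicator (score lam θ)) := by
  have hlog : ∀ θ' ∈ Θ, Measurable (T.indicator fun t => Real.log (lam θ' t)) := fun θ' hθ' => by
    convert Real.measurable_log.comp (hlam.measurable_indicator hT hθ') using 1
    exact Set.indicator_comp_of_zero Real.log_zero
  have hpartial : ∀ v, Measurable (T.indicator fun t =>
      fderiv ℝ (fun θ' => Real.log (lam θ' t)) θ v) :=
    fun v => measurable_indicator_fderiv_apply hΘ hlog hθ
      (fun t ht => (hL0.contDiffAt_log hΘ hθ ht).differentiableAt three_ne_zero) v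
  let b := EuclideanSpace.basisFun (Fin d) ℝ
  have hsum : T.indicator (score lam θ) = fun t => ∑ i, (T.indicator fun t =>
      fderiv ℝ (fun θ' => Real.log (lam θ' t)) θ (b i)) t • b i := by
    ext1 t
    by_cases ht : t ∈ T
    · simp only [Set.indicator_of_mem ht]
      rw [← b.sum_repr' (score lam θ t)]
      refine Finset.sum_congr rfl fun i _ => ?_
      rw [real_inner_comm, score, inner_gradient_left]
    · simp [ht]
  rw [hsum]
  exact Finset.measurable_fun_sum _ fun i _ => (hpartial (b i)).smul_const _

end RegularityL0

/-- A regular intensity family with explicit constants: `C` bounds the score, its first two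
derivatives in the form of Taylor estimates, and the relative variation of the intensity, while
`c` bounds the Fisher information from below. -/
structure RegularModel (T : Set ℝ) (Θ : Set (EuclideanSpace ℝ (Fin d)))
    (lam : EuclideanSpace ℝ (Fin d) → ℝ → ℝ) (C c : ℝ) : Prop where
  measurableSet : MeasurableSet T
  isOpen : IsOpen Θ
  family : IsIntensityFamily T Θ lam
  measurable_score : ∀ θ ∈ Θ, Measurable (T.indicator (score lam θ))
  differentiableAt_score : ∀ θ ∈ Θ, ∀ t ∈ T, DifferentiableAt ℝ (fun θ' => score lam θ' t) θ
  gradient_eq : ∀ θ ∈ Θ, ∀ t ∈ T, gradient (fun θ' => lam θ' t) θ = lam θ t • score lam θ t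
  const_pos : 0 < C
  norm_score : ∀ θ ∈ Θ, ∀ t ∈ T, ‖score lam θ t‖ ≤ C
  norm_fderiv_score : ∀ θ ∈ Θ, ∀ t ∈ T, ‖fderiv ℝ (fun θ' => score lam θ' t) θ‖ ≤ C
  score_sub : ∀ θ ∈ Θ, ∀ θ' ∈ Θ, ∀ t ∈ T, ‖score lam θ t - score lam θ' t‖ ≤ C * ‖θ - θ'‖
  score_taylor : ∀ θ ∈ Θ, ∀ θ' ∈ Θ, ∀ t ∈ T, ‖score lam θ t - score lam θ' t
    - fderiv ℝ (fun θ'' => score lam θ'' t) θ' (θ - θ')‖ ≤ C * ‖θ - θ'‖ ^ 2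
  lam_le : ∀ θ ∈ Θ, ∀ θ' ∈ Θ, ∀ t ∈ T, lam θ t ≤ C * lam θ' t
  lam_sub : ∀ θ ∈ Θ, ∀ θ' ∈ Θ, ∀ t ∈ T, |lam θ t - lam θ' t| ≤ C * ‖θ - θ'‖ * lam θ' t
  lam_taylor : ∀ θ ∈ Θ, ∀ θ' ∈ Θ, ∀ t ∈ T,
    |lam θ t - lam θ' t - lam θ' t * inner ℝ (score lam θ' t) (θ - θ')| ≤
      C * ‖θ - θ'‖ ^ 2 * lam θ' t
  info_pos : 0 < c
  le_info : ∀ θ ∈ Θ, ∀ u : EuclideanSpace ℝ (Fin d), ‖u‖ = 1 →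
    c ≤ inner ℝ u (Matrix.toEuclideanLin (fisherInfo T lam θ) u)

section LogLipschitz

variable {E : Type*} [SeminormedAddCommGroup E] {x y : E} {a b A R : ℝ}

lemma le_exp_mul_of_abs_log_sub_le (ha : 0 < a) (hb : 0 < b)
    (hR : |Real.log a - Real.log b| ≤ R) : a ≤ Real.exp R * b := by
  rw [← Real.log_le_log_iff ha (by positivity), Real.log_mul (by positivity) hb.ne', Real.log_exp]
  linarith [le_abs_self (Real.log a - Real.log b)]

lemma abs_sub_le_of_abs_log_sub_le (ha : 0 < a) (hb : 0 < b)
    (hlip : |Real.log a - Real.log b| ≤ A * ‖x - y‖) (hR : A * ‖x - y‖ ≤ R) :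
    |a - b| ≤ A * Real.exp R * ‖x - y‖ * b := by
  have h := abs_exp_sub_exp_le (Real.log a) (Real.log b)
  rw [Real.exp_log ha, Real.exp_log hb] at h
  have hAxy : 0 ≤ A * ‖x - y‖ := (abs_nonneg _).trans hlip
  calc |a - b| ≤ A * ‖x - y‖ * Real.exp R * b := by
        refine h.trans ?_
        gcongr
        exact hlip.trans hR
    _ = A * Real.exp R * ‖x - y‖ * b := by ring

lemma abs_sub_sub_mul_le_of_abs_log_sub_le {w : ℝ} (ha : 0 < a) (hb : 0 < b)
    (hlip : |Real.log a - Real.log b| ≤ A * ‖x - y‖) (hR : A * ‖x - y‖ ≤ R)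
    (htaylor : |Real.log a - Real.log b - w| ≤ A * ‖x - y‖ ^ 2) :
    |a - b - b * w| ≤ (A ^ 2 * Real.exp R + A) * ‖x - y‖ ^ 2 * b := by
  have h := abs_exp_sub_exp_sub_mul_le (Real.log a) (Real.log b) w
  rw [Real.exp_log ha, Real.exp_log hb] at h
  calc |a - b - b * w| ≤ ((A * ‖x - y‖) ^ 2 * Real.exp R + A * ‖x - y‖ ^ 2) * b := by
        refine h.trans ?_
        gcongr
        exact hlip.trans hR
    _ = (A ^ 2 * Real.exp R + A) * ‖x - y‖ ^ 2 * b := by ring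

end LogLipschitz

lemma norm_iteratedFDeriv_score (θ : EuclideanSpace ℝ (Fin d)) (t : ℝ) (m : ℕ) :
    ‖iteratedFDeriv ℝ m (fun θ' => score lam θ' t) θ‖ =
      ‖iteratedFDeriv ℝ (m + 1) (fun θ' => Real.log (lam θ' t)) θ‖ :=
  norm_iteratedFDeriv_gradient (fun θ' => Real.log (lam θ' t)) θ m

lemma norm_fderiv_score (θ : EuclideanSpace ℝ (Fin d)) (t : ℝ) :
    ‖fderiv ℝ (fun θ' => score lam θ' t) θ‖ =
      ‖iteratedFDeriv ℝ 2 (fun θ' => Real.log (lam θ' t)) θ‖ := by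
  rw [← norm_iteratedFDeriv_one, norm_iteratedFDeriv_score]

namespace RegularityL0

variable {θ' : EuclideanSpace ℝ (Fin d)} {A : ℝ}

lemma abs_log_sub_le (hL0 : RegularityL0 T Θ lam) (hΘo : IsOpen Θ) (hΘc : Convex ℝ Θ) (ht : t ∈ T)
    (hA : ∀ θ ∈ Θ, ‖iteratedFDeriv ℝ 1 (fun θ' => Real.log (lam θ' t)) θ‖ ≤ A) (hθ : θ ∈ Θ)
    (hθ' : θ' ∈ Θ) : |Real.log (lam θ t) - Real.log (lam θ' t)| ≤ A * ‖θ - θ'‖ :=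
  Convex.norm_image_sub_le_of_norm_fderiv_le (𝕜 := ℝ)
    (fun _ hz => (hL0.contDiffAt_log hΘo hz ht).differentiableAt three_ne_zero)
    (fun z hz => (norm_iteratedFDeriv_one _).symm.trans_le (hA z hz)) hΘc hθ' hθ

lemma abs_log_sub_sub_inner_le (hL0 : RegularityL0 T Θ lam) (hΘo : IsOpen Θ) (hΘc : Convex ℝ Θ)
    (ht : t ∈ T) (hA : ∀ θ ∈ Θ, ‖iteratedFDeriv ℝ 2 (fun θ' => Real.log (lam θ' t)) θ‖ ≤ A)
    (hθ : θ ∈ Θ) (hθ' : θ' ∈ Θ) :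
    |Real.log (lam θ t) - Real.log (lam θ' t) - inner ℝ (score lam θ' t) (θ - θ')| ≤
      A * ‖θ - θ'‖ ^ 2 := by
  rw [score, inner_gradient_left]
  exact norm_sub_sub_fderiv_le hΘo hΘc ((hL0.smooth t ht).of_le (by norm_num)) hA hθ hθ'

lemma norm_score_sub_le (hL0 : RegularityL0 T Θ lam) (hΘo : IsOpen Θ) (hΘc : Convex ℝ Θ)
    (ht : t ∈ T) (hA : ∀ θ ∈ Θ, ‖iteratedFDeriv ℝ 2 (fun θ' => Real.log (lam θ' t)) θ‖ ≤ A)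
    (hθ : θ ∈ Θ) (hθ' : θ' ∈ Θ) : ‖score lam θ t - score lam θ' t‖ ≤ A * ‖θ - θ'‖ :=
  Convex.norm_image_sub_le_of_norm_fderiv_le (𝕜 := ℝ)
    (fun _ hz => (hL0.contDiffAt_score hΘo hz ht).differentiableAt two_ne_zero)
    (fun z hz => (norm_fderiv_score z t).trans_le (hA z hz)) hΘc hθ' hθ

lemma norm_score_sub_sub_fderiv_le (hL0 : RegularityL0 T Θ lam) (hΘo : IsOpen Θ)
    (hΘc : Convex ℝ Θ) (ht : t ∈ T)
    (hA : ∀ θ ∈ Θ, ‖iteratedFDeriv ℝ 3 (fun θ' => Real.log (lam θ' t)) θ‖ ≤ A) (hθ : θ ∈ Θ)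
    (hθ' : θ' ∈ Θ) : ‖score lam θ t - score lam θ' t
      - fderiv ℝ (fun θ'' => score lam θ'' t) θ' (θ - θ')‖ ≤ A * ‖θ - θ'‖ ^ 2 :=
  norm_sub_sub_fderiv_le (F := fun θ => score lam θ t) hΘo hΘc
    (fun _ hz => (hL0.contDiffAt_score hΘo hz ht).contDiffWithinAt)
    (fun z hz => (norm_iteratedFDeriv_score z t 2).trans_le (hA z hz)) hθ hθ'

end RegularityL0

lemma exists_regularModel (hT : MeasurableSet T) (hΘo : IsOpen Θ) (hΘc : Convex ℝ Θ)
    (hΘb : Bornology.IsBounded Θ) (hlam : IsIntensityFamily T Θ lam) (hL0 : RegularityL0 T Θ lam) :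
    ∃ C c, RegularModel T Θ lam C c := by
  obtain ⟨C₀, hC₀⟩ := hL0.bounded
  obtain ⟨c, hc, hcI⟩ := hL0.nondegenerate
  let A := max C₀ 1
  let R := A * Metric.diam Θ
  let C := A ^ 2 * Real.exp R + A
  have hA1 : 1 ≤ A := le_max_right _ _
  have hA0 : 0 ≤ A := zero_le_one.trans hA1
  have hderiv : ∀ m : ℕ, 1 ≤ m → m ≤ 3 → ∀ t ∈ T, ∀ θ ∈ Θ,
      ‖iteratedFDeriv ℝ m (fun θ' => Real.log (lam θ' t)) θ‖ ≤ A :=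
    fun m h1 h3 t ht θ hθ => (hC₀ m h1 h3 θ hθ t ht).trans (le_max_left _ _)
  have hR : ∀ θ ∈ Θ, ∀ θ' ∈ Θ, A * ‖θ - θ'‖ ≤ R := fun θ hθ θ' hθ' =>
    mul_le_mul_of_nonneg_left (dist_eq_norm θ θ' ▸ Metric.dist_le_diam_of_mem hΘb hθ hθ') hA0
  have hlip : ∀ θ ∈ Θ, ∀ θ' ∈ Θ, ∀ t ∈ T,
      |Real.log (lam θ t) - Real.log (lam θ' t)| ≤ A * ‖θ - θ'‖ := fun θ hθ θ' hθ' t ht =>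
    hL0.abs_log_sub_le hΘo hΘc ht (hderiv 1 le_rfl (by simp) t ht) hθ hθ'
  have hAC : A ≤ C := le_add_of_nonneg_left (by positivity)
  have hQC : Real.exp R ≤ C :=
    (le_mul_of_one_le_left (Real.exp_pos R).le (one_le_pow₀ hA1)).trans
      (le_add_of_nonneg_right hA0)
  have hAQC : A * Real.exp R ≤ C :=
    (mul_le_mul_of_nonneg_right (le_self_pow₀ hA1 two_ne_zero) (Real.exp_pos R).le).trans
      (le_add_of_nonneg_right hA0)
  refine ⟨C, c, hT, hΘo, hlam, fun θ hθ => hL0.measurable_indicator_score hΘo hT hlam hθ,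
    fun θ hθ t ht => (hL0.contDiffAt_score hΘo hθ ht).differentiableAt two_ne_zero,
    fun θ hθ t ht => hL0.gradient_eq_smul_score hΘo hlam hθ ht, by positivity,
    fun θ hθ t ht => (norm_gradient _ _).trans_le ?_,
    fun θ hθ t ht => (norm_fderiv_score _ _).trans_le ?_,
    fun θ hθ θ' hθ' t ht => hL0.norm_score_sub_le hΘo hΘc ht ?_ hθ hθ',
    fun θ hθ θ' hθ' t ht => hL0.norm_score_sub_sub_fderiv_le hΘo hΘc ht ?_ hθ hθ',
    fun θ hθ θ' hθ' t ht => ?_, fun θ hθ θ' hθ' t ht => ?_, fun θ hθ θ' hθ' t ht => ?_, hc, hcI⟩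
  · exact (hderiv 1 le_rfl (by simp) t ht θ hθ).trans hAC
  · exact (hderiv 2 one_le_two (by simp) t ht θ hθ).trans hAC
  · exact fun z hz => (hderiv 2 one_le_two (by simp) t ht z hz).trans hAC
  · exact fun z hz => (hderiv 3 (by simp) le_rfl t ht z hz).trans hAC
  · have hpos := hlam.pos θ' hθ' t ht
    exact (le_exp_mul_of_abs_log_sub_le (hlam.pos θ hθ t ht) hpos
      ((hlip θ hθ θ' hθ' t ht).trans (hR θ hθ θ' hθ'))).trans (by gcongr)
  · have hpos := hlam.pos θ' hθ' t ht
    exact (abs_sub_le_of_abs_log_sub_le (hlam.pos θ hθ t ht) hpos (hlip θ hθ θ' hθ' t ht)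
      (hR θ hθ θ' hθ')).trans (by gcongr)
  · exact abs_sub_sub_mul_le_of_abs_log_sub_le (hlam.pos θ hθ t ht) (hlam.pos θ' hθ' t ht)
      (hlip θ hθ θ' hθ' t ht) (hR θ hθ θ' hθ')
      (hL0.abs_log_sub_sub_inner_le hΘo hΘc ht (hderiv 2 one_le_two (by simp) t ht) hθ hθ')

end RegularModel

section FisherInformation

variable {d : ℕ} {T : Set ℝ} {Θ : Set (EuclideanSpace ℝ (Fin d))}
  {lam : EuclideanSpace ℝ (Fin d) → ℝ → ℝ} {C c : ℝ}

/-- The expected number of events of a Poisson process on `T` with intensity `lam θ`. -/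
noncomputable def totalIntensity (T : Set ℝ) (lam : EuclideanSpace ℝ (Fin d) → ℝ → ℝ)
    (θ : EuclideanSpace ℝ (Fin d)) : ℝ := ∫ t in T, lam θ t

/-- The Fisher information as an operator. -/
noncomputable def infoOp (T : Set ℝ) (lam : EuclideanSpace ℝ (Fin d) → ℝ → ℝ)
    (θ : EuclideanSpace ℝ (Fin d)) : EuclideanSpace ℝ (Fin d) →ₗ[ℝ] EuclideanSpace ℝ (Fin d) :=
  Matrix.toEuclideanLin (fisherInfo T lam θ)

/-- The inverse of the Fisher information as an operator; it is only meaningful where the Fisher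
information matrix is invertible. -/
noncomputable def infoInv (T : Set ℝ) (lam : EuclideanSpace ℝ (Fin d) → ℝ → ℝ)
    (θ : EuclideanSpace ℝ (Fin d)) : EuclideanSpace ℝ (Fin d) →ₗ[ℝ] EuclideanSpace ℝ (Fin d) :=
  Matrix.toEuclideanLin (fisherInfo T lam θ)⁻¹

namespace RegularModel

variable {θ θ' : EuclideanSpace ℝ (Fin d)}

lemma norm_setIntegral_le {V : Type*} [NormedAddCommGroup V] [NormedSpace ℝ V] {F : ℝ → V}
    (h : RegularModel T Θ lam C c) (hθ : θ ∈ Θ) {M : ℝ} (hF : ∀ t ∈ T, ‖F t‖ ≤ M * lam θ t) :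
    ‖∫ t in T, F t‖ ≤ M * totalIntensity T lam θ := by
  rw [totalIntensity, ← integral_const_mul]
  refine norm_integral_le_of_norm_le ((h.family.integrableOn θ hθ).const_mul M) ?_
  filter_upwards [ae_restrict_mem h.measurableSet] with t ht using hF t ht

lemma totalIntensity_nonneg (h : RegularModel T Θ lam C c) (hθ : θ ∈ Θ) :
    0 ≤ totalIntensity T lam θ :=
  setIntegral_nonneg h.measurableSet fun t ht => (h.family.pos θ hθ t ht).le

lemma totalIntensity_le (h : RegularModel T Θ lam C c) (hθ : θ ∈ Θ) (hθ' : θ' ∈ Θ) :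
    totalIntensity T lam θ ≤ C * totalIntensity T lam θ' := by
  rw [totalIntensity, totalIntensity, ← integral_const_mul]
  exact setIntegral_mono_on (h.family.integrableOn θ hθ)
    ((h.family.integrableOn θ' hθ').const_mul C) h.measurableSet
    fun t ht => h.lam_le θ hθ θ' hθ' t ht

lemma integrable_smul {V : Type*} [NormedAddCommGroup V] [NormedSpace ℝ V] {g : ℝ → V} {B : ℝ}
    (h : RegularModel T Θ lam C c) (hg : AEStronglyMeasurable g (volume.restrict T))
    (hB : ∀ t ∈ T, ‖g t‖ ≤ B) (hθ : θ ∈ Θ) :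
    Integrable (fun t => lam θ t • g t) (volume.restrict T) :=
  (h.family.integrableOn θ hθ).smul_bdd B hg
    ((ae_restrict_mem h.measurableSet).mono hB)

lemma aestronglyMeasurable_score (h : RegularModel T Θ lam C c) (hθ : θ ∈ Θ) :
    AEStronglyMeasurable (score lam θ) (volume.restrict T) :=
  aestronglyMeasurable_restrict_of_measurable_indicator h.measurableSet (h.measurable_score θ hθ)

lemma integrable_smul_score (h : RegularModel T Θ lam C c) (hθ : θ ∈ Θ) (hθ' : θ' ∈ Θ) :
    Integrable (fun t => lam θ t • score lam θ' t) (volume.restrict T) :=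
  h.integrable_smul (h.aestronglyMeasurable_score hθ') (h.norm_score θ' hθ') hθ

lemma abs_inner_score_le (h : RegularModel T Θ lam C c) (hθ : θ ∈ Θ)
    (v : EuclideanSpace ℝ (Fin d)) {t : ℝ} (ht : t ∈ T) :
    |inner ℝ (score lam θ t) v| ≤ C * ‖v‖ :=
  (abs_real_inner_le_norm _ _).trans
    (mul_le_mul_of_nonneg_right (h.norm_score θ hθ t ht) (norm_nonneg _))

lemma integrable_inner_smul_score (h : RegularModel T Θ lam C c) (hθ : θ ∈ Θ)
    (v : EuclideanSpace ℝ (Fin d)) :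
    Integrable (fun t => lam θ t • (inner ℝ (score lam θ t) v : ℝ) • score lam θ t)
      (volume.restrict T) := by
  have hscore := h.aestronglyMeasurable_score hθ
  refine h.integrable_smul (B := C * ‖v‖ * C)
    ((hscore.inner aestronglyMeasurable_const).fun_smul hscore) (fun t ht => ?_) hθ
  rw [norm_smul, Real.norm_eq_abs]
  exact mul_le_mul (h.abs_inner_score_le hθ v ht) (h.norm_score θ hθ t ht) (norm_nonneg _)
    (mul_nonneg h.const_pos.le (norm_nonneg v))

lemma fisherInfo_apply (h : RegularModel T Θ lam C c) (hθ : θ ∈ Θ) (i j : Fin d) :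
    fisherInfo T lam θ i j = ∫ t in T, lam θ t * (score lam θ t i * score lam θ t j) := by
  simp only [fisherInfo, Matrix.of_apply]
  refine setIntegral_congr_fun h.measurableSet fun t ht => ?_
  have hpos := (h.family.pos θ hθ t ht).ne'
  simp only [h.gradient_eq θ hθ t ht, PiLp.smul_apply, smul_eq_mul]
  field_simp

lemma infoOp_apply (h : RegularModel T Θ lam C c) (hθ : θ ∈ Θ) (v : EuclideanSpace ℝ (Fin d)) :
    infoOp T lam θ v = ∫ t in T, lam θ t • (inner ℝ (score lam θ t) v : ℝ) • score lam θ t := by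
  let coord (i : Fin d) : EuclideanSpace ℝ (Fin d) →L[ℝ] ℝ := EuclideanSpace.proj i
  have hint : ∀ i j, Integrable (fun t => lam θ t * (score lam θ t i * score lam θ t j))
      (volume.restrict T) := fun i j => by
    refine ((coord i).integrable_comp
      (h.integrable_inner_smul_score hθ (EuclideanSpace.single j 1))).congr
        (ae_of_all _ fun t => ?_)
    simp [coord, EuclideanSpace.inner_single_right, mul_comm]
  ext i
  have hmulVec : infoOp T lam θ v i = ∑ j, fisherInfo T lam θ i j * v j := by
    rw [infoOp, Matrix.toEuclideanLin, Matrix.toLpLin_apply]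
    rfl
  refine Eq.trans ?_ ((coord i).integral_comp_comm (h.integrable_inner_smul_score hθ v))
  rw [hmulVec]
  simp only [h.fisherInfo_apply hθ, ← integral_mul_const]
  rw [← integral_finsetSum _ fun j _ => (hint i j).mul_const (v j)]
  refine integral_congr_ae (ae_of_all _ fun t => ?_)
  simp only [coord, PiLp.proj_apply, PiLp.smul_apply, smul_eq_mul, PiLp.inner_apply,
    RCLike.inner_apply, conj_trivial, Finset.mul_sum, Finset.sum_mul]
  exact Finset.sum_congr rfl fun j _ => by ring

lemma inner_infoOp (h : RegularModel T Θ lam C c) (hθ : θ ∈ Θ)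
    (v w : EuclideanSpace ℝ (Fin d)) :
    inner ℝ w (infoOp T lam θ v) =
      ∫ t in T, lam θ t * (inner ℝ (score lam θ t) v * inner ℝ (score lam θ t) w) := by
  rw [h.infoOp_apply hθ, ← integral_inner (h.integrable_inner_smul_score hθ v)]
  simp only [inner_smul_right, real_inner_comm w]

lemma inner_infoOp_comm (h : RegularModel T Θ lam C c) (hθ : θ ∈ Θ)
    (v w : EuclideanSpace ℝ (Fin d)) :
    inner ℝ w (infoOp T lam θ v) = inner ℝ (infoOp T lam θ w) v := by
  rw [real_inner_comm v, h.inner_infoOp hθ, h.inner_infoOp hθ]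
  simp only [mul_comm (inner ℝ (score lam θ _) v)]

lemma le_inner_infoOp (h : RegularModel T Θ lam C c) (hθ : θ ∈ Θ)
    (v : EuclideanSpace ℝ (Fin d)) : c * ‖v‖ ^ 2 ≤ inner ℝ v (infoOp T lam θ v) := by
  rcases eq_or_ne v 0 with rfl | hv
  · simp
  have hunit := h.le_info θ hθ (‖v‖⁻¹ • v) (norm_smul_inv_norm (𝕜 := ℝ) hv)
  rw [map_smul, inner_smul_right, real_inner_smul_left, ← infoOp] at hunit
  calc c * ‖v‖ ^ 2 ≤ ‖v‖⁻¹ * (‖v‖⁻¹ * inner ℝ v (infoOp T lam θ v)) * ‖v‖ ^ 2 := by gcongr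
    _ = inner ℝ v (infoOp T lam θ v) := by
      have := norm_ne_zero_iff.2 hv
      field_simp

lemma le_norm_infoOp (h : RegularModel T Θ lam C c) (hθ : θ ∈ Θ)
    (v : EuclideanSpace ℝ (Fin d)) : c * ‖v‖ ≤ ‖infoOp T lam θ v‖ := by
  rcases eq_or_ne v 0 with rfl | hv
  · simp
  refine le_of_mul_le_mul_left ?_ (norm_pos_iff.2 hv)
  calc ‖v‖ * (c * ‖v‖) = c * ‖v‖ ^ 2 := by ring
    _ ≤ inner ℝ v (infoOp T lam θ v) := h.le_inner_infoOp hθ v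
    _ ≤ ‖v‖ * ‖infoOp T lam θ v‖ := real_inner_le_norm _ _

lemma isUnit_det_fisherInfo (h : RegularModel T Θ lam C c) (hθ : θ ∈ Θ) :
    IsUnit (fisherInfo T lam θ).det := by
  have hinj : Function.Injective (infoOp T lam θ) :=
    (injective_iff_map_eq_zero _).2 fun v hv => by
      have hle := h.le_norm_infoOp hθ v
      rw [hv, norm_zero] at hle
      exact norm_le_zero_iff.1 (nonpos_of_mul_nonpos_right hle h.info_pos)
  rw [← Matrix.isUnit_iff_isUnit_det, ← Matrix.mulVec_injective_iff_isUnit]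
  exact fun x y hxy => congrArg WithLp.ofLp
    (hinj (congrArg (WithLp.toLp 2) hxy : infoOp T lam θ (.toLp 2 x) = infoOp T lam θ (.toLp 2 y)))

lemma infoOp_infoInv (h : RegularModel T Θ lam C c) (hθ : θ ∈ Θ)
    (v : EuclideanSpace ℝ (Fin d)) : infoOp T lam θ (infoInv T lam θ v) = v := by
  have hmul := Matrix.toLpLin_mul_same 2 (fisherInfo T lam θ) (fisherInfo T lam θ)⁻¹
  rw [Matrix.mul_nonsing_inv _ (h.isUnit_det_fisherInfo hθ), Matrix.toLpLin_one] at hmul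
  exact (LinearMap.congr_fun hmul v).symm

lemma infoInv_infoOp (h : RegularModel T Θ lam C c) (hθ : θ ∈ Θ)
    (v : EuclideanSpace ℝ (Fin d)) : infoInv T lam θ (infoOp T lam θ v) = v := by
  have hmul := Matrix.toLpLin_mul_same 2 (fisherInfo T lam θ)⁻¹ (fisherInfo T lam θ)
  rw [Matrix.nonsing_inv_mul _ (h.isUnit_det_fisherInfo hθ), Matrix.toLpLin_one] at hmul
  exact (LinearMap.congr_fun hmul v).symm

lemma norm_infoInv_le (h : RegularModel T Θ lam C c) (hθ : θ ∈ Θ)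
    (v : EuclideanSpace ℝ (Fin d)) : ‖infoInv T lam θ v‖ ≤ c⁻¹ * ‖v‖ := by
  rw [inv_mul_eq_div, le_div_iff₀ h.info_pos, mul_comm]
  simpa only [h.infoOp_infoInv hθ] using h.le_norm_infoOp hθ (infoInv T lam θ v)

lemma inner_infoInv_comm (h : RegularModel T Θ lam C c) (hθ : θ ∈ Θ)
    (v w : EuclideanSpace ℝ (Fin d)) :
    inner ℝ (infoInv T lam θ v) w = inner ℝ v (infoInv T lam θ w) := by
  conv_lhs => rw [← h.infoOp_infoInv hθ w]
  rw [h.inner_infoOp_comm hθ, h.infoOp_infoInv hθ]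

lemma posSemidef_fisherInfo_inv (h : RegularModel T Θ lam C c) (hθ : θ ∈ Θ) :
    (fisherInfo T lam θ)⁻¹.PosSemidef := by
  refine Matrix.PosSemidef.inv (Matrix.PosSemidef.of_dotProduct_mulVec_nonneg ?_ fun x => ?_)
  · ext i j
    simp [fisherInfo, mul_comm]
  · refine (mul_nonneg h.info_pos.le (sq_nonneg _)).trans
      ((h.le_inner_infoOp hθ (WithLp.toLp 2 x)).trans_eq ?_)
    rw [EuclideanSpace.inner_eq_star_dotProduct, infoOp, Matrix.toEuclideanLin,
      Matrix.toLpLin_apply, dotProduct_comm]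

lemma integral_inner_infoInv_score_sq (h : RegularModel T Θ lam C c) (hθ : θ ∈ Θ)
    (u : EuclideanSpace ℝ (Fin d)) :
    ∫ t in T, lam θ t * (inner ℝ (infoInv T lam θ (score lam θ t)) u) ^ 2 =
      u.ofLp ⬝ᵥ (fisherInfo T lam θ)⁻¹.mulVec u.ofLp := by
  have hquad : u.ofLp ⬝ᵥ (fisherInfo T lam θ)⁻¹.mulVec u.ofLp = inner ℝ u (infoInv T lam θ u) := by
    rw [EuclideanSpace.inner_eq_star_dotProduct, infoInv, Matrix.toEuclideanLin,
      Matrix.toLpLin_apply, dotProduct_comm]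
    rfl
  rw [hquad, ← h.inner_infoInv_comm hθ]
  conv_rhs => rw [← h.infoOp_infoInv hθ u]
  rw [h.infoInv_infoOp hθ, h.inner_infoOp hθ]
  simp only [h.inner_infoInv_comm hθ, sq]

lemma norm_infoOp_sub_le (h : RegularModel T Θ lam C c) (hθ : θ ∈ Θ) (hθ' : θ' ∈ Θ)
    (v : EuclideanSpace ℝ (Fin d)) :
    ‖infoOp T lam θ v - infoOp T lam θ' v‖ ≤
      (C ^ 3 + 2 * C ^ 2) * ‖θ - θ'‖ * ‖v‖ * totalIntensity T lam θ' := by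
  have hC := h.const_pos
  rw [h.infoOp_apply hθ, h.infoOp_apply hθ', ← integral_sub (h.integrable_inner_smul_score hθ v)
    (h.integrable_inner_smul_score hθ' v)]
  refine h.norm_setIntegral_le hθ' fun t ht => ?_
  have hpos := h.family.pos θ' hθ' t ht
  let s := score lam θ t
  let s' := score lam θ' t
  have hs : ‖s‖ ≤ C := h.norm_score θ hθ t ht
  have hss' : ‖s - s'‖ ≤ C * ‖θ - θ'‖ := h.score_sub θ hθ θ' hθ' t ht
  have hinner : |inner ℝ (s - s') v| ≤ C * ‖θ - θ'‖ * ‖v‖ :=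
    (abs_real_inner_le_norm _ _).trans (by gcongr)
  have hsplit : lam θ t • (inner ℝ s v : ℝ) • s - lam θ' t • (inner ℝ s' v : ℝ) • s' =
      (lam θ t - lam θ' t) • (inner ℝ s v : ℝ) • s +
        (lam θ' t • (inner ℝ (s - s') v : ℝ) • s + lam θ' t • (inner ℝ s' v : ℝ) • (s - s')) := by
    rw [inner_sub_left]
    module
  rw [hsplit]
  refine (norm_add_le _ _).trans ((add_le_add_right (norm_add_le _ _) _).trans ?_)
  simp only [norm_smul, Real.norm_eq_abs, abs_of_pos hpos]
  calc _ ≤ C * ‖θ - θ'‖ * lam θ' t * (C * ‖v‖ * C) + (lam θ' t * (C * ‖θ - θ'‖ * ‖v‖ * C) +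
        lam θ' t * (C * ‖v‖ * (C * ‖θ - θ'‖))) := by
        gcongr
        · exact h.lam_sub θ hθ θ' hθ' t ht
        · exact h.abs_inner_score_le hθ v ht
        · exact h.abs_inner_score_le hθ' v ht
    _ = (C ^ 3 + 2 * C ^ 2) * ‖θ - θ'‖ * ‖v‖ * lam θ' t := by ring

lemma norm_infoInv_sub_le (h : RegularModel T Θ lam C c) (hθ : θ ∈ Θ) (hθ' : θ' ∈ Θ)
    (v : EuclideanSpace ℝ (Fin d)) :
    ‖infoInv T lam θ v - infoInv T lam θ' v‖ ≤
      c⁻¹ * ((C ^ 3 + 2 * C ^ 2) * ‖θ - θ'‖ * (c⁻¹ * ‖v‖) * totalIntensity T lam θ') := by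
  have hC := h.const_pos
  have hc := h.info_pos
  have hm := h.totalIntensity_nonneg hθ'
  have hresolvent : infoInv T lam θ v - infoInv T lam θ' v = infoInv T lam θ
      (infoOp T lam θ' (infoInv T lam θ' v) - infoOp T lam θ (infoInv T lam θ' v)) := by
    rw [map_sub, h.infoInv_infoOp hθ, h.infoOp_infoInv hθ']
  rw [hresolvent]
  refine (h.norm_infoInv_le hθ _).trans ?_
  gcongr
  rw [norm_sub_rev]
  refine (h.norm_infoOp_sub_le hθ hθ' _).trans ?_
  gcongr
  exact h.norm_infoInv_le hθ' v

-- This bias is what cancels the error of the preliminary estimator to first order.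
lemma norm_integral_score_sub_infoOp_le (h : RegularModel T Θ lam C c) (hθ : θ ∈ Θ)
    (hθ' : θ' ∈ Θ) :
    ‖(∫ t in T, lam θ t • score lam θ t) - (∫ t in T, lam θ' t • score lam θ t)
      - infoOp T lam θ (θ - θ')‖ ≤ C ^ 2 * ‖θ - θ'‖ ^ 2 * totalIntensity T lam θ := by
  have hint := h.integrable_smul_score hθ hθ
  have hint' := h.integrable_smul_score hθ' hθ
  rw [h.infoOp_apply hθ, ← integral_sub hint hint',
    ← integral_sub (hint.sub' hint') (h.integrable_inner_smul_score hθ _)]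
  refine h.norm_setIntegral_le hθ fun t ht => ?_
  have hfactor : lam θ t • score lam θ t - lam θ' t • score lam θ t -
      lam θ t • (inner ℝ (score lam θ t) (θ - θ') : ℝ) • score lam θ t =
      -(lam θ' t - lam θ t - lam θ t * inner ℝ (score lam θ t) (θ' - θ)) • score lam θ t := by
    rw [← neg_sub θ θ', inner_neg_right]
    module
  have htaylor := h.lam_taylor θ' hθ' θ hθ t ht
  rw [norm_sub_rev θ' θ] at htaylor
  rw [hfactor, norm_smul, norm_neg, Real.norm_eq_abs]
  calc _ ≤ C * ‖θ - θ'‖ ^ 2 * lam θ t * C :=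
        mul_le_mul htaylor (h.norm_score θ hθ t ht) (norm_nonneg _) ((abs_nonneg _).trans htaylor)
    _ = C ^ 2 * ‖θ - θ'‖ ^ 2 * lam θ t := by ring

end RegularModel

end FisherInformation

section IntensityMeasure

variable {d : ℕ} {T : Set ℝ} {Θ : Set (EuclideanSpace ℝ (Fin d))}
  {lam : EuclideanSpace ℝ (Fin d) → ℝ → ℝ} {C c : ℝ} {θ θ₀ : EuclideanSpace ℝ (Fin d)}

/-- The measure on `T` with density `r`: the mean measure of a Poisson process on `T` with
intensity `r`. -/
noncomputable def intensityMeasure (T : Set ℝ) (r : ℝ → ℝ) : Measure ℝ :=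
  (volume.restrict T).withDensity fun t => ENNReal.ofReal (r t)

/-- The derivative of the score in the direction of the `b`-th coordinate, extended by zero
outside `T`. -/
noncomputable def scoreDeriv (T : Set ℝ) (lam : EuclideanSpace ℝ (Fin d) → ℝ → ℝ)
    (θ : EuclideanSpace ℝ (Fin d)) (b : Fin d) : ℝ → EuclideanSpace ℝ (Fin d) :=
  T.indicator fun t =>
    fderiv ℝ (fun θ' => score lam θ' t) θ (EuclideanSpace.basisFun (Fin d) ℝ b)

/-- The remainder of the first order Taylor expansion of the score at `θ₀`, extended by zero
outside `T`. -/
noncomputable def scoreRemainder (T : Set ℝ) (lam : EuclideanSpace ℝ (Fin d) → ℝ → ℝ)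
    (θ₀ θ : EuclideanSpace ℝ (Fin d)) (t : ℝ) : EuclideanSpace ℝ (Fin d) :=
  T.indicator (score lam θ) t - T.indicator (score lam θ₀) t
    - ∑ b, (θ - θ₀) b • scoreDeriv T lam θ₀ b t

namespace RegularModel

lemma isFiniteMeasure_intensityMeasure (h : RegularModel T Θ lam C c) (hθ : θ ∈ Θ) :
    IsFiniteMeasure (intensityMeasure T (lam θ)) :=
  isFiniteMeasure_withDensity_ofReal (h.family.integrableOn θ hθ).2

lemma integral_intensityMeasure {V : Type*} [NormedAddCommGroup V] [NormedSpace ℝ V]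
    (h : RegularModel T Θ lam C c) (hθ : θ ∈ Θ) (g : ℝ → V) :
    ∫ t, g t ∂intensityMeasure T (lam θ) = ∫ t in T, lam θ t • g t := by
  rw [intensityMeasure, integral_withDensity_eq_integral_toReal_smul₀
    (h.family.integrableOn θ hθ).aestronglyMeasurable.aemeasurable.ennreal_ofReal
    (ae_of_all _ fun _ => ENNReal.ofReal_lt_top)]
  refine setIntegral_congr_fun h.measurableSet fun t ht => ?_
  simp only [ENNReal.toReal_ofReal (h.family.pos θ hθ t ht).le]

lemma integral_indicator_intensityMeasure {V : Type*} [NormedAddCommGroup V] [NormedSpace ℝ V]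
    (h : RegularModel T Θ lam C c) (hθ : θ ∈ Θ) (g : ℝ → V) :
    ∫ t, T.indicator g t ∂intensityMeasure T (lam θ) = ∫ t in T, lam θ t • g t := by
  rw [h.integral_intensityMeasure hθ]
  refine setIntegral_congr_fun h.measurableSet fun t ht => ?_
  simp only [Set.indicator_of_mem ht]

lemma measureReal_univ_intensityMeasure (h : RegularModel T Θ lam C c) (hθ : θ ∈ Θ) :
    (intensityMeasure T (lam θ)).real Set.univ = totalIntensity T lam θ := by
  simpa [totalIntensity] using h.integral_intensityMeasure hθ fun _ => (1 : ℝ)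

lemma intensityMeasure_Ioc (h : RegularModel T Θ lam C c) (hθ : θ ∈ Θ) (a b : ℝ) :
    intensityMeasure T (lam θ) (Set.Ioc a b) =
      ENNReal.ofReal (∫ t in Set.Ioc a b ∩ T, lam θ t) := by
  have hint : IntegrableOn (lam θ) (Set.Ioc a b ∩ T) :=
    (h.family.integrableOn θ hθ).mono_set Set.inter_subset_right
  rw [intensityMeasure, withDensity_apply _ measurableSet_Ioc,
    Measure.restrict_restrict measurableSet_Ioc, ofReal_integral_eq_lintegral_ofReal hint]
  filter_upwards [ae_restrict_mem (measurableSet_Ioc.inter h.measurableSet)] with t ht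
  exact (h.family.pos θ hθ t ht.2).le

lemma isPoissonMeasureSample {Ω : Type*} [MeasurableSpace Ω] {P : Measure Ω}
    {X : ℕ → Ω → StieltjesFunction ℝ} (h : RegularModel T Θ lam C c) (hθ : θ ∈ Θ)
    (hX : IsPoissonSample P T (lam θ) X) :
    IsPoissonMeasureSample P (intensityMeasure T (lam θ)) X where
  hasPoissonIncrements j :=
    { measurable := (hX.poisson j).measurable
      law := fun a b hab => by
        rw [h.intensityMeasure_Ioc hθ]
        exact (hX.poisson j).increment_law a b hab
      indep_increments := (hX.poisson j).indep_increments }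
  indep := hX.indep

lemma measurable_scoreDeriv (h : RegularModel T Θ lam C c) (hθ : θ ∈ Θ) (b : Fin d) :
    Measurable (scoreDeriv T lam θ b) :=
  measurable_indicator_fderiv_apply h.isOpen h.measurable_score hθ (h.differentiableAt_score θ hθ) _

lemma norm_scoreDeriv_le (h : RegularModel T Θ lam C c) (hθ : θ ∈ Θ) (b : Fin d) (t : ℝ) :
    ‖scoreDeriv T lam θ b t‖ ≤ C := by
  by_cases ht : t ∈ T
  · rw [scoreDeriv, Set.indicator_of_mem ht]
    refine (ContinuousLinearMap.le_opNorm _ _).trans ?_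
    rw [OrthonormalBasis.norm_eq_one, mul_one]
    exact h.norm_fderiv_score θ hθ t ht
  · rw [scoreDeriv, Set.indicator_of_notMem ht, norm_zero]
    exact h.const_pos.le

lemma norm_indicator_score_le (h : RegularModel T Θ lam C c) (hθ : θ ∈ Θ) (t : ℝ) :
    ‖T.indicator (score lam θ) t‖ ≤ C := by
  by_cases ht : t ∈ T
  · rw [Set.indicator_of_mem ht]
    exact h.norm_score θ hθ t ht
  · rw [Set.indicator_of_notMem ht, norm_zero]
    exact h.const_pos.le

lemma norm_scoreRemainder_le (h : RegularModel T Θ lam C c) (hθ₀ : θ₀ ∈ Θ) (hθ : θ ∈ Θ) (t : ℝ) :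
    ‖scoreRemainder T lam θ₀ θ t‖ ≤ C * ‖θ - θ₀‖ ^ 2 := by
  have hC := h.const_pos
  rw [scoreRemainder]
  by_cases ht : t ∈ T
  · simp only [scoreDeriv, Set.indicator_of_mem ht, ← map_smul, ← map_sum]
    have hrepr : ∑ b, (θ - θ₀) b • EuclideanSpace.basisFun (Fin d) ℝ b = θ - θ₀ :=
      (EuclideanSpace.basisFun (Fin d) ℝ).sum_repr (θ - θ₀)
    rw [hrepr]
    exact h.score_taylor θ hθ θ₀ hθ₀ t ht
  · simp only [scoreDeriv, Set.indicator_of_notMem ht, smul_zero, Finset.sum_const_zero, sub_zero,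
      norm_zero]
    positivity

section FiniteMeasure

variable (ν : Measure ℝ) [IsFiniteMeasure ν]

lemma norm_integral_scoreRemainder_le (h : RegularModel T Θ lam C c) (hθ₀ : θ₀ ∈ Θ)
    (hθ : θ ∈ Θ) :
    ‖∫ t, scoreRemainder T lam θ₀ θ t ∂ν‖ ≤ C * ‖θ - θ₀‖ ^ 2 * ν.real Set.univ :=
  norm_integral_le_of_norm_le_const (ae_of_all _ (h.norm_scoreRemainder_le hθ₀ hθ))

lemma memLp_indicator_score (h : RegularModel T Θ lam C c) (hθ : θ ∈ Θ) (p : ENNReal) :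
    MemLp (T.indicator (score lam θ)) p ν :=
  MemLp.of_bound (h.measurable_score θ hθ).aestronglyMeasurable C
    (ae_of_all _ (h.norm_indicator_score_le hθ))

lemma memLp_scoreDeriv (h : RegularModel T Θ lam C c) (hθ : θ ∈ Θ) (b : Fin d) (p : ENNReal) :
    MemLp (scoreDeriv T lam θ b) p ν :=
  MemLp.of_bound (h.measurable_scoreDeriv hθ b).aestronglyMeasurable C
    (ae_of_all _ (h.norm_scoreDeriv_le hθ b))

lemma integrable_indicator_score (h : RegularModel T Θ lam C c) (hθ : θ ∈ Θ) :
    Integrable (T.indicator (score lam θ)) ν :=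
  (h.memLp_indicator_score ν hθ 1).integrable le_rfl

lemma integrable_scoreDeriv (h : RegularModel T Θ lam C c) (hθ : θ ∈ Θ) (b : Fin d) :
    Integrable (scoreDeriv T lam θ b) ν :=
  (h.memLp_scoreDeriv ν hθ b 1).integrable le_rfl

lemma integral_scoreRemainder (h : RegularModel T Θ lam C c) (hθ₀ : θ₀ ∈ Θ) (hθ : θ ∈ Θ) :
    ∫ t, scoreRemainder T lam θ₀ θ t ∂ν =
      ∫ t, T.indicator (score lam θ) t ∂ν - ∫ t, T.indicator (score lam θ₀) t ∂ν
        - ∑ b, (θ - θ₀) b • ∫ t, scoreDeriv T lam θ₀ b t ∂ν := by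
  have hscore := h.integrable_indicator_score ν hθ
  have hscore₀ := h.integrable_indicator_score ν hθ₀
  have hderiv : ∀ b ∈ Finset.univ, Integrable (fun t => (θ - θ₀) b • scoreDeriv T lam θ₀ b t) ν :=
    fun b _ => (h.integrable_scoreDeriv ν hθ₀ b).fun_smul _
  simp only [scoreRemainder]
  rw [integral_sub (hscore.sub' hscore₀) (integrable_finsetSum _ hderiv),
    integral_sub hscore hscore₀, integral_finsetSum _ hderiv]
  simp only [integral_smul]

lemma norm_integral_score_sub_le (h : RegularModel T Θ lam C c) (hθ₀ : θ₀ ∈ Θ) (hθ : θ ∈ Θ) :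
    ‖((∫ t in T, score lam θ t ∂ν) - ∫ t in T, lam θ t • score lam θ t)
      - ((∫ t, T.indicator (score lam θ₀) t ∂ν
          - ∫ t, T.indicator (score lam θ₀) t ∂intensityMeasure T (lam θ₀))
        + ∑ b, (θ - θ₀) b • (∫ t, scoreDeriv T lam θ₀ b t ∂ν
          - ∫ t, scoreDeriv T lam θ₀ b t ∂intensityMeasure T (lam θ₀))
        - infoOp T lam θ (θ - θ₀))‖ ≤
      C * ‖θ - θ₀‖ ^ 2 * ν.real Set.univ +
        (C + C ^ 3) * ‖θ - θ₀‖ ^ 2 * totalIntensity T lam θ₀ := by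
  have hC := h.const_pos
  let Λ := intensityMeasure T (lam θ₀)
  have : IsFiniteMeasure Λ := h.isFiniteMeasure_intensityMeasure hθ₀
  let bias := (∫ t in T, lam θ t • score lam θ t) - (∫ t in T, lam θ₀ t • score lam θ t)
    - infoOp T lam θ (θ - θ₀)
  have hremainder := h.norm_integral_scoreRemainder_le Λ hθ₀ hθ
  rw [h.measureReal_univ_intensityMeasure hθ₀] at hremainder
  have hsplit : ((∫ t in T, score lam θ t ∂ν) - ∫ t in T, lam θ t • score lam θ t)
      - ((∫ t, T.indicator (score lam θ₀) t ∂ν - ∫ t, T.indicator (score lam θ₀) t ∂Λ)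
        + ∑ b, (θ - θ₀) b • (∫ t, scoreDeriv T lam θ₀ b t ∂ν - ∫ t, scoreDeriv T lam θ₀ b t ∂Λ)
        - infoOp T lam θ (θ - θ₀)) =
      ∫ t, scoreRemainder T lam θ₀ θ t ∂ν - ∫ t, scoreRemainder T lam θ₀ θ t ∂Λ - bias := by
    rw [h.integral_scoreRemainder ν hθ₀ hθ, h.integral_scoreRemainder Λ hθ₀ hθ,
      ← integral_indicator h.measurableSet, h.integral_indicator_intensityMeasure hθ₀ (score lam θ)]
    simp only [smul_sub, Finset.sum_sub_distrib, bias]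
    abel
  rw [hsplit]
  calc _ ≤ ‖∫ t, scoreRemainder T lam θ₀ θ t ∂ν‖ + ‖∫ t, scoreRemainder T lam θ₀ θ t ∂Λ‖ + ‖bias‖ :=
        (norm_sub_le _ _).trans (add_le_add_left (norm_sub_le _ _) _)
    _ ≤ C * ‖θ - θ₀‖ ^ 2 * ν.real Set.univ + C * ‖θ - θ₀‖ ^ 2 * totalIntensity T lam θ₀ +
        C ^ 2 * ‖θ - θ₀‖ ^ 2 * (C * totalIntensity T lam θ₀) := by
        refine add_le_add (add_le_add (h.norm_integral_scoreRemainder_le ν hθ₀ hθ) hremainder)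
          ((h.norm_integral_score_sub_infoOp_le hθ hθ₀).trans ?_)
        gcongr
        exact h.totalIntensity_le hθ hθ₀
    _ = _ := by ring

end FiniteMeasure

end RegularModel

end IntensityMeasure

section Expansion

variable {d : ℕ} {Ω : Type*} {T : Set ℝ} {Θ : Set (EuclideanSpace ℝ (Fin d))}
  {lam : EuclideanSpace ℝ (Fin d) → ℝ → ℝ} {C c : ℝ} {X : ℕ → Ω → StieltjesFunction ℝ}
  {θ θ₀ : EuclideanSpace ℝ (Fin d)} {N k : ℕ} {ω : Ω}

/-- The score at `θ` of the observations `N ≤ j < k`, each compensated at `θ`; this is the sum in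
the definition of the one-step estimator. -/
noncomputable def scoreSum (T : Set ℝ) (lam : EuclideanSpace ℝ (Fin d) → ℝ → ℝ)
    (X : ℕ → Ω → StieltjesFunction ℝ) (θ : EuclideanSpace ℝ (Fin d)) (N k : ℕ) (ω : Ω) :
    EuclideanSpace ℝ (Fin d) :=
  ∑ j ∈ Finset.Ico N k,
    ((∫ t in T, score lam θ t ∂(X j ω).measure) - ∫ t in T, lam θ t • score lam θ t)

/-- The score of the observations `N ≤ j < k` at the true parameter, centered at its mean. -/
noncomputable def scoreNoise (T : Set ℝ) (lam : EuclideanSpace ℝ (Fin d) → ℝ → ℝ)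
    (X : ℕ → Ω → StieltjesFunction ℝ) (θ₀ : EuclideanSpace ℝ (Fin d)) (N k : ℕ) (ω : Ω) :
    EuclideanSpace ℝ (Fin d) :=
  centeredSum (intensityMeasure T (lam θ₀)) X (T.indicator (score lam θ₀)) N k ω

/-- The derivative along the `b`-th coordinate of the score of the observations `N ≤ j < k` at
the true parameter, centered at its mean. -/
noncomputable def scoreDerivNoise (T : Set ℝ) (lam : EuclideanSpace ℝ (Fin d) → ℝ → ℝ)
    (X : ℕ → Ω → StieltjesFunction ℝ) (θ₀ : EuclideanSpace ℝ (Fin d)) (b : Fin d) (N k : ℕ)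
    (ω : Ω) : EuclideanSpace ℝ (Fin d) :=
  centeredSum (intensityMeasure T (lam θ₀)) X (scoreDeriv T lam θ₀ b) N k ω

lemma norm_smul_sum_smul_le (H : Fin d → EuclideanSpace ℝ (Fin d)) (a : ℝ)
    (v : EuclideanSpace ℝ (Fin d)) : ‖a • ∑ b, v b • H b‖ ≤ ‖v‖ * ∑ b, ‖a • H b‖ := by
  rw [Finset.smul_sum, Finset.mul_sum]
  refine norm_sum_le_of_le _ fun b _ => ?_
  rw [smul_comm, norm_smul]
  exact mul_le_mul_of_nonneg_right (PiLp.norm_apply_le v b) (norm_nonneg _)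

lemma mul_add_mul_add_mul_le {a₁ a₂ a₃ x₁ x₂ x₃ : ℝ} (ha₁ : 0 ≤ a₁) (ha₂ : 0 ≤ a₂) (ha₃ : 0 ≤ a₃)
    (hx₁ : 0 ≤ x₁) (hx₂ : 0 ≤ x₂) (hx₃ : 0 ≤ x₃) :
    a₁ * x₁ + a₂ * x₂ + a₃ * x₃ ≤ (a₁ + a₂ + a₃) * (x₁ + x₂ + x₃) := by
  have : 0 ≤ a₁ * (x₂ + x₃) + a₂ * (x₁ + x₃) + a₃ * (x₁ + x₂) := by positivity
  linarith

namespace RegularModel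

lemma norm_scoreSum_sub_le (h : RegularModel T Θ lam C c) (hθ₀ : θ₀ ∈ Θ) (hθ : θ ∈ Θ)
    (hω : ∀ j, IsFiniteMeasure (X j ω).measure) (hNk : N ≤ k) :
    ‖scoreSum T lam X θ N k ω - (scoreNoise T lam X θ₀ N k ω
        + ∑ b, (θ - θ₀) b • scoreDerivNoise T lam X θ₀ b N k ω
        - ((k : ℝ) - N) • infoOp T lam θ (θ - θ₀))‖ ≤
      C * ‖θ - θ₀‖ ^ 2 * ∑ j ∈ Finset.Ico N k, (X j ω).measure.real Set.univ
        + k * ((C + C ^ 3) * ‖θ - θ₀‖ ^ 2 * totalIntensity T lam θ₀) := by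
  have hC := h.const_pos
  have hm := h.totalIntensity_nonneg hθ₀
  have hcard : ((Finset.Ico N k).card : ℝ) = (k : ℝ) - N := by rw [Nat.card_Ico, Nat.cast_sub hNk]
  have hswap : ∑ b, (θ - θ₀) b • scoreDerivNoise T lam X θ₀ b N k ω =
      ∑ j ∈ Finset.Ico N k, ∑ b, (θ - θ₀) b • (∫ t, scoreDeriv T lam θ₀ b t ∂(X j ω).measure
        - ∫ t, scoreDeriv T lam θ₀ b t ∂intensityMeasure T (lam θ₀)) := by
    simp only [scoreDerivNoise, centeredSum, Finset.smul_sum]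
    exact Finset.sum_comm
  rw [hswap, scoreSum, scoreNoise, centeredSum, ← hcard, Nat.cast_smul_eq_nsmul ℝ,
    ← Finset.sum_const, ← Finset.sum_add_distrib, ← Finset.sum_sub_distrib,
    ← Finset.sum_sub_distrib]
  calc _ ≤ ∑ j ∈ Finset.Ico N k, (C * ‖θ - θ₀‖ ^ 2 * (X j ω).measure.real Set.univ +
        (C + C ^ 3) * ‖θ - θ₀‖ ^ 2 * totalIntensity T lam θ₀) :=
        norm_sum_le_of_le _ fun j _ =>
          have := hω j
          h.norm_integral_score_sub_le (X j ω).measure hθ₀ hθ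
    _ ≤ _ := by
        rw [Finset.sum_add_distrib, ← Finset.mul_sum, Finset.sum_const, nsmul_eq_mul, hcard]
        gcongr
        exact sub_le_self _ N.cast_nonneg

-- The bias `-(k - N) • I(θ)(θ - θ₀)` of `scoreSum` turns `θ - θ₀` into `(N / k) • (θ - θ₀)`.
lemma add_infoInv_sub_sub_infoInv (h : RegularModel T Θ lam C c) (hθ : θ ∈ Θ) (hk : 0 < k)
    (U S D : EuclideanSpace ℝ (Fin d)) :
    θ + infoInv T lam θ ((k : ℝ)⁻¹ • U) - θ₀ - infoInv T lam θ₀ ((k : ℝ)⁻¹ • S) =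
      ((N : ℝ) / k) • (θ - θ₀)
        + infoInv T lam θ ((k : ℝ)⁻¹ • (U - (S + D - ((k : ℝ) - N) • infoOp T lam θ (θ - θ₀))))
        + infoInv T lam θ ((k : ℝ)⁻¹ • D)
        + (infoInv T lam θ ((k : ℝ)⁻¹ • S) - infoInv T lam θ₀ ((k : ℝ)⁻¹ • S)) := by
  have hratio : (k : ℝ)⁻¹ * ((k : ℝ) - N) = 1 - N / k := by field_simp
  simp only [smul_sub, smul_add, map_sub, map_add, smul_smul, hratio]
  simp only [map_smul, h.infoInv_infoOp hθ]
  module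

lemma norm_infoInv_scoreSum_remainder_le (h : RegularModel T Θ lam C c) (hθ₀ : θ₀ ∈ Θ)
    (hθ : θ ∈ Θ) (hω : ∀ j, IsFiniteMeasure (X j ω).measure) (hNk : N ≤ k) (hk : 0 < k) :
    ‖infoInv T lam θ ((k : ℝ)⁻¹ • (scoreSum T lam X θ N k ω - (scoreNoise T lam X θ₀ N k ω
        + ∑ b, (θ - θ₀) b • scoreDerivNoise T lam X θ₀ b N k ω
        - ((k : ℝ) - N) • infoOp T lam θ (θ - θ₀))))‖ ≤
      c⁻¹ * (C + (C + C ^ 3) * totalIntensity T lam θ₀) * (‖θ - θ₀‖ ^ 2 *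
        (1 + (k : ℝ)⁻¹ * ∑ j ∈ Finset.Ico N k, (X j ω).measure.real Set.univ)) := by
  have hC := h.const_pos
  have hc := h.info_pos
  have hm := h.totalIntensity_nonneg hθ₀
  have hk0 : (0 : ℝ) < k := Nat.cast_pos.2 hk
  refine (h.norm_infoInv_le hθ _).trans ?_
  rw [norm_smul, norm_inv, RCLike.norm_natCast, mul_assoc c⁻¹]
  gcongr c⁻¹ * ?_
  refine (mul_le_mul_of_nonneg_left (h.norm_scoreSum_sub_le hθ₀ hθ hω hNk) (by positivity)).trans ?_
  set A := ∑ j ∈ Finset.Ico N k, (X j ω).measure.real Set.univ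
  have hextra : 0 ≤ C * ‖θ - θ₀‖ ^ 2 + (C + C ^ 3) * totalIntensity T lam θ₀ *
      (‖θ - θ₀‖ ^ 2 * ((k : ℝ)⁻¹ * A)) := by positivity
  rw [mul_add, inv_mul_cancel_left₀ hk0.ne']
  linarith

/-- The constant in the deterministic expansion of the one-step estimator around `θ₀`. -/
noncomputable def expansionConst (T : Set ℝ) (lam : EuclideanSpace ℝ (Fin d) → ℝ → ℝ)
    (C c : ℝ) (θ₀ : EuclideanSpace ℝ (Fin d)) : ℝ :=
  c⁻¹ * (C + (C + C ^ 3) * totalIntensity T lam θ₀) + c⁻¹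
    + c⁻¹ * ((C ^ 3 + 2 * C ^ 2) * c⁻¹ * totalIntensity T lam θ₀)

lemma expansionConst_nonneg (h : RegularModel T Θ lam C c) (hθ₀ : θ₀ ∈ Θ) :
    0 ≤ expansionConst T lam C c θ₀ := by
  have hC := h.const_pos
  have hc := h.info_pos
  have hm := h.totalIntensity_nonneg hθ₀
  rw [expansionConst]
  positivity

lemma norm_add_infoInv_scoreSum_sub_le (h : RegularModel T Θ lam C c) (hθ₀ : θ₀ ∈ Θ)
    (hθ : θ ∈ Θ) (hω : ∀ j, IsFiniteMeasure (X j ω).measure) (hNk : N ≤ k) (hk : 0 < k) :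
    ‖θ + infoInv T lam θ ((k : ℝ)⁻¹ • scoreSum T lam X θ N k ω) - θ₀
        - infoInv T lam θ₀ ((k : ℝ)⁻¹ • scoreNoise T lam X θ₀ N k ω)‖ ≤
      (N : ℝ) / k * ‖θ - θ₀‖ + expansionConst T lam C c θ₀ * (
        ‖θ - θ₀‖ ^ 2 * (1 + (k : ℝ)⁻¹ * ∑ j ∈ Finset.Ico N k, (X j ω).measure.real Set.univ)
        + ‖θ - θ₀‖ * ∑ b, ‖(k : ℝ)⁻¹ • scoreDerivNoise T lam X θ₀ b N k ω‖
        + ‖θ - θ₀‖ * ‖(k : ℝ)⁻¹ • scoreNoise T lam X θ₀ N k ω‖) := by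
  have hC := h.const_pos
  have hc := h.info_pos
  have hm := h.totalIntensity_nonneg hθ₀
  rw [h.add_infoInv_sub_sub_infoInv (θ₀ := θ₀) (N := N) hθ hk _ _
    (∑ b, (θ - θ₀) b • scoreDerivNoise T lam X θ₀ b N k ω)]
  set S := scoreNoise T lam X θ₀ N k ω
  have hprelim : ‖((N : ℝ) / k) • (θ - θ₀)‖ = (N : ℝ) / k * ‖θ - θ₀‖ := by
    rw [norm_smul, Real.norm_of_nonneg (by positivity)]
  have hderiv := (h.norm_infoInv_le hθ _).trans (mul_le_mul_of_nonneg_left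
    (norm_smul_sum_smul_le (fun b => scoreDerivNoise T lam X θ₀ b N k ω) (k : ℝ)⁻¹ (θ - θ₀))
    (inv_nonneg.2 hc.le))
  have hinfo : ‖infoInv T lam θ ((k : ℝ)⁻¹ • S) - infoInv T lam θ₀ ((k : ℝ)⁻¹ • S)‖ ≤
      c⁻¹ * ((C ^ 3 + 2 * C ^ 2) * c⁻¹ * totalIntensity T lam θ₀) *
        (‖θ - θ₀‖ * ‖(k : ℝ)⁻¹ • S‖) :=
    (h.norm_infoInv_sub_le hθ hθ₀ _).trans_eq (by ring)
  have hmass : 0 ≤ 1 + (k : ℝ)⁻¹ * ∑ j ∈ Finset.Ico N k, (X j ω).measure.real Set.univ :=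
    add_nonneg zero_le_one
      (mul_nonneg (by positivity) (Finset.sum_nonneg fun _ _ => measureReal_nonneg))
  refine (norm_add₄_le.trans (add_le_add (add_le_add (add_le_add hprelim.le
    (h.norm_infoInv_scoreSum_remainder_le hθ₀ hθ hω hNk hk)) hderiv) hinfo)).trans ?_
  rw [expansionConst, add_assoc, add_assoc, ← add_assoc (c⁻¹ * _ * _)]
  exact add_le_add_right (mul_add_mul_add_mul_le (by positivity) (by positivity) (by positivity)
    (mul_nonneg (sq_nonneg _) hmass)
    (mul_nonneg (norm_nonneg _) (Finset.sum_nonneg fun _ _ => norm_nonneg _)) (by positivity)) _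

end RegularModel

end Expansion

section MatrixMeasurability

variable {α ι : Type*} [MeasurableSpace α] [Fintype ι] [DecidableEq ι] {A : α → Matrix ι ι ℝ}

lemma measurable_det (hA : ∀ i j, Measurable fun a => A a i j) : Measurable fun a => (A a).det := by
  simp only [Matrix.det_apply']
  exact Finset.measurable_fun_sum _ fun σ _ =>
    measurable_const.mul (Finset.measurable_fun_prod _ fun i _ => hA (σ i) i)

lemma measurable_matrix_inv_apply (hA : ∀ i j, Measurable fun a => A a i j) (i j : ι) :
    Measurable fun a => (A a)⁻¹ i j := by
  simp only [Matrix.inv_def, Matrix.smul_apply, smul_eq_mul, Ring.inverse_eq_inv',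
    Matrix.adjugate_apply]
  refine (measurable_det hA).inv.mul (measurable_det fun i' j' => ?_)
  obtain rfl | hi := eq_or_ne i' j
  · simp only [Matrix.updateRow_self, measurable_const]
  · simpa only [Matrix.updateRow_ne hi] using hA i' j'

lemma measurable_toEuclideanLin_apply {v : α → EuclideanSpace ℝ ι}
    (hA : ∀ i j, Measurable fun a => A a i j) (hv : Measurable v) :
    Measurable fun a => Matrix.toEuclideanLin (A a) (v a) := by
  refine (WithLp.measurable_toLp 2 (ι → ℝ)).comp (measurable_pi_lambda _ fun i => ?_)
  exact Finset.measurable_fun_sum _ fun j _ =>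
    (hA i j).mul (((measurable_pi_apply j).comp (WithLp.measurable_ofLp 2 (ι → ℝ))).comp hv)

end MatrixMeasurability

section EstimatorMeasurability

variable {d : ℕ} {T : Set ℝ} {Θ : Set (EuclideanSpace ℝ (Fin d))}
  {lam : EuclideanSpace ℝ (Fin d) → ℝ → ℝ}

namespace RegularityL0

lemma measurable_uncurry_indicator_score (hL0 : RegularityL0 T Θ lam) (hΘ : IsOpen Θ)
    (hT : MeasurableSet T) (hlam : IsIntensityFamily T Θ lam) :
    Measurable (Function.uncurry fun (θ : Θ) t => T.indicator (score lam θ) t) := by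
  refine measurable_uncurry_of_continuous_of_measurable
    (u := fun (θ : Θ) t => T.indicator (score lam θ) t) (fun t => ?_)
    fun θ => hL0.measurable_indicator_score hΘ hT hlam θ.2
  by_cases ht : t ∈ T
  · simp only [Set.indicator_of_mem ht]
    exact continuous_iff_continuousAt.2 fun θ =>
      (hL0.contDiffAt_score hΘ θ.2 ht).continuousAt.comp continuousAt_subtype_val
  · simp only [Set.indicator_of_notMem ht, continuous_const]

lemma measurable_uncurry_indicator_intensity (hL0 : RegularityL0 T Θ lam)
    (hT : MeasurableSet T) (hlam : IsIntensityFamily T Θ lam) :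
    Measurable (Function.uncurry fun (θ : Θ) t => T.indicator (lam θ) t) := by
  refine measurable_uncurry_of_continuous_of_measurable
    (u := fun (θ : Θ) t => T.indicator (lam θ) t) (fun t => ?_)
    fun θ => hlam.measurable_indicator hT θ.2
  by_cases ht : t ∈ T
  · simp only [Set.indicator_of_mem ht]
    exact (Real.continuous_exp.comp (hL0.smooth t ht).continuousOn.domRestrict).congr fun θ =>
      Real.exp_log (hlam.pos θ θ.2 t ht)
  · simp only [Set.indicator_of_notMem ht, continuous_const]

lemma measurable_integral_smul_score (hL0 : RegularityL0 T Θ lam) (hΘ : IsOpen Θ)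
    (hT : MeasurableSet T) (hlam : IsIntensityFamily T Θ lam) :
    Measurable fun θ : Θ => ∫ t in T, lam θ t • score lam θ t := by
  have h := (hL0.measurable_uncurry_indicator_intensity hT hlam).smul
    (hL0.measurable_uncurry_indicator_score hΘ hT hlam)
  convert (h.stronglyMeasurable.integral_prod_right' (ν := volume.restrict T)).measurable
    using 2 with θ
  refine setIntegral_congr_fun hT fun t ht => ?_
  simp only [Pi.smul_apply', Function.uncurry_apply_pair, Set.indicator_of_mem ht]

lemma measurable_fisherInfo_apply (hL0 : RegularityL0 T Θ lam) (hΘ : IsOpen Θ)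
    (hT : MeasurableSet T) (hlam : IsIntensityFamily T Θ lam) (i j : Fin d) :
    Measurable fun θ : Θ => fisherInfo T lam θ i j := by
  have hscore := hL0.measurable_uncurry_indicator_score hΘ hT hlam
  have hcoord : ∀ i, Measurable fun p : Θ × ℝ => T.indicator (score lam p.1) p.2 i := fun i =>
    ((measurable_pi_apply i).comp (WithLp.measurable_ofLp 2 (Fin d → ℝ))).comp hscore
  have h := ((hL0.measurable_uncurry_indicator_intensity hT hlam).mul (hcoord i)).mul (hcoord j)
  convert (h.stronglyMeasurable.integral_prod_right' (ν := volume.restrict T)).measurable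
    using 2 with θ
  refine setIntegral_congr_fun hT fun t ht => ?_
  have hpos := hlam.pos θ θ.2 t ht
  simp only [Pi.mul_apply, Function.uncurry_apply_pair, Set.indicator_of_mem ht,
    hL0.gradient_eq_smul_score hΘ hlam θ.2 ht, PiLp.smul_apply, smul_eq_mul]
  field_simp

end RegularityL0

variable {Ω : Type*} {X : ℕ → Ω → StieltjesFunction ℝ}
  {θbar : ℕ → Ω → EuclideanSpace ℝ (Fin d)} {N k : ℕ}

lemma oneStepMLE_of_mem {ω : Ω} (hω : θbar N ω ∈ Θ) :
    oneStepMLE T Θ lam X θbar N k ω = θbar N ω +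
      infoInv T lam (θbar N ω) ((k : ℝ)⁻¹ • scoreSum T lam X (θbar N ω) N k ω) :=
  if_pos hω

lemma oneStepMLE_of_notMem {ω : Ω} (hω : θbar N ω ∉ Θ) :
    oneStepMLE T Θ lam X θbar N k ω = θbar N ω :=
  if_neg hω

lemma exists_measurable_retraction {E : Type*} [MeasurableSpace E] {s : Set E}
    (hs : MeasurableSet s) (hne : s.Nonempty) :
    ∃ r : E → s, Measurable r ∧ ∀ x ∈ s, (r x : E) = x := by
  classical
  obtain ⟨x₀, hx₀⟩ := hne
  have hmem : ∀ x, (if x ∈ s then x else x₀) ∈ s := fun x => by split_ifs <;> assumption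
  exact ⟨fun x => ⟨if x ∈ s then x else x₀, hmem x⟩,
    (Measurable.ite hs measurable_id measurable_const).subtype_mk (h := hmem),
    fun x hx => if_pos hx⟩

namespace RegularityL0

lemma measurable_scoreSum [MeasurableSpace Ω] (hL0 : RegularityL0 T Θ lam) (hΘ : IsOpen Θ)
    (hT : MeasurableSet T) (hlam : IsIntensityFamily T Θ lam)
    (hX : ∀ j < k, ∀ t : ℝ, Measurable fun ω => X j ω t) {q : Ω → Θ} (hq : Measurable q) :
    Measurable fun ω => scoreSum T lam X (q ω) N k ω := by
  refine Finset.measurable_fun_sum _ fun j hj =>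
    Measurable.sub ?_ ((hL0.measurable_integral_smul_score hΘ hT hlam).comp hq)
  simp only [← integral_indicator hT]
  exact measurable_integral_stieltjes (X j) (hX j (Finset.mem_Ico.1 hj).2)
    ((hL0.measurable_uncurry_indicator_score hΘ hT hlam).comp
      ((hq.comp measurable_fst).prodMk measurable_snd))

lemma measurable_oneStepMLE [MeasurableSpace Ω] (hL0 : RegularityL0 T Θ lam) (hΘ : IsOpen Θ)
    (hT : MeasurableSet T) (hlam : IsIntensityFamily T Θ lam)
    (hX : ∀ j < k, ∀ t : ℝ, Measurable fun ω => X j ω t) (hθbar : Measurable (θbar N)) :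
    Measurable (oneStepMLE T Θ lam X θbar N k) := by
  obtain hempty | hne := Θ.eq_empty_or_nonempty
  · convert hθbar using 1
    ext1 ω
    exact oneStepMLE_of_notMem (hempty ▸ Set.notMem_empty _)
  obtain ⟨r, hr, hr_eq⟩ := exists_measurable_retraction hΘ.measurableSet hne
  have hq : Measurable fun ω => r (θbar N ω) := hr.comp hθbar
  have hsum := (hL0.measurable_scoreSum (N := N) hΘ hT hlam hX hq).const_smul (k : ℝ)⁻¹
  have hstep : Measurable fun ω => infoInv T lam (r (θbar N ω))
      ((k : ℝ)⁻¹ • scoreSum T lam X (r (θbar N ω)) N k ω) :=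
    measurable_toEuclideanLin_apply (measurable_matrix_inv_apply fun i j =>
      (hL0.measurable_fisherInfo_apply hΘ hT hlam i j).comp hq) hsum
  convert hθbar.add (hstep.indicator (hθbar hΘ.measurableSet)) using 1
  ext1 ω
  by_cases hω : θbar N ω ∈ Θ
  · rw [oneStepMLE_of_mem hω, Pi.add_apply, Set.indicator_of_mem (by exact hω), hr_eq _ hω]
  · rw [oneStepMLE_of_notMem hω, Pi.add_apply, Set.indicator_of_notMem (by exact hω), add_zero]

lemma measurable_obsSigma_oneStepMLE (hL0 : RegularityL0 T Θ lam) (hΘ : IsOpen Θ)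
    (hT : MeasurableSet T) (hlam : IsIntensityFamily T Θ lam) (hNk : N ≤ k)
    (hθbar : Measurable[obsSigma X N] (θbar N)) :
    Measurable[obsSigma X k] (oneStepMLE T Θ lam X θbar N k) := by
  refine @measurable_oneStepMLE d T Θ lam Ω X θbar N k (obsSigma X k) hL0 hΘ hT hlam
    (fun j hj t => (measurable_pathSigma (X j) t).mono ?_ le_rfl) (hθbar.mono ?_ le_rfl)
  · exact le_iSup₂_of_le j (Finset.mem_range.2 hj) le_rfl
  · exact biSup_mono fun j hj => Finset.mem_range.2 ((Finset.mem_range.1 hj).trans_le hNk)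

end RegularityL0

end EstimatorMeasurability

section OneStepAsymptotics

lemma sqrt_smul_inv_smul {E : Type*} [AddCommGroup E] [Module ℝ E] (a : ℝ) (v : E) :
    √a • a⁻¹ • v = (√a)⁻¹ • v := by
  rw [smul_smul, ← div_eq_mul_inv, Real.sqrt_div_self]

lemma norm_sqrt_smul_sub_inv_sqrt_smul {E : Type*} [NormedAddCommGroup E] [NormedSpace ℝ E]
    (a : ℝ) (u v : E) : ‖√a • u - (√a)⁻¹ • v‖ = √a * ‖u - a⁻¹ • v‖ := by
  rw [← sqrt_smul_inv_smul, ← smul_sub, norm_smul, Real.norm_of_nonneg (Real.sqrt_nonneg a)]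

lemma sqrt_mul_norm_inv_smul {E : Type*} [NormedAddCommGroup E] [NormedSpace ℝ E] (a : ℝ) (v : E) :
    √a * ‖a⁻¹ • v‖ = ‖(√a)⁻¹ • v‖ := by
  simpa using (norm_sqrt_smul_sub_inv_sqrt_smul a 0 v).symm

-- The preliminary error `ρ` enters either with the rate `√N * ρ` or next to a term of order `√k`.
lemma sqrt_mul_expansion_bound {N k : ℝ} (hN : 0 < N) (hk : 0 < k) (ρ m L w₀ w₁ w₂ : ℝ) :
    √k * (N / k * ρ + L * (ρ ^ 2 * (1 + m + w₀) + ρ * w₁ + ρ * w₂)) =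
      √(N / k) * (√N * ρ) + (√k / N * (√N * ρ) * (√N * ρ) * (1 + m) + ρ * (√k * w₀) * ρ
        + ρ * (√k * w₁) + ρ * (√k * w₂)) * L := by
  have hp : 0 < √N := Real.sqrt_pos.2 hN
  have hq : 0 < √k := Real.sqrt_pos.2 hk
  have hpp : N = √N * √N := (Real.mul_self_sqrt hN.le).symm
  have hqq : k = √k * √k := (Real.mul_self_sqrt hk.le).symm
  rw [Real.sqrt_div hN.le]
  generalize √N = p at *
  generalize √k = q at *
  subst hpp hqq
  field_simp

variable {d : ℕ} {Ω : Type*} {T : Set ℝ} {Θ Θ' : Set (EuclideanSpace ℝ (Fin d))}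
  {lam : EuclideanSpace ℝ (Fin d) → ℝ → ℝ} {C c : ℝ} {X : ℕ → Ω → StieltjesFunction ℝ}
  {θbar : ℕ → Ω → EuclideanSpace ℝ (Fin d)} {θ₀ : EuclideanSpace ℝ (Fin d)}

/-- The efficient influence function: the value at one event of the linear term in the expansion
of the one-step estimator. -/
noncomputable def influence (T : Set ℝ) (lam : EuclideanSpace ℝ (Fin d) → ℝ → ℝ)
    (θ : EuclideanSpace ℝ (Fin d)) (t : ℝ) : EuclideanSpace ℝ (Fin d) :=
  infoInv T lam θ (T.indicator (score lam θ) t)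

/-- The part of the one-step estimation error that is not explained by the centered score. -/
noncomputable def oneStepRemainder (T : Set ℝ) (Θ : Set (EuclideanSpace ℝ (Fin d)))
    (lam : EuclideanSpace ℝ (Fin d) → ℝ → ℝ) (X : ℕ → Ω → StieltjesFunction ℝ)
    (θbar : ℕ → Ω → EuclideanSpace ℝ (Fin d)) (θ₀ : EuclideanSpace ℝ (Fin d)) (N k : ℕ) (ω : Ω) :
    EuclideanSpace ℝ (Fin d) :=
  oneStepMLE T Θ lam X θbar N k ω - θ₀
    - (k : ℝ)⁻¹ • infoInv T lam θ₀ (scoreNoise T lam X θ₀ N k ω)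

namespace RegularModel

lemma norm_oneStepRemainder_le (h : RegularModel T Θ' lam C c) (hΘ' : Θ' ⊆ Θ) (hθ₀ : θ₀ ∈ Θ')
    {N k : ℕ} {ω : Ω} (hmem : θbar N ω ∈ Θ') (hω : ∀ j, IsFiniteMeasure (X j ω).measure)
    (hNk : N ≤ k) (hk : 0 < k) :
    ‖oneStepRemainder T Θ lam X θbar θ₀ N k ω‖ ≤
      (N : ℝ) / k * ‖θbar N ω - θ₀‖ + expansionConst T lam C c θ₀ * (
        ‖θbar N ω - θ₀‖ ^ 2 * (1 + totalIntensity T lam θ₀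
          + ‖(k : ℝ)⁻¹ • centeredSum (intensityMeasure T (lam θ₀)) X (fun _ => (1 : ℝ)) N k ω‖)
        + ‖θbar N ω - θ₀‖ * ∑ b, ‖(k : ℝ)⁻¹ • scoreDerivNoise T lam X θ₀ b N k ω‖
        + ‖θbar N ω - θ₀‖ * ‖(k : ℝ)⁻¹ • scoreNoise T lam X θ₀ N k ω‖) := by
  rw [oneStepRemainder, oneStepMLE_of_mem (hΘ' hmem), ← map_smul]
  refine (h.norm_add_infoInv_scoreSum_sub_le hθ₀ hmem hω hNk hk).trans ?_
  have hL := h.expansionConst_nonneg hθ₀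
  have hmass := inv_mul_sum_measureReal_univ_le (Λ := intensityMeasure T (lam θ₀)) (X := X) hNk ω
  rw [h.measureReal_univ_intensityMeasure hθ₀] at hmass
  rw [add_assoc 1]
  gcongr

variable [MeasurableSpace Ω] {P : Measure Ω} [IsProbabilityMeasure P]

section Consistency

variable {N : ℕ → ℕ} {κ : ℕ → Ω → ℕ}

lemma smallInProb_scoreNoise (h : RegularModel T Θ lam C c) (hθ₀ : θ₀ ∈ Θ)
    (hX : IsPoissonSample P T (lam θ₀) X) (hN : Tendsto N atTop atTop)
    (hκ : ∀ n ω, N n ≤ κ n ω) :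
    SmallInProb P fun n ω => ‖(κ n ω : ℝ)⁻¹ • scoreNoise T lam X θ₀ (N n) (κ n ω) ω‖ :=
  have := h.isFiniteMeasure_intensityMeasure hθ₀
  (h.isPoissonMeasureSample hθ₀ hX).smallInProb_centeredSum (h.measurable_score θ₀ hθ₀)
    (h.integrable_indicator_score _ hθ₀) hN hκ

lemma smallInProb_sum_scoreDerivNoise (h : RegularModel T Θ lam C c) (hθ₀ : θ₀ ∈ Θ)
    (hX : IsPoissonSample P T (lam θ₀) X) (hN : Tendsto N atTop atTop)
    (hκ : ∀ n ω, N n ≤ κ n ω) :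
    SmallInProb P fun n ω =>
      ∑ b, ‖(κ n ω : ℝ)⁻¹ • scoreDerivNoise T lam X θ₀ b (N n) (κ n ω) ω‖ :=
  have := h.isFiniteMeasure_intensityMeasure hθ₀
  SmallInProb.sum _ fun b _ => (h.isPoissonMeasureSample hθ₀ hX).smallInProb_centeredSum
    (h.measurable_scoreDeriv hθ₀ b) (h.integrable_scoreDeriv _ hθ₀ b) hN hκ

lemma smallInProb_oneStepRemainder (h : RegularModel T Θ' lam C c) (hΘ' : Θ' ⊆ Θ) (hθ₀ : θ₀ ∈ Θ')
    (hX : IsPoissonSample P T (lam θ₀) X) (hθbar : SmallInProb P fun n ω => ‖θbar n ω - θ₀‖)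
    (hN : Tendsto N atTop atTop) (hκ : ∀ n ω, N n < κ n ω) :
    SmallInProb P fun n ω => ‖oneStepRemainder T Θ lam X θbar θ₀ (N n) (κ n ω) ω‖ := by
  have := h.isFiniteMeasure_intensityMeasure hθ₀
  have hS := h.isPoissonMeasureSample hθ₀ hX
  have hκ' : ∀ n ω, N n ≤ κ n ω := fun n ω => (hκ n ω).le
  have hL := h.expansionConst_nonneg hθ₀
  have hm := h.totalIntensity_nonneg hθ₀
  have hρ := hθbar.comp hN
  have hmass := hS.smallInProb_centeredSum (f := fun _ => (1 : ℝ)) measurable_const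
    (integrable_const _) hN hκ'
  have hquad := (hρ.mul_boundedInProb hρ.boundedInProb fun _ _ => norm_nonneg _).mul_boundedInProb
    ((BoundedInProb.const P (1 + totalIntensity T lam θ₀)).add hmass.boundedInProb)
    fun _ _ => by positivity
  have hderiv := hρ.mul_boundedInProb
    (h.smallInProb_sum_scoreDerivNoise hθ₀ hX hN hκ').boundedInProb
    fun _ _ => Finset.sum_nonneg fun _ _ => norm_nonneg _
  have hscore := hρ.mul_boundedInProb (h.smallInProb_scoreNoise hθ₀ hX hN hκ').boundedInProb
    fun _ _ => norm_nonneg _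
  have hrem := ((hquad.add hderiv).add hscore).mul_boundedInProb
    (BoundedInProb.const P (expansionConst T lam C c θ₀)) fun _ _ => hL
  refine (hρ.add hrem).mono ((hθbar.tendsto_measure_notMem (h.isOpen.mem_nhds hθ₀)).comp hN)
    (Eventually.of_forall fun n => ?_)
  filter_upwards [hS.ae_isFiniteMeasure] with ω hω hmem
  have hratio : (N n : ℝ) / κ n ω * ‖θbar (N n) ω - θ₀‖ ≤ ‖θbar (N n) ω - θ₀‖ :=
    mul_le_of_le_one_left (norm_nonneg _)
      (div_le_one_of_le₀ (by exact_mod_cast hκ' n ω) (Nat.cast_nonneg _))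
  refine (h.norm_oneStepRemainder_le hΘ' hθ₀ (not_not.1 hmem) hω (hκ' n ω)
    ((N n).zero_le.trans_lt (hκ n ω))).trans ?_
  linarith

lemma smallInProb_oneStepMLE_sub (h : RegularModel T Θ' lam C c) (hΘ' : Θ' ⊆ Θ) (hθ₀ : θ₀ ∈ Θ')
    (hX : IsPoissonSample P T (lam θ₀) X) (hθbar : SmallInProb P fun n ω => ‖θbar n ω - θ₀‖)
    (hN : Tendsto N atTop atTop) (hκ : ∀ n ω, N n < κ n ω) :
    SmallInProb P fun n ω => ‖oneStepMLE T Θ lam X θbar (N n) (κ n ω) ω - θ₀‖ := by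
  have hlin := (h.smallInProb_scoreNoise hθ₀ hX hN fun n ω => (hκ n ω).le).mul_boundedInProb
    (BoundedInProb.const P c⁻¹) fun _ _ => inv_nonneg.2 h.info_pos.le
  refine ((h.smallInProb_oneStepRemainder hΘ' hθ₀ hX hθbar hN hκ).add hlin).mono_of_le
    fun n ω => (norm_le_norm_sub_add _ _).trans (add_le_add_right ?_ _)
  rw [← map_smul, mul_comm]
  exact h.norm_infoInv_le hθ₀ _

lemma tendsto_measure_exists_oneStepMLE_sub_ge (h : RegularModel T Θ' lam C c) (hΘ' : Θ' ⊆ Θ)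
    (hθ₀ : θ₀ ∈ Θ') (hX : IsPoissonSample P T (lam θ₀) X)
    (hθbar : SmallInProb P fun n ω => ‖θbar n ω - θ₀‖) (hN : Tendsto N atTop atTop) {ε : ℝ}
    (hε : 0 < ε) :
    Tendsto (fun n => P {ω | ∃ k, N n < k ∧ ε ≤ ‖oneStepMLE T Θ lam X θbar (N n) k ω - θ₀‖})
      atTop (𝓝 0) :=
  SmallInProb.tendsto_measure_exists_ge
    (Z := fun n k ω => ‖oneStepMLE T Θ lam X θbar (N n) k ω - θ₀‖)
    (fun _ hκ => h.smallInProb_oneStepMLE_sub hΘ' hθ₀ hX hθbar hN hκ) hε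

end Consistency

section Normality

variable {N k : ℕ → ℕ}

lemma measurable_influence (h : RegularModel T Θ lam C c) (hθ₀ : θ₀ ∈ Θ) :
    Measurable (influence T lam θ₀) :=
  (infoInv T lam θ₀).continuous_of_finiteDimensional.measurable.comp (h.measurable_score θ₀ hθ₀)

lemma norm_influence_le (h : RegularModel T Θ lam C c) (hθ₀ : θ₀ ∈ Θ) (t : ℝ) :
    ‖influence T lam θ₀ t‖ ≤ c⁻¹ * C :=
  (h.norm_infoInv_le hθ₀ _).trans (mul_le_mul_of_nonneg_left (h.norm_indicator_score_le hθ₀ t)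
    (inv_nonneg.2 h.info_pos.le))

lemma tendstoInDistribution_centeredSum_influence (h : RegularModel T Θ lam C c) (hθ₀ : θ₀ ∈ Θ)
    (hX : IsPoissonSample P T (lam θ₀) X) (hk : Tendsto k atTop atTop)
    (hNk : Tendsto (fun n => (N n : ℝ) / k n) atTop (𝓝 0)) :
    TendstoInDistribution (fun n ω => (√(k n : ℝ))⁻¹ •
        centeredSum (intensityMeasure T (lam θ₀)) X (influence T lam θ₀) (N n) (k n) ω)
      atTop id (fun _ => P) (multivariateGaussian 0 (fisherInfo T lam θ₀)⁻¹) := by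
  have := h.isFiniteMeasure_intensityMeasure hθ₀
  have hcov (u : EuclideanSpace ℝ (Fin d)) :
      ∫ t, (inner ℝ (influence T lam θ₀ t) u) ^ 2 ∂intensityMeasure T (lam θ₀) =
        u.ofLp ⬝ᵥ (fisherInfo T lam θ₀)⁻¹.mulVec u.ofLp := by
    rw [h.integral_intensityMeasure hθ₀, ← h.integral_inner_infoInv_score_sq hθ₀]
    refine setIntegral_congr_fun h.measurableSet fun t ht => ?_
    simp only [influence, Set.indicator_of_mem ht, smul_eq_mul]
  exact (h.isPoissonMeasureSample hθ₀ hX).tendstoInDistribution_centeredSum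
    (h.measurable_influence hθ₀) (MemLp.of_bound (h.measurable_influence hθ₀).aestronglyMeasurable
      _ (ae_of_all _ (h.norm_influence_le hθ₀))) (h.posSemidef_fisherInfo_inv hθ₀) hcov hk hNk

lemma boundedInProb_scoreNoise (h : RegularModel T Θ lam C c) (hθ₀ : θ₀ ∈ Θ)
    (hX : IsPoissonSample P T (lam θ₀) X) (hk : Tendsto k atTop atTop)
    (hNk : Tendsto (fun n => (N n : ℝ) / k n) atTop (𝓝 0)) :
    BoundedInProb P fun n ω => ‖(√(k n : ℝ))⁻¹ • scoreNoise T lam X θ₀ (N n) (k n) ω‖ :=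
  have := h.isFiniteMeasure_intensityMeasure hθ₀
  (h.isPoissonMeasureSample hθ₀ hX).boundedInProb_centeredSum (h.measurable_score θ₀ hθ₀)
    (h.memLp_indicator_score _ hθ₀ 2) hk hNk

lemma boundedInProb_sum_scoreDerivNoise (h : RegularModel T Θ lam C c) (hθ₀ : θ₀ ∈ Θ)
    (hX : IsPoissonSample P T (lam θ₀) X) (hk : Tendsto k atTop atTop)
    (hNk : Tendsto (fun n => (N n : ℝ) / k n) atTop (𝓝 0)) :
    BoundedInProb P fun n ω =>
      ∑ b, ‖(√(k n : ℝ))⁻¹ • scoreDerivNoise T lam X θ₀ b (N n) (k n) ω‖ :=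
  have := h.isFiniteMeasure_intensityMeasure hθ₀
  BoundedInProb.sum _ fun b _ => (h.isPoissonMeasureSample hθ₀ hX).boundedInProb_centeredSum
    (h.measurable_scoreDeriv hθ₀ b) (h.memLp_scoreDeriv _ hθ₀ b 2) hk hNk

lemma smallInProb_sqrt_mul_oneStepRemainder (h : RegularModel T Θ' lam C c) (hΘ' : Θ' ⊆ Θ)
    (hθ₀ : θ₀ ∈ Θ') (hX : IsPoissonSample P T (lam θ₀) X)
    (hsmall : SmallInProb P fun n ω => ‖θbar n ω - θ₀‖)
    (hbdd : BoundedInProb P fun n ω => √(n : ℝ) * ‖θbar n ω - θ₀‖)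
    (hN : Tendsto N atTop atTop) (hk : Tendsto k atTop atTop)
    (hNk : Tendsto (fun n => (N n : ℝ) / k n) atTop (𝓝 0))
    (hkN : Tendsto (fun n => √(k n : ℝ) / N n) atTop (𝓝 0)) :
    SmallInProb P fun n ω =>
      √(k n : ℝ) * ‖oneStepRemainder T Θ lam X θbar θ₀ (N n) (k n) ω‖ := by
  have := h.isFiniteMeasure_intensityMeasure hθ₀
  have hS := h.isPoissonMeasureSample hθ₀ hX
  have hL := h.expansionConst_nonneg hθ₀
  have hm := h.totalIntensity_nonneg hθ₀
  have hmass := hS.boundedInProb_centeredSum (f := fun _ => (1 : ℝ)) measurable_const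
    (memLp_const _) hk hNk
  have hρ := hsmall.comp hN
  have hrate := hbdd.comp hN
  have hrate0 : ∀ n ω, 0 ≤ √(N n : ℝ) * ‖θbar (N n) ω - θ₀‖ := fun _ _ => by positivity
  have hprelim := (SmallInProb.of_tendsto P
    ((Real.continuous_sqrt.tendsto' 0 0 Real.sqrt_zero).comp hNk)).mul_boundedInProb hrate hrate0
  have hquad := (((SmallInProb.of_tendsto P hkN).mul_boundedInProb hrate hrate0).mul_boundedInProb
    hrate hrate0).mul_boundedInProb (BoundedInProb.const P (1 + totalIntensity T lam θ₀))
      fun _ _ => by positivity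
  have hcross := (((hρ.mul_boundedInProb hmass fun _ _ => norm_nonneg _).mul_boundedInProb
    hρ.boundedInProb fun _ _ => norm_nonneg _).add (hρ.mul_boundedInProb
      (h.boundedInProb_sum_scoreDerivNoise hθ₀ hX hk hNk)
        fun _ _ => Finset.sum_nonneg fun _ _ => norm_nonneg _)).add
          (hρ.mul_boundedInProb (h.boundedInProb_scoreNoise hθ₀ hX hk hNk)
            fun _ _ => norm_nonneg _)
  have hrem := (hquad.add hcross).mul_boundedInProb
    (BoundedInProb.const P (expansionConst T lam C c θ₀)) fun _ _ => hL
  refine (hprelim.add hrem).mono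
    ((hsmall.tendsto_measure_notMem (h.isOpen.mem_nhds hθ₀)).comp hN) ?_
  filter_upwards [hN.eventually_gt_atTop 0, hk.eventually_gt_atTop 0,
    hNk.eventually_le_const one_pos] with n hN0 hk0 hle
  filter_upwards [hS.ae_isFiniteMeasure] with ω hω hmem
  have hk0' : (0 : ℝ) < k n := Nat.cast_pos.2 hk0
  have hNk' : N n ≤ k n := by exact_mod_cast (div_le_one hk0').1 hle
  refine (mul_le_mul_of_nonneg_left (h.norm_oneStepRemainder_le hΘ' hθ₀ (not_not.1 hmem) hω
    hNk' hk0) (Real.sqrt_nonneg _)).trans_eq ?_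
  rw [sqrt_mul_expansion_bound (Nat.cast_pos.2 hN0) hk0', Finset.mul_sum]
  simp only [sqrt_mul_norm_inv_smul, Function.comp_apply]
  ring

lemma tendstoInDistribution_sqrt_smul_oneStepMLE_sub (h : RegularModel T Θ' lam C c)
    (hΘ' : Θ' ⊆ Θ) (hθ₀ : θ₀ ∈ Θ') (hX : IsPoissonSample P T (lam θ₀) X)
    (hsmall : SmallInProb P fun n ω => ‖θbar n ω - θ₀‖)
    (hbdd : BoundedInProb P fun n ω => √(n : ℝ) * ‖θbar n ω - θ₀‖)
    (hmeas : ∀ n, Measurable (oneStepMLE T Θ lam X θbar (N n) (k n)))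
    (hN : Tendsto N atTop atTop) (hk : Tendsto k atTop atTop)
    (hNk : Tendsto (fun n => (N n : ℝ) / k n) atTop (𝓝 0))
    (hkN : Tendsto (fun n => √(k n : ℝ) / N n) atTop (𝓝 0)) :
    TendstoInDistribution
      (fun n ω => √(k n : ℝ) • (oneStepMLE T Θ lam X θbar (N n) (k n) ω - θ₀))
      atTop id (fun _ => P) (multivariateGaussian 0 (fisherInfo T lam θ₀)⁻¹) := by
  have := h.isFiniteMeasure_intensityMeasure hθ₀
  have hrem := h.smallInProb_sqrt_mul_oneStepRemainder hΘ' hθ₀ hX hsmall hbdd hN hk hNk hkN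
  refine tendstoInDistribution_of_tendstoInMeasure_sub _ _
    (h.tendstoInDistribution_centeredSum_influence hθ₀ hX hk hNk)
    (tendstoInMeasure_iff_norm.2 ?_)
    fun n => (((hmeas n).sub_const θ₀).const_smul √(k n : ℝ)).aemeasurable
  refine hrem.mono (B := fun _ => ∅) (by simp) (Eventually.of_forall fun n => ?_)
  filter_upwards [(h.isPoissonMeasureSample hθ₀ hX).ae_isFiniteMeasure] with ω hω _
  have hinfluence : centeredSum (intensityMeasure T (lam θ₀)) X (influence T lam θ₀) (N n) (k n) ω =
      infoInv T lam θ₀ (scoreNoise T lam X θ₀ (N n) (k n) ω) :=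
    centeredSum_clm_comp (infoInv T lam θ₀).toContinuousLinearMap
      (h.integrable_indicator_score _ hθ₀) fun j =>
        have := hω j
        h.integrable_indicator_score _ hθ₀
  simp only [Pi.sub_apply, Pi.zero_apply, sub_zero]
  rw [hinfluence, norm_sqrt_smul_sub_inv_sqrt_smul, oneStepRemainder]

end Normality

end RegularModel

end OneStepAsymptotics

section MainTheorem

variable {d : ℕ} {Ω : Type*} [MeasurableSpace Ω] {P : Measure Ω} {T : Set ℝ} {r : ℝ → ℝ}
  {X : ℕ → Ω → StieltjesFunction ℝ} {θbar : ℕ → Ω → EuclideanSpace ℝ (Fin d)}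
  {θ₀ : EuclideanSpace ℝ (Fin d)}

lemma IsPoissonSample.obsSigma_le (hX : IsPoissonSample P T r X) (n : ℕ) :
    obsSigma X n ≤ ‹MeasurableSpace Ω› :=
  iSup₂_le fun j _ => iSup_le fun t =>
    (BorelSpace.measurable_eq (α := ℝ)) ▸ ((hX.poisson j).measurable t).comap_le

namespace PreliminaryP0

lemma smallInProb (h : PreliminaryP0 P X θ₀ θbar) : SmallInProb P fun n ω => ‖θbar n ω - θ₀‖ :=
  tendstoInMeasure_iff_norm.1 h.consistent

lemma boundedInProb (h : PreliminaryP0 P X θ₀ θbar) :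
    BoundedInProb P fun n ω => √(n : ℝ) * ‖θbar n ω - θ₀‖ := fun ε hε => by
  refine (h.bounded_in_prob ε hε).imp fun M hM => Eventually.of_forall fun n => ?_
  simpa only [norm_smul, Real.norm_of_nonneg (Real.sqrt_nonneg _)] using hM n

end PreliminaryP0

end MainTheorem

theorem theorem3_general {d : ℕ} {Ω : Type*} [MeasurableSpace Ω] (P : Measure Ω)
    [IsProbabilityMeasure P] (T : Set ℝ) (hT : MeasurableSet T)
    (Θ : Set (EuclideanSpace ℝ (Fin d))) (hΘ_open : IsOpen Θ)
    (lam : EuclideanSpace ℝ (Fin d) → ℝ → ℝ) (hlam : IsIntensityFamily T Θ lam)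
    (hL0 : RegularityL0 T Θ lam)
    (θ₀ : EuclideanSpace ℝ (Fin d)) (hθ₀ : θ₀ ∈ Θ)
    (X : ℕ → Ω → StieltjesFunction ℝ) (hX : IsPoissonSample P T (lam θ₀) X)
    (θbar : ℕ → Ω → EuclideanSpace ℝ (Fin d)) (hP0 : PreliminaryP0 P X θ₀ θbar)
    (δ : ℝ) (hδ : δ ∈ Set.Ioo (1 / 2 : ℝ) 1) :
    (∀ n k : ℕ, learnSize δ n < k →
      Measurable[obsSigma X k] (oneStepMLE T Θ lam X θbar (learnSize δ n) k)) ∧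
    (∀ ε : ℝ, 0 < ε → Tendsto (fun n : ℕ => P {ω | ∃ k : ℕ, learnSize δ n < k ∧
      ε ≤ ‖oneStepMLE T Θ lam X θbar (learnSize δ n) k ω - θ₀‖}) atTop (𝓝 0)) ∧
    (∀ s : ℝ, 0 < s → TendstoInDistribution
      (fun (n : ℕ) ω => √(⌊s * n⌋₊ : ℝ) •
        (oneStepMLE T Θ lam X θbar (learnSize δ n) ⌊s * n⌋₊ ω - θ₀))
      atTop id (fun _ => P) (multivariateGaussian 0 (fisherInfo T lam θ₀)⁻¹)) := by
  obtain ⟨r, hr, hball⟩ := Metric.isOpen_iff.1 hΘ_open θ₀ hθ₀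
  have hθ₀' := Metric.mem_ball_self (x := θ₀) hr
  obtain ⟨C, c, hmodel⟩ := exists_regularModel hT Metric.isOpen_ball (convex_ball θ₀ r)
    Metric.isBounded_ball (hlam.mono hball) (hL0.mono hball)
  have hδ0 : 0 < δ := one_half_pos.trans hδ.1
  have hN := tendsto_learnSize hδ0
  have hadapted (n k : ℕ) (hk : learnSize δ n < k) :=
    hL0.measurable_obsSigma_oneStepMLE (X := X) hΘ_open hT hlam hk.le (hP0.estimator _)
  have hconsistent (ε : ℝ) (hε : 0 < ε) :=
    hmodel.tendsto_measure_exists_oneStepMLE_sub_ge hball hθ₀' hX hP0.smallInProb hN hε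
  refine ⟨hadapted, hconsistent, fun s hs => ?_⟩
  refine hmodel.tendstoInDistribution_sqrt_smul_oneStepMLE_sub hball hθ₀' hX hP0.smallInProb
    hP0.boundedInProb (fun n => ?_) hN (tendsto_natFloor_mul hs)
    (tendsto_learnSize_div_natFloor hδ0 hδ.2 hs)
    (tendsto_sqrt_natFloor_div_learnSize hδ.1 hs.le)
  exact hL0.measurable_oneStepMLE hΘ_open hT hlam (fun j _ => (hX.poisson j).measurable)
    ((hP0.estimator _).mono (hX.obsSigma_le _) le_rfl)

theorem theorem3 {d : ℕ} {Ω : Type*} [MeasurableSpace Ω] (P : Measure Ω) [IsProbabilityMeasure P]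
    (T : Set ℝ) (hT : T.OrdConnected)
    (Θ : Set (EuclideanSpace ℝ (Fin d))) (hΘ_open : IsOpen Θ) (hΘ_convex : Convex ℝ Θ)
    (hΘ_bounded : Bornology.IsBounded Θ)
    (lam : EuclideanSpace ℝ (Fin d) → ℝ → ℝ) (hlam : IsIntensityFamily T Θ lam)
    (hL0 : RegularityL0 T Θ lam)
    (θ₀ : EuclideanSpace ℝ (Fin d)) (hθ₀ : θ₀ ∈ Θ)
    (X : ℕ → Ω → StieltjesFunction ℝ) (hX : IsPoissonSample P T (lam θ₀) X)
    (θbar : ℕ → Ω → EuclideanSpace ℝ (Fin d)) (hP0 : PreliminaryP0 P X θ₀ θbar)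
    (δ : ℝ) (hδ : δ ∈ Set.Ioo (1 / 2 : ℝ) 1) :
    (∀ n k : ℕ, learnSize δ n < k → k ≤ n →
      Measurable[obsSigma X k] (oneStepMLE T Θ lam X θbar (learnSize δ n) k)) ∧
    (∀ ε : ℝ, 0 < ε → Tendsto (fun n : ℕ => P {ω | ∃ k : ℕ, learnSize δ n < k ∧ k ≤ n ∧
      ε ≤ ‖oneStepMLE T Θ lam X θbar (learnSize δ n) k ω - θ₀‖}) atTop (𝓝 0)) ∧
    (∀ s ∈ Set.Ioc (0 : ℝ) 1, TendstoInDistribution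
      (fun (n : ℕ) ω => √(⌊s * n⌋₊ : ℝ) •
        (oneStepMLE T Θ lam X θbar (learnSize δ n) ⌊s * n⌋₊ ω - θ₀))
      atTop id (fun _ => P) (multivariateGaussian 0 (fisherInfo T lam θ₀)⁻¹)) := by
  obtain ⟨hadapted, hconsistent, hnormal⟩ := theorem3_general P T hT.measurableSet Θ hΘ_open lam
    hlam hL0 θ₀ hθ₀ X hX θbar hP0 δ hδ
  exact ⟨fun n k hk _ => hadapted n k hk, fun ε hε => tendsto_measure_zero_of_subset
    (hconsistent ε hε) fun _ _ ⟨k, hk, _, hkε⟩ => ⟨k, hk, hkε⟩, fun s hs => hnormal s hs.1⟩
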